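/- An \emph{arena} is a finite bipartite directed graph with non-empty set of nodes $V = V_0 \sqcup V_1$ and edge set $E \subseteq (V_0 \times V_1) \cup (V_1 \times V_0)$ in which every node has an outgoing edge. A \emph{Muller game} $\mathcal{G}$ consists of an arena and of winning conditions $\mathcal{F}_0, \mathcal{F}_1$ with $\mathcal{F}_0 \cup \mathcal{F}_1 = 2^V$ and $\mathcal{F}_0 \cap \mathcal{F}_1 = \emptyset$. A play is an infinite path $\rho = v_0, v_1, \dots$, where the owner of $v_i$ (Player $\sigma$ if $v_i \in V_\sigma$) chooses $v_{i+1}$; Player $\sigma$ wins $\rho$ if the set of nodes that occur infinitely often in $\rho$ belongs to $\mathcal{F}_\sigma$. Player $\sigma$ wins $\mathcal{G}$ from $v$ if she has a strategy (a function of the history of the play) with which she wins every play from $v$. The game is given explicitly, with $V = \{0, \dots, n-1\}$, by the owners of the nodes, a list of the edges and a list of the sets in $\mathcal{F}_0$, each coded as a binary string of length $|V|$; its size is $|\mathcal{G}| = |V| + |E| + |\mathcal{F}_0| \cdot |V|$. \textbf{Theorem.} There is an algorithm that decides Muller games in time $O(2^{|V|} |V| |E|)$ and space $O(|\mathcal{G}|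 + 2^{|V|})$. That is, there are a program for the random access machine (with addition, truncated subtraction, comparison and indirect addressing, each in one step) and a constant $C$ such that, for every Muller game $\mathcal{G}$ and every such presentation of it, the program halts after at most $C \cdot 2^{|V|} |V| |E|$ steps, uses words of at most $C \cdot |V|$ bits and altogether at most $C \cdot (|\mathcal{G}| + 2^{|V|})$ bits of space (including the input) at every moment, and outputs for every $v \in V$ a player $\sigma(v) \in \{0, 1\}$ such that, for each $\sigma \in \{0,1\}$, Player $\sigma$ wins $\mathcal{G}$ from $v$ if and only if $\sigma = \sigma(v)$. -/

import Mathlib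

/-! ## Arenas and Muller games -/

/-- An arena on the set of positions `V`: a bipartite directed graph in which every node has an
outgoing edge.  The partition of `V` into the positions `V₀` of Player 0 and `V₁` of Player 1 is
given by `owner`, so that `V_σ = {v | owner v = σ}`. -/
structure Arena (V : Type*) where
  owner : V → Fin 2
  edges : Finset (V × V)
  bipartite : ∀ u v, (u, v) ∈ edges → owner u ≠ owner v
  total : ∀ u, ∃ v, (u, v) ∈ edges

/-- A Muller game: an arena with winning conditions `F 0` and `F 1` that partition the
collection of all subsets of `V`. -/
structure MullerGame (V : Type*) extends Arena V where
  F : Fin 2 → Finset (Finset V)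
  cover : ∀ X, X ∈ F 0 ∨ X ∈ F 1
  disjoint : ∀ X, ¬ (X ∈ F 0 ∧ X ∈ F 1)

namespace Arena

variable {V : Type*}

/-- `ρ` is a play starting at `v`. -/
def IsPlay (A : Arena V) (v : V) (ρ : ℕ → V) : Prop :=
  ρ 0 = v ∧ ∀ i, (ρ i, ρ (i + 1)) ∈ A.edges

/-- `f` is a strategy of Player `σ`: it maps every history that ends in a position of Player `σ`
to a successor of that position. -/
def IsStrategy (A : Arena V) (σ : Fin 2) (f : List V → V) : Prop :=
  ∀ (h : List V) (v : V), A.owner v = σ → (v, f (h ++ [v])) ∈ A.edges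

/-- In the play `ρ` Player `σ` always moves according to `f`, which sees the whole history
`ρ 0, …, ρ i`. -/
def Follows (A : Arena V) (σ : Fin 2) (f : List V → V) (ρ : ℕ → V) : Prop :=
  ∀ i, A.owner (ρ i) = σ → ρ (i + 1) = f ((List.range (i + 1)).map ρ)

end Arena

open Classical in
/-- The infinity set of a play: the positions that occur infinitely often. -/
noncomputable def infinitySet {V : Type*} [Fintype V] (ρ : ℕ → V) : Finset V :=
  Finset.univ.filter fun v => {i | ρ i = v}.Infinite

/-- Player `σ` wins the game `G` starting at `v`: she has a strategy such that she wins every play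
from `v` that follows it. -/
def MullerGame.WinsFrom {V : Type*} [Fintype V] (G : MullerGame V) (σ : Fin 2) (v : V) : Prop :=
  ∃ f : List V → V, G.IsStrategy σ f ∧
    ∀ ρ : ℕ → V, G.IsPlay v ρ → G.Follows σ f ρ → infinitySet ρ ∈ G.F σ

/-! ## Random access machines

Programs over finitely many registers and a memory that is addressed by numbers.  The arithmetic
consists of addition, truncated subtraction and comparison. -/

namespace RAM

/-- A state of the machine: the contents of the registers and of the memory cells. -/
structure State where
  reg : ℕ → ℕ
  mem : ℕ → ℕ

/-- Expressions; `load e` is the content of the memory cell whose address is the value of `e`. -/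
inductive Expr where
  | lit (k : ℕ)
  | reg (x : ℕ)
  | load (e : Expr)
  | add (e₁ e₂ : Expr)
  | sub (e₁ e₂ : Expr)
  | lt (e₁ e₂ : Expr)
  | eq (e₁ e₂ : Expr)

/-- The value of an expression (comparisons yield `1` for true and `0` for false). -/
def Expr.eval (s : State) : Expr → ℕ
  | .lit k => k
  | .reg x => s.reg x
  | .load e => s.mem (e.eval s)
  | .add e₁ e₂ => e₁.eval s + e₂.eval s
  | .sub e₁ e₂ => e₁.eval s - e₂.eval s
  | .lt e₁ e₂ => if e₁.eval s < e₂.eval s then 1 else 0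
  | .eq e₁ e₂ => if e₁.eval s = e₂.eval s then 1 else 0

/-- The number of steps that the evaluation of an expression takes: one for each node. -/
def Expr.cost : Expr → ℕ
  | .lit _ => 1
  | .reg _ => 1
  | .load e => e.cost + 1
  | .add e₁ e₂ => e₁.cost + e₂.cost + 1
  | .sub e₁ e₂ => e₁.cost + e₂.cost + 1
  | .lt e₁ e₂ => e₁.cost + e₂.cost + 1
  | .eq e₁ e₂ => e₁.cost + e₂.cost + 1

/-- Programs. -/
inductive Program where
  | skip
  | assign (x : ℕ) (e : Expr)
  | store (address value : Expr)
  | seq (p q : Program)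
  | ite (e : Expr) (p q : Program)
  | while (e : Expr) (p : Program)

/-- Write `k` into register `x`. -/
def State.setReg (s : State) (x k : ℕ) : State :=
  { s with reg := Function.update s.reg x k }

/-- Write `k` into the memory cell with address `a`. -/
def State.setMem (s : State) (a k : ℕ) : State :=
  { s with mem := Function.update s.mem a k }

/-- `Run Ok p s t s'`: started in state `s`, the program `p` halts after exactly `t` steps in
state `s'`, and each state that arises after the start satisfies `Ok`. -/
inductive Run (Ok : State → Prop) : Program → State → ℕ → State → Prop
  | skip (s : State) : Run Ok .skip s 1 s
  | assign (x : ℕ) (e : Expr) (s : State) (ok : Ok (s.setReg x (e.eval s))) :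
      Run Ok (.assign x e) s (e.cost + 1) (s.setReg x (e.eval s))
  | store (a e : Expr) (s : State) (ok : Ok (s.setMem (a.eval s) (e.eval s))) :
      Run Ok (.store a e) s (a.cost + e.cost + 1) (s.setMem (a.eval s) (e.eval s))
  | seq {p q : Program} {s s' s'' : State} {t t' : ℕ} (hp : Run Ok p s t s')
      (hq : Run Ok q s' t' s'') : Run Ok (.seq p q) s (t + t') s''
  | iteTrue {e : Expr} {p q : Program} {s s' : State} {t : ℕ} (he : e.eval s ≠ 0)
      (hp : Run Ok p s t s') : Run Ok (.ite e p q) s (e.cost + 1 + t) s'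
  | iteFalse {e : Expr} {p q : Program} {s s' : State} {t : ℕ} (he : e.eval s = 0)
      (hq : Run Ok q s t s') : Run Ok (.ite e p q) s (e.cost + 1 + t) s'
  | whileFalse {e : Expr} {p : Program} {s : State} (he : e.eval s = 0) :
      Run Ok (.while e p) s (e.cost + 1) s
  | whileTrue {e : Expr} {p : Program} {s s' s'' : State} {t t' : ℕ} (he : e.eval s ≠ 0)
      (hp : Run Ok p s t s') (hw : Run Ok (.while e p) s' t' s'') :
      Run Ok (.while e p) s (e.cost + 1 + t + t') s''

/-- Each register and memory cell holds a number of at most `w` bits. -/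
def State.WordsFit (s : State) (w : ℕ) : Prop :=
  (∀ x, (s.reg x).size ≤ w) ∧ ∀ a, (s.mem a).size ≤ w

/-- The state takes up at most `b` bits of space: every cell of an initial segment of the registers
and of the memory that contains all nonzero cells is charged the length of its content, plus one
(so that cells that hold `0` are charged, too). -/
def State.SpaceFits (s : State) (b : ℕ) : Prop :=
  ∃ k l : ℕ, (∀ x, k ≤ x → s.reg x = 0) ∧ (∀ a, l ≤ a → s.mem a = 0) ∧
    ∑ x ∈ Finset.range k, ((s.reg x).size + 1) + ∑ a ∈ Finset.range l, ((s.mem a).size + 1) ≤ b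

/-- The initial state on the input `l`: the entries of `l` stand in the memory cells
`0, 1, 2, …`; all other cells and all registers hold `0`. -/
def initialState (l : List ℕ) : State where
  reg := fun _ => 0
  mem := fun a => l.getD a 0

/-- On the input `l`, the program `p` halts after at most `t` steps in state `s'`, and in every
state of the computation (including the first one) all words have at most `w` bits and the space
taken up is at most `b` bits. -/
def HaltsWithin (p : Program) (l : List ℕ) (t w b : ℕ) (s' : State) : Prop :=
  let Ok : State → Prop := fun s => s.WordsFit w ∧ s.SpaceFits b
  Ok (initialState l) ∧ ∃ t', t' ≤ t ∧ Run Ok p (initialState l) t' s'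

end RAM

/-! ## Explicitly presented Muller games -/

namespace MullerGame

/-- An explicit presentation of a game with positions `0, …, n - 1`: the edges and the sets in
`F 0` are listed without repetition, each in an arbitrary order (`F 1` is the complement). -/
structure Presentation {n : ℕ} (G : MullerGame (Fin n)) where
  edgeList : List (Fin n × Fin n)
  edgeList_nodup : edgeList.Nodup
  mem_edgeList : ∀ e, e ∈ edgeList ↔ e ∈ G.edges
  winList : List (Finset (Fin n))
  winList_nodup : winList.Nodup
  mem_winList : ∀ X, X ∈ winList ↔ X ∈ G.F 0

/-- The input that presents the game to a machine: the numbers `|V|`, `|E|`, `|F 0|`, the owners of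
the positions `0, …, n - 1`, the two ends of each edge, and for each set in `F 0` its
characteristic binary string of length `n`. -/
def Presentation.encode {n : ℕ} {G : MullerGame (Fin n)} (P : G.Presentation) : List ℕ :=
  [n, P.edgeList.length, P.winList.length]
    ++ List.ofFn (fun v : Fin n => (G.owner v : ℕ))
    ++ P.edgeList.flatMap (fun e => [(e.1 : ℕ), (e.2 : ℕ)])
    ++ P.winList.flatMap (fun X => List.ofFn (fun v : Fin n => if v ∈ X then 1 else 0))

/-- The size `|G|` of the explicit representation: `|V| + |E| + |F 0| * |V|`. -/
def size {n : ℕ} (G : MullerGame (Fin n)) : ℕ :=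
  n + G.edges.card + (G.F 0).card * n

end MullerGame

/-! ## Subarenas, traps and attractors -/

namespace MullerGame

/-! The algorithm is a dynamic program over all sets $S$ of positions. For a subarena $S$ and a
player σ with opponent τ it records whether σ wins from everywhere when the play is confined to $S$.
Winning everywhere is captured by the certificates `Good`, which have two nontrivial rules. If $S
\in \mathcal{F}_\sigma$ and σ wins everywhere on $S \setminus \mathrm{Attr}_\sigma(S, \{v\})$ for
each $v \in S$, then σ attracts the play to the positions of $S$ in cyclic order: either the play
finally stays outside one of these attractors, where she wins, or its infinity set is $S$. If σ wins
everywhere on a set $W$ that τ cannot leave, and also everywhere on $S \setminus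
\mathrm{Attr}_\sigma(S, W)$, then she wins on $S$ by gluing the strategies together.
`Good.exists_winsSub` turns certificates into strategies.

Certificates are complete: by induction on $S$, `exists_partition` splits every subarena into a part
certified for σ and a part certified for τ, neither of which the other player can leave. They are
exclusive: if $U \subseteq S$ is certified for σ, τ cannot leave $U$, and $S$ is certified for τ,
then playing both strategies against each other in $U$ shows that $U$ is empty
(`Good.eq_empty_of_isTrap`).

These two facts give the recursion `good_iff`: a nonempty subarena $S$ is good for σ iff all $S
\setminus \mathrm{Attr}_\sigma(S, \{v\})$ are, and $S \in \mathcal{F}_\sigma$ or $S$ is not good for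
τ. The second rule for certificates never has to be searched for. Indeed, if $S$ is not good for τ,
the part of σ contains some $v$; the part of τ avoids $\mathrm{Attr}_\sigma(S, \{v\})$, hence lies
in a set that is good for σ, hence is empty. By `winsFrom_iff`, Player 0 wins exactly from the
positions in good sets that Player 1 cannot leave in the full arena.

For the complexity, sets are coded by numbers. A proper subset has a smaller number, so increasing
order respects the recursion. A set needs at most $2n$ attractors, each computed in time $O(n + m)$
by a worklist on the edges sorted by their ends, and $n \le m$ since every position has an outgoing
edge. Besides the input there are three bit tables of length $2^n$ and boundedly many arrays of $O(n
+ m)$ words of $O(n)$ bits; the latter are paid for by $m \le n^2$ and $n^3 = O(2^n)$.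

The program is verified on an abstract machine `Abs` with sixteen arrays. `Runs` is a total
correctness statement with a time bound, and the invariant `Safe` of all states yields the bounds on
words and space. -/

/-- The stages of the attractor of Player `σ` to `X` in the subarena on `S`. -/
def AttrStage {V : Type*} (A : Arena V) (σ : Fin 2) (S X : Finset V) : ℕ → V → Prop
  | 0, v => v ∈ S ∧ v ∈ X
  | k + 1, v => AttrStage A σ S X k v ∨ v ∈ S ∧
      ((A.owner v = σ ∧ ∃ w, AttrStage A σ S X k w ∧ (v, w) ∈ A.edges) ∨
      (A.owner v ≠ σ ∧ ∀ w ∈ S, (v, w) ∈ A.edges → AttrStage A σ S X k w))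

open Classical in
/-- The attractor of Player `σ` to `X` in the subarena on `S`. -/
noncomputable def attr {V : Type*} (A : Arena V) (σ : Fin 2) (S X : Finset V) : Finset V :=
  S.filter fun v => ∃ k, AttrStage A σ S X k v

/-- Every position of `S` has a successor in `S`. -/
def IsSubarena {V : Type*} (A : Arena V) (S : Finset V) : Prop :=
  ∀ u ∈ S, ∃ w ∈ S, (u, w) ∈ A.edges

/-- The opponent of Player `σ` cannot leave `U` inside `S`. -/
def IsTrap {V : Type*} (A : Arena V) (σ : Fin 2) (U S : Finset V) : Prop :=
  U ⊆ S ∧ ∀ u ∈ U, A.owner u ≠ σ → ∀ w ∈ S, (u, w) ∈ A.edges → w ∈ U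

variable {V : Type*} {A : Arena V} {σ τ : Fin 2} {S X U W : Finset V}

lemma AttrStage.mem {k : ℕ} {v : V} (h : AttrStage A σ S X k v) : v ∈ S := by
  induction k with
  | zero => exact h.1
  | succ k ih => exact h.elim ih And.left

lemma mem_attr {v : V} : v ∈ attr A σ S X ↔ ∃ k, AttrStage A σ S X k v := by
  classical
  simp only [attr, Finset.mem_filter, and_iff_right_iff_imp]
  rintro ⟨k, hk⟩
  exact hk.mem

lemma AttrStage.mono {k l : ℕ} (h : k ≤ l) {v : V} (hv : AttrStage A σ S X k v) :
    AttrStage A σ S X l v := by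
  induction h with
  | refl => exact hv
  | step _ ih => exact Or.inl ih

lemma subset_attr (h : X ⊆ S) : X ⊆ attr A σ S X := fun _ hv => mem_attr.2 ⟨0, h hv, hv⟩

lemma attr_subset : attr A σ S X ⊆ S := by
  classical
  exact Finset.filter_subset _ _

lemma mem_attr_of_owner {v w : V} (hv : v ∈ S) (ho : A.owner v = σ) (hw : w ∈ attr A σ S X)
    (he : (v, w) ∈ A.edges) : v ∈ attr A σ S X := by
  obtain ⟨k, hk⟩ := mem_attr.1 hw
  exact mem_attr.2 ⟨k + 1, Or.inr ⟨hv, Or.inl ⟨ho, w, hk, he⟩⟩⟩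

lemma mem_attr_of_forall {v : V} (hv : v ∈ S) (ho : A.owner v ≠ σ)
    (h : ∀ w ∈ S, (v, w) ∈ A.edges → w ∈ attr A σ S X) : v ∈ attr A σ S X := by
  have : ∀ w : V, ∃ k, w ∈ S → (v, w) ∈ A.edges → AttrStage A σ S X k w := by
    intro w
    by_cases hw : w ∈ S ∧ (v, w) ∈ A.edges
    · obtain ⟨k, hk⟩ := mem_attr.1 (h w hw.1 hw.2)
      exact ⟨k, fun _ _ => hk⟩
    · exact ⟨0, fun h₁ h₂ => absurd ⟨h₁, h₂⟩ hw⟩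
  choose f hf using this
  -- Finitely many successors entered at finitely many stages, so one stage contains them all; here
  -- finiteness of $S$ is essential.
  exact mem_attr.2 ⟨S.sup f + 1, Or.inr ⟨hv, Or.inr ⟨ho, fun w hw he =>
    (hf w hw he).mono (Finset.le_sup hw)⟩⟩⟩

/-- The attractor is the least set that contains the target and is closed under both attraction
rules. -/
lemma attr_subset_of_closed {Y : Finset V} (hX : X ⊆ Y)
    (h₁ : ∀ v ∈ S, ∀ w ∈ S, w ∈ Y → A.owner v = σ → (v, w) ∈ A.edges → v ∈ Y)
    (h₂ : ∀ v ∈ S, A.owner v ≠ σ → (∀ w ∈ S, (v, w) ∈ A.edges → w ∈ Y) → v ∈ Y) :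
    attr A σ S X ⊆ Y := by
  intro v hv
  obtain ⟨k, hk⟩ := mem_attr.1 hv
  clear hv
  induction k generalizing v with
  | zero => exact hX hk.2
  | succ k ih =>
    rcases hk with hk | ⟨hv, ⟨ho, w, hw, he⟩ | ⟨ho, h⟩⟩
    · exact ih hk
    · exact h₁ v hv w hw.mem (ih hw) ho he
    · exact h₂ v hv ho fun w hw he => ih (h w hw he)

/-- Shrinking the arena to a set that contains the whole attractor only weakens the condition on the
opponent, so every stage survives. -/
lemma attr_subset_attr {B : Finset V} (hA : attr A σ S X ⊆ B) (hB : B ⊆ S) :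
    attr A σ S X ⊆ attr A σ B X := by
  intro v hv
  obtain ⟨k, hk⟩ := mem_attr.1 hv
  refine mem_attr.2 ⟨k, ?_⟩
  clear hv
  induction k generalizing v with
  | zero => exact ⟨hA (mem_attr.2 ⟨0, hk⟩), hk.2⟩
  | succ k ih =>
    have hvB := hA (mem_attr.2 ⟨k + 1, hk⟩)
    rcases hk with hk | ⟨_, ⟨ho, w, hw, he⟩ | ⟨ho, h⟩⟩
    · exact Or.inl (ih hk)
    · exact Or.inr ⟨hvB, Or.inl ⟨ho, w, ih hw, he⟩⟩
    · exact Or.inr ⟨hvB, Or.inr ⟨ho, fun w hw he => ih (h w (hB hw) he)⟩⟩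

/-- A rank that Player `σ` can decrease, and that her opponent has to decrease, on the attractor
outside of the target. -/
lemma exists_rank (A : Arena V) (σ : Fin 2) (S X : Finset V) :
    ∃ r : V → ℕ, ∀ v ∈ attr A σ S X, v ∉ X →
      (A.owner v = σ → ∃ w ∈ attr A σ S X, (v, w) ∈ A.edges ∧ r w < r v) ∧
      (A.owner v ≠ σ → ∀ w ∈ S, (v, w) ∈ A.edges → w ∈ attr A σ S X ∧ r w < r v) := by
  classical
  -- The rank is the first stage at which a position appears; outside the target it is positive, and
  -- the rule that added the position refers to the previous stage.
  refine ⟨fun v => if h : ∃ k, AttrStage A σ S X k v then Nat.find h else 0, ?_⟩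
  intro v hv hvX
  have hex := mem_attr.1 hv
  have hlt : ∀ k w, k + 1 = Nat.find hex → AttrStage A σ S X k w →
      w ∈ attr A σ S X ∧ (if h : ∃ k, AttrStage A σ S X k w then Nat.find h else 0) <
        (if h : ∃ k, AttrStage A σ S X k v then Nat.find h else 0) := by
    intro k w hk hw
    have hw' : ∃ k, AttrStage A σ S X k w := ⟨k, hw⟩
    rw [dif_pos hw', dif_pos hex, ← hk]
    exact ⟨mem_attr.2 hw', Nat.lt_succ_of_le (Nat.find_min' hw' hw)⟩
  have hspec := Nat.find_spec hex
  rcases hf : Nat.find hex with _ | k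
  · rw [hf] at hspec
    exact absurd hspec.2 hvX
  · have hmin := Nat.find_min hex (m := k) (by omega)
    rw [hf] at hspec
    rcases hspec with h | ⟨_, ⟨ho, w, hw, he⟩ | ⟨ho, h⟩⟩
    · exact absurd h hmin
    · exact ⟨fun _ => ⟨w, (hlt k w hf.symm hw).1, he, (hlt k w hf.symm hw).2⟩,
        fun h => absurd ho h⟩
    · exact ⟨fun h' => absurd h' ho, fun _ w hw he => hlt k w hf.symm (h w hw he)⟩

lemma IsTrap.trans (h₁ : IsTrap A σ U W) (h₂ : IsTrap A σ W S) : IsTrap A σ U S :=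
  ⟨h₁.1.trans h₂.1, fun u hu ho w hw he =>
    h₁.2 u hu ho w (h₂.2 u (h₁.1 hu) ho w hw he) he⟩

lemma IsTrap.mono (h : IsTrap A σ U S) (hU : U ⊆ W) (hW : W ⊆ S) : IsTrap A σ U W :=
  ⟨hU, fun u hu ho w hw he => h.2 u hu ho w (hW hw) he⟩

/-- The complement of an attractor of a player is a trap for that player. -/
lemma isTrap_sdiff_attr [DecidableEq V] (h : σ ≠ τ) : IsTrap A τ (S \ attr A σ S X) S := by
  refine ⟨Finset.sdiff_subset, fun u hu ho w hw he => ?_⟩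
  rw [Finset.mem_sdiff] at hu ⊢
  exact ⟨hw, fun hw' => hu.2 (mem_attr_of_owner hu.1 (by omega) hw' he)⟩

/-- A position outside the attractor keeps a successor outside: its owner σ has no edge into the
attractor, and an opponent with all successors inside would have been attracted. -/
lemma isSubarena_sdiff_attr [DecidableEq V] (h : IsSubarena A S) :
    IsSubarena A (S \ attr A σ S X) := by
  intro u hu
  rw [Finset.mem_sdiff] at hu
  by_cases ho : A.owner u = σ
  · obtain ⟨w, hw, he⟩ := h u hu.1
    exact ⟨w, Finset.mem_sdiff.2 ⟨hw, fun hw' => hu.2 (mem_attr_of_owner hu.1 ho hw' he)⟩, he⟩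
  · by_contra hcon
    push Not at hcon
    refine hu.2 (mem_attr_of_forall hu.1 ho fun w hw he => ?_)
    by_contra hw'
    exact hcon w (Finset.mem_sdiff.2 ⟨hw, hw'⟩) he

/-- A trap for the opponent of `σ` that avoids `X` avoids the attractor of the opponent to `X`. -/
lemma IsTrap.subset_sdiff_attr [DecidableEq V] (h : IsTrap A σ U S) (hU : IsSubarena A U)
    (hστ : σ ≠ τ) (hX : Disjoint U X) : U ⊆ S \ attr A τ S X := by
  intro u hu
  refine Finset.mem_sdiff.2 ⟨h.1 hu, fun hu' => ?_⟩
  obtain ⟨k, hk⟩ := mem_attr.1 hu'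
  clear hu'
  induction k generalizing u with
  | zero => exact Finset.disjoint_left.1 hX hu hk.2
  | succ k ih =>
    rcases hk with hk | ⟨hv, ⟨ho, w, hw, he⟩ | ⟨ho, h'⟩⟩
    · exact ih hu hk
    · exact ih (h.2 u hu (by omega) w hw.mem he) hw
    · obtain ⟨w, hw, he⟩ := hU u hu
      exact ih hw (h' w (h.1 hw) he)

/-- A play that decreases the rank on the attractor outside of `X` reaches `X`. -/
lemma exists_mem_of_rank {r : V → ℕ} {ρ : ℕ → V} {Y X : Finset V} {k : ℕ} (hk : ρ k ∈ Y)
    (h : ∀ j, k ≤ j → ρ j ∈ Y → ρ j ∉ X → ρ (j + 1) ∈ Y ∧ r (ρ (j + 1)) < r (ρ j)) :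
    ∃ j, k ≤ j ∧ ρ j ∈ X := by
  induction hr : r (ρ k) using Nat.strong_induction_on generalizing k with
  | _ a ih =>
    by_cases hX : ρ k ∈ X
    · exact ⟨k, le_rfl, hX⟩
    · obtain ⟨h₁, h₂⟩ := h k le_rfl hk hX
      obtain ⟨j, hj, hjX⟩ := ih _ (hr ▸ h₂) h₁ (fun j hj => h j (by omega)) rfl
      exact ⟨j, by omega, hjX⟩

/-! ## Strategies in subarenas -/

/-- `f` is a strategy of Player `σ` in the game on `S` with which she wins every play. -/
def WinsSub {V : Type*} [Fintype V] (G : MullerGame V) (σ : Fin 2) (S : Finset V)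
    (f : List V → V) : Prop :=
  (∀ h v, v ∈ S → G.owner v = σ → f (h ++ [v]) ∈ S ∧ (v, f (h ++ [v])) ∈ G.edges) ∧
    ∀ ρ : ℕ → V, (∀ i, ρ i ∈ S) → (∀ i, (ρ i, ρ (i + 1)) ∈ G.edges) → G.Follows σ f ρ →
      infinitySet ρ ∈ G.F σ

/-- The history at time `i` of the play `ρ`. -/
def history {V : Type*} (ρ : ℕ → V) (i : ℕ) : List V := (List.range (i + 1)).map ρ

lemma history_succ {V : Type*} (ρ : ℕ → V) (i : ℕ) :
    history ρ (i + 1) = history ρ i ++ [ρ (i + 1)] := by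
  simp [history, List.range_succ]

lemma history_zero {V : Type*} (ρ : ℕ → V) : history ρ 0 = [ρ 0] := rfl

lemma exists_history_eq {V : Type*} (ρ : ℕ → V) (i : ℕ) : ∃ h, history ρ i = h ++ [ρ i] := by
  cases i with
  | zero => exact ⟨[], rfl⟩
  | succ i => exact ⟨_, history_succ ρ i⟩

/-- The next move depends on the whole history, so histories are built by recursion first and the
play is read off from them. -/
lemma exists_play_of_next {V : Type*} (F : List V → V) (v : V) :
    ∃ ρ : ℕ → V, ρ 0 = v ∧ ∀ i, ρ (i + 1) = F (history ρ i) := by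
  let h : ℕ → List V := fun i => Nat.rec [v] (fun _ l => l ++ [F l]) i
  let ρ : ℕ → V := fun i => Nat.casesOn i v fun j => F (h j)
  have key : ∀ i, history ρ i = h i := by
    intro i
    induction i with
    | zero => rfl
    | succ i ih => rw [history_succ, ih]
  exact ⟨ρ, rfl, fun i => by rw [key]⟩

lemma infinitySet_shift {V : Type*} [Fintype V] (ρ : ℕ → V) (k : ℕ) :
    infinitySet (fun i => ρ (k + i)) = infinitySet ρ := by
  classical
  ext v
  simp only [infinitySet, Finset.mem_filter, Finset.mem_univ, true_and]
  rw [← Nat.frequently_atTop_iff_infinite, ← Nat.frequently_atTop_iff_infinite,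
    Filter.frequently_atTop, Filter.frequently_atTop]
  constructor
  · intro h a
    obtain ⟨b, hb, hv⟩ := h a
    exact ⟨k + b, by omega, hv⟩
  · intro h a
    obtain ⟨b, hb, hv⟩ := h (k + a)
    exact ⟨b - k, by omega, by simpa [Nat.add_sub_cancel' (show k ≤ b by omega)] using hv⟩

lemma mem_infinitySet {V : Type*} [Fintype V] {ρ : ℕ → V} {v : V} :
    v ∈ infinitySet ρ ↔ ∀ a, ∃ b, a ≤ b ∧ ρ b = v := by
  classical
  simp only [infinitySet, Finset.mem_filter, Finset.mem_univ, true_and]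
  rw [← Nat.frequently_atTop_iff_infinite, Filter.frequently_atTop]

/-! ### Strategies that switch between modes -/

section Switching

variable {V I : Type*} [DecidableEq V] [DecidableEq I] (next : I → V → I)
  (reg : I → Finset V) (i₀ : I)

/-- The mode of a switching strategy, together with the positions seen since the region of the mode
was entered. -/
def switchStep (p : I × List V) (x : V) : I × List V :=
  (next p.1 x, if x ∈ reg (next p.1 x) then (if next p.1 x = p.1 then p.2 ++ [x] else [x]) else [])

/-- The memory of a switching strategy after a history. -/
def switchMem (h : List V) : I × List V := h.foldl (switchStep next reg) (i₀, [])

/-- The strategy that plays `f i` while the mode is `i` and the play is in the region of `i`, and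
the move `g i` elsewhere. -/
noncomputable def switchStrategy [Nonempty V] (f : I → List V → V) (g : I → V → V)
    (h : List V) : V :=
  let p := switchMem next reg i₀ h
  let x := h.getLast?.getD (Classical.arbitrary V)
  if x ∈ reg p.1 then f p.1 p.2 else g p.1 x

variable {next reg i₀}

lemma switchMem_append (h : List V) (x : V) :
    switchMem next reg i₀ (h ++ [x]) = switchStep next reg (switchMem next reg i₀ h) x := by
  simp [switchMem]

lemma switchStrategy_of_mem [Nonempty V] {f : I → List V → V} {g : I → V → V} {h : List V} {x : V}
    (hx : x ∈ reg (switchMem next reg i₀ (h ++ [x])).1) :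
    switchStrategy next reg i₀ f g (h ++ [x]) =
      f (switchMem next reg i₀ (h ++ [x])).1 (switchMem next reg i₀ (h ++ [x])).2 := by
  simp [switchStrategy, hx]

lemma switchStrategy_of_notMem [Nonempty V] {f : I → List V → V} {g : I → V → V} {h : List V}
    {x : V} (hx : x ∉ reg (switchMem next reg i₀ (h ++ [x])).1) :
    switchStrategy next reg i₀ f g (h ++ [x]) = g (switchMem next reg i₀ (h ++ [x])).1 x := by
  simp [switchStrategy, hx]

lemma exists_switchMem_eq {h : List V} {x : V}
    (hx : x ∈ reg (switchMem next reg i₀ (h ++ [x])).1) :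
    ∃ l, (switchMem next reg i₀ (h ++ [x])).2 = l ++ [x] := by
  rw [switchMem_append] at hx ⊢
  simp only [switchStep] at hx ⊢
  rw [if_pos hx]
  split_ifs
  · exact ⟨_, rfl⟩
  · exact ⟨[], rfl⟩

lemma switchMem_snd_of_notMem {h : List V} {x : V}
    (hx : x ∉ reg (switchMem next reg i₀ (h ++ [x])).1) :
    (switchMem next reg i₀ (h ++ [x])).2 = [] := by
  rw [switchMem_append] at hx ⊢
  simp only [switchStep] at hx ⊢
  rw [if_neg hx]

/-- If the mode is eventually constant and the play stays in its region, then the memory is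
eventually the history of a tail of the play. -/
lemma exists_tail {ρ : ℕ → V} {i : I} {k₀ : ℕ}
    (h : ∀ j, k₀ ≤ j → (switchMem next reg i₀ (history ρ j)).1 = i ∧ ρ j ∈ reg i) :
    ∃ k, (∀ j, k ≤ j → (switchMem next reg i₀ (history ρ j)).1 = i ∧ ρ j ∈ reg i) ∧
      ∀ j, (switchMem next reg i₀ (history ρ (k + j))).2 = history (fun t => ρ (k + t)) j := by
  classical
  let P : ℕ → Prop := fun k =>
    ∀ j, k ≤ j → (switchMem next reg i₀ (history ρ j)).1 = i ∧ ρ j ∈ reg i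
  -- The least such time is taken: just before it the mode was different or the play was outside the
  -- region, so the memory was restarted there.
  have hex : ∃ k, P k := ⟨k₀, h⟩
  obtain ⟨k, hk, hmin⟩ : ∃ k, P k ∧ ∀ m < k, ¬ P m :=
    ⟨Nat.find hex, Nat.find_spec hex, fun m hm => Nat.find_min hex hm⟩
  refine ⟨k, hk, fun j => ?_⟩
  induction j with
  | zero =>
    have hk0 := hk k le_rfl
    rw [Nat.add_zero, history_zero, Nat.add_zero]
    cases k with
    | zero =>
      rw [history_zero, ← List.nil_append [ρ 0], switchMem_append] at hk0 ⊢
      simp only [switchStep] at hk0 ⊢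
      rw [hk0.1, if_pos hk0.2]
      split_ifs <;> rfl
    | succ k =>
      have hne : ¬ ((switchMem next reg i₀ (history ρ k)).1 = i ∧ ρ k ∈ reg i) := by
        intro hcon
        refine hmin k (by omega) fun j hj => ?_
        rcases hj.eq_or_lt with rfl | hj
        · exact hcon
        · exact hk j hj
      rw [history_succ, switchMem_append] at hk0 ⊢
      simp only [switchStep] at hk0 ⊢
      rw [hk0.1, if_pos hk0.2]
      by_cases hi : (switchMem next reg i₀ (history ρ k)).1 = i
      · rw [if_pos hi.symm]
        obtain ⟨l, hl⟩ := exists_history_eq ρ k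
        have hnm : ρ k ∉ reg i := fun h' => hne ⟨hi, h'⟩
        rw [hl] at hi ⊢
        rw [switchMem_snd_of_notMem (by rwa [hi])]
        rfl
      · rw [if_neg (Ne.symm hi)]
  | succ j ih =>
    have h₁ := hk (k + (j + 1)) (by omega)
    have h₂ := hk (k + j) (by omega)
    rw [← Nat.add_assoc, history_succ, switchMem_append] at h₁ ⊢
    simp only [switchStep] at h₁ ⊢
    rw [h₁.1, if_pos h₁.2, if_pos h₂.1.symm, ih, history_succ]
    rfl

end Switching

end MullerGame

namespace MullerGame

section Switching

variable {V I : Type*} [DecidableEq V] [DecidableEq I] [Nonempty V] [Fintype V]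
  {G : MullerGame V} {σ τ : Fin 2} {S : Finset V}
  {next : I → V → I} {reg : I → Finset V} {i₀ : I} {f : I → List V → V} {g : I → V → V}

lemma switchStrategy_valid (hf : ∀ i, WinsSub G σ (reg i) (f i)) (hreg : ∀ i, reg i ⊆ S)
    (hg : ∀ i, ∀ v ∈ S, G.owner v = σ → g i v ∈ S ∧ (v, g i v) ∈ G.edges) (h : List V) (v : V)
    (hv : v ∈ S) (ho : G.owner v = σ) :
    switchStrategy next reg i₀ f g (h ++ [v]) ∈ S ∧
      (v, switchStrategy next reg i₀ f g (h ++ [v])) ∈ G.edges := by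
  by_cases hx : v ∈ reg (switchMem next reg i₀ (h ++ [v])).1
  · rw [switchStrategy_of_mem hx]
    obtain ⟨l, hl⟩ := exists_switchMem_eq hx
    rw [hl]
    have := (hf (switchMem next reg i₀ (h ++ [v])).1).1 l v hx ho
    exact ⟨hreg _ this.1, this.2⟩
  · rw [switchStrategy_of_notMem hx]
    exact hg _ v hv ho

variable {ρ : ℕ → V}

omit [DecidableEq V] [Nonempty V] [Fintype V] in
lemma follows_iff {f : List V → V} :
    G.Follows σ f ρ ↔ ∀ j, G.owner (ρ j) = σ → ρ (j + 1) = f (history ρ j) := Iff.rfl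

lemma switchStrategy_step_of_mem (hf : ∀ i, WinsSub G σ (reg i) (f i))
    (hρ : G.Follows σ (switchStrategy next reg i₀ f g) ρ) {j : ℕ} (ho : G.owner (ρ j) = σ)
    (hx : ρ j ∈ reg (switchMem next reg i₀ (history ρ j)).1) :
    ρ (j + 1) ∈ reg (switchMem next reg i₀ (history ρ j)).1 := by
  have h := follows_iff.1 hρ j ho
  obtain ⟨l, hl⟩ := exists_history_eq ρ j
  rw [hl] at h hx ⊢
  rw [switchStrategy_of_mem hx] at h
  obtain ⟨l', hl'⟩ := exists_switchMem_eq hx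
  rw [h, hl']
  exact ((hf _).1 l' _ hx ho).1

omit [Fintype V] in
lemma switchStrategy_step_of_notMem
    (hρ : G.Follows σ (switchStrategy next reg i₀ f g) ρ) {j : ℕ} (ho : G.owner (ρ j) = σ)
    (hx : ρ j ∉ reg (switchMem next reg i₀ (history ρ j)).1) :
    ρ (j + 1) = g (switchMem next reg i₀ (history ρ j)).1 (ρ j) := by
  have h := follows_iff.1 hρ j ho
  obtain ⟨l, hl⟩ := exists_history_eq ρ j
  rw [hl] at h hx ⊢
  rwa [switchStrategy_of_notMem hx] at h

omit [Nonempty V] [Fintype V] in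
lemma switchMem_zero : (switchMem next reg i₀ (history ρ 0)).1 = next i₀ (ρ 0) := rfl

omit [Nonempty V] [Fintype V] in
lemma switchMem_succ (j : ℕ) : (switchMem next reg i₀ (history ρ (j + 1))).1 =
    next (switchMem next reg i₀ (history ρ j)).1 (ρ (j + 1)) := by
  rw [history_succ, switchMem_append]
  rfl

/-- Winning depends only on the tail of a play, and on the tail the switching strategy is `f i` fed
with the history of that tail. -/
lemma infinitySet_mem_of_tail (hf : ∀ i, WinsSub G σ (reg i) (f i))
    (he : ∀ i, (ρ i, ρ (i + 1)) ∈ G.edges)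
    (hρ : G.Follows σ (switchStrategy next reg i₀ f g) ρ) {i : I} {k₀ : ℕ}
    (h : ∀ j, k₀ ≤ j → (switchMem next reg i₀ (history ρ j)).1 = i ∧ ρ j ∈ reg i) :
    infinitySet ρ ∈ G.F σ := by
  obtain ⟨k, hk, hmem⟩ := exists_tail h
  rw [← infinitySet_shift ρ k]
  refine (hf i).2 _ (fun j => (hk (k + j) (by omega)).2) (fun j => he (k + j)) ?_
  rw [follows_iff]
  intro j ho
  have h₁ := follows_iff.1 hρ (k + j) ho
  have h₂ := hk (k + j) (by omega)
  rw [← hmem]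
  obtain ⟨l, hl⟩ := exists_history_eq ρ (k + j)
  rw [← Nat.add_assoc]
  rw [hl] at h₁ h₂ ⊢
  rwa [switchStrategy_of_mem (by rw [h₂.1]; exact h₂.2), h₂.1] at h₁

end Switching

/-! ### Certificates for winning everywhere, and the recursion -/

section Good

variable {V : Type*} [DecidableEq V] [Nonempty V] [Fintype V]
  {G : MullerGame V} {σ τ : Fin 2} {S U W : Finset V}

omit [Nonempty V] [Fintype V] in
/-- A move in `S` that decreases the rank on the attractor. -/
lemma exists_attr_move (hS : IsSubarena G.toArena S) (X : Finset V) :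
    ∃ (r : V → ℕ) (g : V → V), (∀ v ∈ S, g v ∈ S ∧ (v, g v) ∈ G.edges) ∧
      ∀ v ∈ attr G.toArena σ S X, v ∉ X → ∀ w ∈ S, (v, w) ∈ G.edges →
        (G.owner v = σ → w = g v) → w ∈ attr G.toArena σ S X ∧ r w < r v := by
  obtain ⟨r, hr⟩ := exists_rank G.toArena σ S X
  have : ∀ v, ∃ w, (v ∈ S → w ∈ S ∧ (v, w) ∈ G.edges) ∧
      (v ∈ attr G.toArena σ S X → v ∉ X → G.owner v = σ →
        w ∈ attr G.toArena σ S X ∧ r w < r v) := by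
    intro v
    by_cases h : v ∈ attr G.toArena σ S X ∧ v ∉ X ∧ G.owner v = σ
    · obtain ⟨w, hw, he, hlt⟩ := (hr v h.1 h.2.1).1 h.2.2
      exact ⟨w, fun _ => ⟨attr_subset hw, he⟩, fun _ _ _ => ⟨hw, hlt⟩⟩
    · by_cases hv : v ∈ S
      · obtain ⟨w, hw, he⟩ := hS v hv
        exact ⟨w, fun _ => ⟨hw, he⟩, fun h₁ h₂ h₃ => absurd ⟨h₁, h₂, h₃⟩ h⟩
      · exact ⟨v, fun h => absurd h hv, fun h₁ h₂ h₃ => absurd ⟨h₁, h₂, h₃⟩ h⟩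
  choose g hg using this
  refine ⟨r, g, fun v hv => (hg v).1 hv, fun v hv hX w hw he hwg => ?_⟩
  by_cases ho : G.owner v = σ
  · rw [hwg ho]
    exact (hg v).2 hv hX ho
  · exact (hr v hv hX).2 ho w hw he

/-- Certificates for the fact that Player `σ` wins the game on `S` from everywhere. -/
inductive Good (G : MullerGame V) (σ : Fin 2) : Finset V → Prop
  | empty : Good G σ ∅
  | muller (S : Finset V) (hS : IsSubarena G.toArena S) (hF : S ∈ G.F σ)
      (h : ∀ v ∈ S, Good G σ (S \ attr G.toArena σ S {v})) : Good G σ S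
  | union (S W : Finset V) (hS : IsSubarena G.toArena S) (hW : Good G σ W)
      (hWS : IsTrap G.toArena σ W S) (hR : Good G σ (S \ attr G.toArena σ S W)) : Good G σ S

omit [Nonempty V] [Fintype V] in
lemma Good.isSubarena (h : Good G σ S) : IsSubarena G.toArena S := by
  cases h with
  | empty => exact fun u hu => absurd hu (Finset.notMem_empty u)
  | muller _ hS _ _ => exact hS
  | union _ _ hS _ _ _ => exact hS

/-- On $W$ and outside its attractor the given strategies are used; in between the play is attracted
to $W$. A play that reaches $W$ stays there, and one that never does must avoid the attractor
altogether. -/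
lemma exists_winsSub_union (hS : IsSubarena G.toArena S) {f₁ f₂ : List V → V}
    (hW : WinsSub G σ W f₁) (hWS : IsTrap G.toArena σ W S)
    (hR : WinsSub G σ (S \ attr G.toArena σ S W) f₂) : ∃ f, WinsSub G σ S f := by
  obtain ⟨r, g, hg, hgr⟩ := exists_attr_move (σ := σ) hS W
  let reg : Bool → Finset V := fun i => if i then W else S \ attr G.toArena σ S W
  let next : Bool → V → Bool := fun _ x => decide (x ∈ W)
  let fs : Bool → List V → V := fun i => if i then f₁ else f₂
  have hreg : ∀ i, reg i ⊆ S := by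
    intro i
    cases i
    · exact Finset.sdiff_subset
    · exact hWS.1
  have hfs : ∀ i, WinsSub G σ (reg i) (fs i) := by
    intro i
    cases i
    · exact hR
    · exact hW
  refine ⟨switchStrategy next reg false fs (fun _ => g),
    switchStrategy_valid hfs hreg fun _ v hv _ => hg v hv, fun ρ hρS he hρ => ?_⟩
  have hmode : ∀ j, (switchMem next reg false (history ρ j)).1 = decide (ρ j ∈ W) := by
    intro j
    cases j with
    | zero => exact switchMem_zero
    | succ j => exact switchMem_succ j
  by_cases hin : ∃ k, ρ k ∈ W
  · obtain ⟨k, hk⟩ := hin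
    have hstay : ∀ j, k ≤ j → ρ j ∈ W := by
      intro j hj
      induction hj with
      | refl => exact hk
      | @step j _ ih =>
        by_cases ho : G.owner (ρ j) = σ
        · have := switchStrategy_step_of_mem hfs hρ ho
          rw [hmode, decide_eq_true ih] at this
          exact this ih
        · exact hWS.2 _ ih ho _ (hρS _) (he _)
    exact infinitySet_mem_of_tail hfs he hρ (i := true) (k₀ := k) fun j hj =>
      ⟨by rw [hmode, decide_eq_true (hstay j hj)], hstay j hj⟩
  · push Not at hin
    have hmode' : ∀ j, (switchMem next reg false (history ρ j)).1 = false := fun j => by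
      rw [hmode, decide_eq_false (hin j)]
    refine infinitySet_mem_of_tail hfs he hρ (i := false) (k₀ := 0) fun j _ => ⟨hmode' j, ?_⟩
    refine Finset.mem_sdiff.2 ⟨hρS j, fun hj => ?_⟩
    -- Inside the attractor every move lowers the rank, so a single visit to the attractor would
    -- force a visit to $W$.
    obtain ⟨l, _, hl⟩ := exists_mem_of_rank (r := r) (X := W) hj fun i _ hi hiX => by
      refine hgr _ hi hiX _ (hρS _) (he _) fun ho => ?_
      refine switchStrategy_step_of_notMem hρ ho ?_
      rw [hmode' i]
      exact fun h => (Finset.mem_sdiff.1 h).2 hi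
    exact hin l hl

/-- The mode counts how many targets of a cyclic tour through $S$ have been reached. If it grows
forever, the infinity set is $S$; if it stops, the play ends up outside the attractor of the current
target. -/
lemma exists_winsSub_muller (hS : IsSubarena G.toArena S) (hF : S ∈ G.F σ)
    (h : ∀ v ∈ S, ∃ f, WinsSub G σ (S \ attr G.toArena σ S {v}) f) : ∃ f, WinsSub G σ S f := by
  rcases S.eq_empty_or_nonempty with rfl | hne
  · exact ⟨fun _ => Classical.arbitrary V, fun _ _ h => absurd h (Finset.notMem_empty _),
      fun ρ h => absurd (h 0) (Finset.notMem_empty _)⟩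
  have hcard : 0 < S.card := hne.card_pos
  -- The tour is indexed by all natural numbers rather than modulo the size of $S$, so that infinite
  -- progress means an unbounded mode.
  let t : ℕ → V := fun i => S.equivFin.symm ⟨i % S.card, Nat.mod_lt _ hcard⟩
  have htS : ∀ i, t i ∈ S := fun i => (S.equivFin.symm _).2
  have ht : ∀ v ∈ S, ∀ a, ∃ i, a ≤ i ∧ t i = v := by
    intro v hv a
    refine ⟨S.equivFin ⟨v, hv⟩ + S.card * a, ?_, ?_⟩
    · nlinarith
    · have : ((S.equivFin ⟨v, hv⟩ : ℕ) + S.card * a) % S.card = S.equivFin ⟨v, hv⟩ := by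
        rw [Nat.add_mul_mod_self_left, Nat.mod_eq_of_lt (S.equivFin ⟨v, hv⟩).2]
      simp only [t, this, Fin.eta, Equiv.symm_apply_apply]
  have hmove := fun i => exists_attr_move (σ := σ) hS {t i}
  choose r g hg hgr using hmove
  have hf := fun i => h (t i) (htS i)
  choose f hf using hf
  let next : ℕ → V → ℕ := fun i x => if x = t i then i + 1 else i
  let reg : ℕ → Finset V := fun i => S \ attr G.toArena σ S {t i}
  refine ⟨switchStrategy next reg 0 f g,
    switchStrategy_valid hf (fun _ => Finset.sdiff_subset) fun i v hv _ => hg i v hv,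
    fun ρ hρS he hρ => ?_⟩
  let mode : ℕ → ℕ := fun j => (switchMem next reg 0 (history ρ j)).1
  have hmode : ∀ j, mode (j + 1) = if ρ (j + 1) = t (mode j) then mode j + 1 else mode j :=
    fun j => switchMem_succ j
  have hmono : Monotone mode := monotone_nat_of_le_succ fun j => by
    rw [hmode]
    split_ifs <;> omega
  by_cases hb : ∃ b, ∀ j, mode j ≤ b
  · obtain ⟨k, hk⟩ : ∃ k, ∀ j, k ≤ j → mode j = mode k := by
      obtain ⟨b, hb⟩ := hb
      obtain ⟨k, hk⟩ := Nat.sSup_mem (s := Set.range mode) ⟨_, 0, rfl⟩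
        ⟨b, by rintro _ ⟨j, rfl⟩; exact hb j⟩
      refine ⟨k, fun j hj => le_antisymm ?_ (hmono hj)⟩
      rw [hk]
      exact le_csSup ⟨b, by rintro _ ⟨j, rfl⟩; exact hb j⟩ ⟨j, rfl⟩
    have hnot : ∀ j, k + 1 ≤ j → ρ j ≠ t (mode k) := by
      intro j hj hcon
      obtain ⟨j, rfl⟩ : ∃ i, j = i + 1 := ⟨j - 1, by omega⟩
      have h₁ := hmode j
      -- A visit to the current target would have increased the mode, which is constant by now.
      rw [hk j (by omega), if_pos hcon, hk (j + 1) (by omega)] at h₁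
      omega
    refine infinitySet_mem_of_tail hf he hρ (i := mode k) (k₀ := k + 1) fun j hj =>
      ⟨hk j (by omega), ?_⟩
    refine Finset.mem_sdiff.2 ⟨hρS j, fun hj' => ?_⟩
    obtain ⟨l, hl, hlX⟩ := exists_mem_of_rank (r := r (mode k)) (X := {t (mode k)}) hj'
      fun i hi hiA hiX => by
        refine hgr _ _ hiA hiX _ (hρS _) (he _) fun ho => ?_
        have hm : (switchMem next reg 0 (history ρ i)).1 = mode k := hk i (by omega)
        have := switchStrategy_step_of_notMem hρ ho (by
          rw [hm]
          exact fun h => (Finset.mem_sdiff.1 h).2 hiA)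
        rwa [hm] at this
    exact hnot l (by omega) (Finset.mem_singleton.1 hlX)
  · push Not at hb
    -- The mode increases by at most one in each step, so it skips no value; when it passes from `c
    -- - 1` to `c`, the play is at target `c - 1`.
    have hreach : ∀ c a, mode 0 < c → mode a < c →
        ∃ j, a < j ∧ mode j = c ∧ mode (j - 1) + 1 = c := by
      intro c a _ ha
      have hex : ∃ j, c ≤ mode j := ⟨_, (hb c).choose_spec.le⟩
      have hs := Nat.find_spec hex
      have haj : a < Nat.find hex := by
        by_contra hcon
        have := hmono (not_lt.1 hcon)
        omega
      have hm := Nat.find_min hex (m := Nat.find hex - 1) (by omega)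
      have h₁ := hmode (Nat.find hex - 1)
      rw [show Nat.find hex - 1 + 1 = Nat.find hex by omega] at h₁
      refine ⟨Nat.find hex, haj, ?_⟩
      split_ifs at h₁ <;> omega
    have : infinitySet ρ = S := by
      ext v
      rw [mem_infinitySet]
      constructor
      · intro hv
        obtain ⟨b, _, rfl⟩ := hv 0
        exact hρS b
      · intro hv a
        obtain ⟨i, hi, rfl⟩ := ht v hv (mode a + mode 0)
        obtain ⟨j, hj, h₁, h₂⟩ := hreach (i + 1) a (by omega) (by omega)
        refine ⟨j, hj.le, ?_⟩
        have h₃ := hmode (j - 1)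
        rw [show j - 1 + 1 = j by omega] at h₃
        have h₄ : mode (j - 1) = i := by omega
        rw [h₄] at h₃
        by_contra hcon
        rw [if_neg hcon] at h₃
        omega
    rwa [this]

lemma Good.exists_winsSub (h : Good G σ S) : ∃ f, WinsSub G σ S f := by
  induction h with
  | empty =>
    exact ⟨fun _ => Classical.arbitrary V, fun _ _ h => absurd h (Finset.notMem_empty _),
      fun ρ h => absurd (h 0) (Finset.notMem_empty _)⟩
  | muller S hS hF _ ih => exact exists_winsSub_muller hS hF ih
  | union S W hS _ hWS _ ih₁ ih₂ =>
    obtain ⟨f₁, h₁⟩ := ih₁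
    obtain ⟨f₂, h₂⟩ := ih₂
    exact exists_winsSub_union hS h₁ hWS h₂

/-- The subarenas on which the two players win cannot interfere. -/
lemma Good.eq_empty_of_isTrap (hστ : σ ≠ τ) (hU : Good G σ U) (hUS : IsTrap G.toArena σ U S)
    (hS : Good G τ S) : U = ∅ := by
  by_contra hne
  obtain ⟨v, hv⟩ := Finset.nonempty_iff_ne_empty.2 hne
  obtain ⟨f₁, h₁⟩ := hU.exists_winsSub
  obtain ⟨f₂, h₂⟩ := hS.exists_winsSub
  -- Both strategies are played against each other from a position of $U$. The play stays in $U$, so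
  -- each player would win it.
  obtain ⟨ρ, hρ0, hρ⟩ := exists_play_of_next
    (fun h => if G.owner (h.getLast?.getD v) = σ then f₁ h else f₂ h) v
  have hlast : ∀ i, (history ρ i).getLast?.getD v = ρ i := by
    intro i
    obtain ⟨l, hl⟩ := exists_history_eq ρ i
    simp [hl]
  simp only [hlast] at hρ
  have hρU : ∀ i, ρ i ∈ U := by
    intro i
    induction i with
    | zero => rwa [hρ0]
    | succ i ih =>
      obtain ⟨l, hl⟩ := exists_history_eq ρ i
      rw [hρ, hl]
      split_ifs with ho
      · exact (h₁.1 l _ ih ho).1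
      · have := h₂.1 l _ (hUS.1 ih) (by omega)
        exact hUS.2 _ ih ho _ this.1 this.2
  have he : ∀ i, (ρ i, ρ (i + 1)) ∈ G.edges := by
    intro i
    obtain ⟨l, hl⟩ := exists_history_eq ρ i
    rw [hρ, hl]
    split_ifs with ho
    · exact (h₁.1 l _ (hρU i) ho).2
    · exact (h₂.1 l _ (hUS.1 (hρU i)) (by omega)).2
  have w₁ := h₁.2 ρ hρU he fun i ho => by rw [hρ, if_pos ho]; rfl
  have w₂ := h₂.2 ρ (fun i => hUS.1 (hρU i)) he fun i ho => by
    rw [hρ, if_neg (by omega)]; rfl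
  refine G.disjoint (infinitySet ρ) ?_
  fin_cases σ <;> fin_cases τ <;> simp_all

omit [DecidableEq V] [Nonempty V] [Fintype V] in
lemma mem_F_or (hστ : σ ≠ τ) (X : Finset V) : X ∈ G.F σ ∨ X ∈ G.F τ := by
  have := G.cover X
  fin_cases σ <;> fin_cases τ <;> simp_all [or_comm]

omit [Nonempty V] in
-- If the rule for $S \in \mathcal{F}_\sigma$ fails at some $v$, then τ wins on a nonempty set $W$
-- that σ cannot leave in $S$. The attractor of τ to $W$ is removed, the rest is split by induction,
-- and the part of τ is joined with the attractor.
lemma exists_partition_aux (hστ : σ ≠ τ) (hS : IsSubarena G.toArena S) (hF : S ∈ G.F σ)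
    (ih : ∀ T ⊂ S, IsSubarena G.toArena T → ∃ A B, A ∪ B = T ∧ Disjoint A B ∧
      Good G σ A ∧ IsTrap G.toArena σ A T ∧
      Good G τ B ∧ IsTrap G.toArena τ B T) :
    ∃ A B, A ∪ B = S ∧ Disjoint A B ∧ Good G σ A ∧ IsTrap G.toArena σ A S ∧
      Good G τ B ∧ IsTrap G.toArena τ B S := by
  by_cases hall : ∀ v ∈ S, Good G σ (S \ attr G.toArena σ S {v})
  · exact ⟨S, ∅, Finset.union_empty S, Finset.disjoint_empty_right S, .muller S hS hF hall,
      ⟨subset_rfl, fun _ _ _ w hw _ => hw⟩,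
      .empty, Finset.empty_subset _, fun u hu => absurd hu (Finset.notMem_empty u)⟩
  · push Not at hall
    obtain ⟨v, hv, hng⟩ := hall
    have hvA : v ∈ attr G.toArena σ S {v} :=
      subset_attr (Finset.singleton_subset_iff.2 hv) (Finset.mem_singleton_self v)
    obtain ⟨A₁, W, hAW, -, hA₁, hA₁t, hW, hWt⟩ := ih (S \ attr G.toArena σ S {v})
      (Finset.sdiff_ssubset attr_subset ⟨v, hvA⟩) (isSubarena_sdiff_attr hS)
    have hWne : W ≠ ∅ := by
      rintro rfl
      rw [Finset.union_empty] at hAW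
      exact hng (hAW ▸ hA₁)
    have hWS : IsTrap G.toArena τ W S := hWt.trans (isTrap_sdiff_attr hστ)
    have hWA : W ⊆ attr G.toArena τ S W := subset_attr hWS.1
    obtain ⟨R₁, R₂, hR, hRd, hR₁, hR₁t, hR₂, hR₂t⟩ := ih (S \ attr G.toArena τ S W)
      (Finset.sdiff_ssubset attr_subset
        ((Finset.nonempty_iff_ne_empty.2 hWne).mono hWA))
      (isSubarena_sdiff_attr hS)
    have hRS : IsTrap G.toArena σ (S \ attr G.toArena τ S W) S := isTrap_sdiff_attr hστ.symm
    have hR₂S : R₂ ⊆ S := hR₂t.1.trans Finset.sdiff_subset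
    have hBS : attr G.toArena τ S W ∪ R₂ ⊆ S := Finset.union_subset attr_subset hR₂S
    -- Player σ leaves neither the attractor nor $W$, and from $R_2$ she can only move on within
    -- $R_2$ or into the attractor.
    have hBt : IsTrap G.toArena τ (attr G.toArena τ S W ∪ R₂) S := by
      refine ⟨hBS, fun u hu ho w hw he => ?_⟩
      rw [Finset.mem_union] at hu ⊢
      by_cases hwA : w ∈ attr G.toArena τ S W
      · exact Or.inl hwA
      rcases hu with hu | hu
      · by_cases huW : u ∈ W
        · exact Or.inl (hWA (hWS.2 u huW ho w hw he))
        · obtain ⟨r, hr⟩ := exists_rank G.toArena τ S W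
          exact Or.inl ((hr u hu huW).2 ho w hw he).1
      · exact Or.inr (hR₂t.2 u hu ho w (Finset.mem_sdiff.2 ⟨hw, hwA⟩) he)
    have hBsub : IsSubarena G.toArena (attr G.toArena τ S W ∪ R₂) := by
      intro u hu
      rcases Finset.mem_union.1 hu with h | h
      · by_cases ho : G.owner u = τ
        · by_cases huW : u ∈ W
          · obtain ⟨w, hw, he⟩ := hW.isSubarena u huW
            exact ⟨w, Finset.mem_union_left _ (hWA hw), he⟩
          · obtain ⟨r, hr⟩ := exists_rank G.toArena τ S W
            obtain ⟨w, hw, he, _⟩ := (hr u h huW).1 ho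
            exact ⟨w, Finset.mem_union_left _ hw, he⟩
        · obtain ⟨w, hw, he⟩ := hS u (hBS hu)
          exact ⟨w, hBt.2 u hu ho w hw he, he⟩
      · obtain ⟨w, hw, he⟩ := hR₂.isSubarena u h
        exact ⟨w, Finset.mem_union_right _ hw, he⟩
    -- The certificate for the union refers to the attractor computed inside the union; it agrees
    -- with the one in $S$ because σ cannot leave the union.
    have hattr : attr G.toArena τ (attr G.toArena τ S W ∪ R₂) W = attr G.toArena τ S W := by
      apply subset_antisymm
      · refine attr_subset_of_closed hWA
          (fun v hv w hw hwA ho he => mem_attr_of_owner (hBS hv) ho hwA he) ?_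
        intro v hv ho h
        exact mem_attr_of_forall (hBS hv) ho fun w hw he => h w (hBt.2 v hv ho w hw he) he
      · exact attr_subset_attr Finset.subset_union_left hBS
    refine ⟨R₁, attr G.toArena τ S W ∪ R₂, ?_, ?_, hR₁, hR₁t.trans hRS, ?_, hBt⟩
    · rw [Finset.union_left_comm, hR, Finset.union_sdiff_of_subset attr_subset]
    · refine Finset.disjoint_union_right.2 ⟨?_, hRd⟩
      exact Finset.disjoint_left.2 fun u hu h => (Finset.mem_sdiff.1 (hR₁t.1 hu)).2 h
    · refine .union _ W hBsub hW (hWS.mono (hWA.trans Finset.subset_union_left) hBS) ?_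
      rw [hattr, Finset.union_sdiff_left, Finset.sdiff_eq_self_iff_disjoint.2]
      · exact hR₂
      · exact Finset.disjoint_left.2 fun u hu h => (Finset.mem_sdiff.1 (hR₂t.1 hu)).2 h

omit [Nonempty V] in
/-- Every subarena splits into the regions on which the two players win. -/
lemma exists_partition (hστ : σ ≠ τ) (hS : IsSubarena G.toArena S) :
    ∃ A B, A ∪ B = S ∧ Disjoint A B ∧ Good G σ A ∧ IsTrap G.toArena σ A S ∧
      Good G τ B ∧ IsTrap G.toArena τ B S := by
  induction S using Finset.strongInduction with
  | H S ih =>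
    rcases mem_F_or hστ S with hF | hF
    · exact exists_partition_aux hστ hS hF fun T hT hTs => ih T hT hTs
    · obtain ⟨A, B, h, hd, h₁, h₂, h₃, h₄⟩ :=
        exists_partition_aux hστ.symm hS hF fun T hT hTs => by
          obtain ⟨A, B, h, hd, h₁, h₂, h₃, h₄⟩ := ih T hT hTs
          exact ⟨B, A, by rwa [Finset.union_comm], hd.symm, h₃, h₄, h₁, h₂⟩
      exact ⟨B, A, by rwa [Finset.union_comm], hd.symm, h₃, h₄, h₁, h₂⟩

/-- The recursion on which the dynamic programming algorithm is based. -/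
theorem good_iff (hστ : σ ≠ τ) (hS : IsSubarena G.toArena S) (hne : S.Nonempty) :
    Good G σ S ↔ (∀ v ∈ S, Good G σ (S \ attr G.toArena σ S {v})) ∧
      (S ∈ G.F σ ∨ ¬ Good G τ S) := by
  constructor
  · intro h
    refine ⟨fun v _ => ?_, Or.inr fun h' => ?_⟩
    -- The opponent's part of the complement is a set that σ cannot leave in $S$, where σ wins
    -- everywhere; so it is empty.
    · obtain ⟨A, B, hAB, -, hA, _, hB, hBt⟩ := exists_partition (G := G) hστ
        (isSubarena_sdiff_attr (σ := σ) (X := {v}) hS)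
      have hBe := hB.eq_empty_of_isTrap hστ.symm (hBt.trans (isTrap_sdiff_attr hστ)) h
      rw [hBe, Finset.union_empty] at hAB
      rwa [← hAB]
    · exact hne.ne_empty
        (h.eq_empty_of_isTrap hστ ⟨subset_rfl, fun _ _ _ w hw _ => hw⟩ h')
  · rintro ⟨hall, hF | hτ⟩
    · exact .muller S hS hF hall
    · obtain ⟨A, B, hAB, hd, hA, hAt, hB, hBt⟩ := exists_partition (G := G) hστ hS
      -- Since $S$ is not good for τ, the part of σ contains some $v$. The part of τ avoids the
      -- attractor of σ to $v$, and outside of that attractor σ wins.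
      rcases A.eq_empty_or_nonempty with rfl | ⟨v, hv⟩
      · rw [Finset.empty_union] at hAB
        exact absurd (hAB ▸ hB) hτ
      · have hvB : v ∉ B := Finset.disjoint_left.1 hd hv
        have hsub : B ⊆ S \ attr G.toArena σ S {v} :=
          hBt.subset_sdiff_attr hB.isSubarena hστ.symm
            (Finset.disjoint_singleton_right.2 hvB)
        have hBe := hB.eq_empty_of_isTrap hστ.symm
          (hBt.mono hsub Finset.sdiff_subset) (hall v (hAt.1 hv))
        rw [hBe, Finset.union_empty] at hAB
        rwa [← hAB]

/-- Outside of $S$ the strategy may use any edge: a play from $S$ that follows it never leaves $S$,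
since the opponent cannot. -/
lemma Good.winsFrom (h : Good G σ S) (hS : IsTrap G.toArena σ S Finset.univ) {v : V}
    (hv : v ∈ S) : G.WinsFrom σ v := by
  obtain ⟨f, hf⟩ := h.exists_winsSub
  choose g hg using G.total
  let f' : List V → V := fun h =>
    let x := h.getLast?.getD v
    if x ∈ S then f h else g x
  have hf' : ∀ h x, f' (h ++ [x]) = if x ∈ S then f (h ++ [x]) else g x := by
    intro h x
    simp [f']
  refine ⟨f', fun h x ho => ?_, fun ρ hρ hfol => ?_⟩
  · rw [hf']
    split_ifs with hx
    · exact (hf.1 h x hx ho).2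
    · exact hg x
  · have hstep : ∀ i, ρ i ∈ S → G.owner (ρ i) = σ → ρ (i + 1) = f (history ρ i) := by
      intro i hi ho
      have := follows_iff.1 hfol i ho
      obtain ⟨l, hl⟩ := exists_history_eq ρ i
      rw [hl] at this ⊢
      rwa [hf', if_pos hi] at this
    have hρS : ∀ i, ρ i ∈ S := by
      intro i
      induction i with
      | zero => rwa [hρ.1]
      | succ i ih =>
        by_cases ho : G.owner (ρ i) = σ
        · rw [hstep i ih ho]
          obtain ⟨l, hl⟩ := exists_history_eq ρ i
          rw [hl]
          exact (hf.1 l _ ih ho).1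
        · exact hS.2 _ ih ho _ (Finset.mem_univ _) (hρ.2 i)
    exact hf.2 ρ hρS hρ.2 (follows_iff.2 fun i ho => hstep i (hρS i) ho)

omit [DecidableEq V] [Nonempty V] in
lemma not_winsFrom_both (hστ : σ ≠ τ) {v : V} (h₁ : G.WinsFrom σ v) (h₂ : G.WinsFrom τ v) :
    False := by
  obtain ⟨f₁, hf₁, h₁⟩ := h₁
  obtain ⟨f₂, hf₂, h₂⟩ := h₂
  obtain ⟨ρ, hρ0, hρ⟩ := exists_play_of_next
    (fun h => if G.owner (h.getLast?.getD v) = σ then f₁ h else f₂ h) v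
  have hlast : ∀ i, (history ρ i).getLast?.getD v = ρ i := by
    intro i
    obtain ⟨l, hl⟩ := exists_history_eq ρ i
    simp [hl]
  simp only [hlast] at hρ
  have hplay : G.IsPlay v ρ := by
    refine ⟨hρ0, fun i => ?_⟩
    obtain ⟨l, hl⟩ := exists_history_eq ρ i
    rw [hρ, hl]
    split_ifs with ho
    · exact hf₁ l _ ho
    · exact hf₂ l _ (by omega)
  have w₁ := h₁ ρ hplay (follows_iff.2 fun i ho => by rw [hρ, if_pos ho])
  have w₂ := h₂ ρ hplay (follows_iff.2 fun i ho => by rw [hρ, if_neg (by omega)])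
  refine G.disjoint (infinitySet ρ) ?_
  fin_cases σ <;> fin_cases τ <;> simp_all

/-- The winning region of a player is the union of the traps for her opponent on which she wins. -/
theorem winsFrom_iff (hστ : σ ≠ τ) {v : V} : G.WinsFrom σ v ↔
    ∃ S, v ∈ S ∧ Good G σ S ∧ IsTrap G.toArena σ S Finset.univ := by
  refine ⟨fun h => ?_, fun ⟨S, hv, hS, hSt⟩ => hS.winsFrom hSt hv⟩
  obtain ⟨A, B, hAB, -, hA, hAt, hB, hBt⟩ := exists_partition (G := G) (S := Finset.univ) hστ
    (fun u _ => (G.total u).imp fun w hw => ⟨Finset.mem_univ w, hw⟩)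
  have hv : v ∈ A ∪ B := hAB ▸ Finset.mem_univ v
  rcases Finset.mem_union.1 hv with hv | hv
  · exact ⟨A, hv, hA, hAt⟩
  · exact (not_winsFrom_both hστ h (hB.winsFrom hBt hv)).elim

lemma winsFrom_or (hστ : σ ≠ τ) (v : V) : G.WinsFrom σ v ∨ G.WinsFrom τ v := by
  obtain ⟨A, B, hAB, -, hA, hAt, hB, hBt⟩ := exists_partition (G := G) (S := Finset.univ) hστ
    (fun u _ => (G.total u).imp fun w hw => ⟨Finset.mem_univ w, hw⟩)
  have hv : v ∈ A ∪ B := hAB ▸ Finset.mem_univ v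
  exact (Finset.mem_union.1 hv).imp (hA.winsFrom hAt) (hB.winsFrom hBt)

end Good

end MullerGame

/-! ## A layer of arrays on top of the random access machine -/

namespace RAM

/-- The state of a machine whose memory consists of the input cells and of sixteen arrays. -/
structure Abs where
  r : ℕ → ℕ
  a : ℕ → ℕ → ℕ
  inp : ℕ → ℕ

namespace Abs

/-- Write a register. -/
def set (A : Abs) (x v : ℕ) : Abs := { A with r := Function.update A.r x v }

/-- Write an entry of an array. -/
def put (A : Abs) (i j v : ℕ) : Abs :=
  { A with a := fun i' j' => if i' = i ∧ j' = j then v else A.a i' j' }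

/-- Write an input cell. -/
def wr (A : Abs) (j v : ℕ) : Abs := { A with inp := Function.update A.inp j v }

variable (A : Abs) (x y i j i' j' v : ℕ)

@[simp] lemma set_r : (A.set x v).r y = if y = x then v else A.r y := by
  simp [set, Function.update_apply]
@[simp] lemma set_a : (A.set x v).a = A.a := rfl
@[simp] lemma set_inp : (A.set x v).inp = A.inp := rfl
@[simp] lemma put_a : (A.put i j v).a i' j' = if i' = i ∧ j' = j then v else A.a i' j' := rfl
@[simp] lemma put_r : (A.put i j v).r = A.r := rfl
@[simp] lemma wr_inp : (A.wr j v).inp j' = if j' = j then v else A.inp j' := by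
  simp [wr, Function.update_apply]

/-- `A'` differs from `A` at most in the registers `R` and in the arrays `I`. -/
structure Same (R I : List ℕ) (A A' : Abs) : Prop where
  r : ∀ x, x ∉ R → A'.r x = A.r x
  a : ∀ i, i ∉ I → A'.a i = A.a i
  inp : A'.inp = A.inp

variable {A} {A' A'' : Abs} {R I R' I' : List ℕ}

lemma Same.refl (R I : List ℕ) (A : Abs) : Same R I A A := ⟨fun _ _ => rfl, fun _ _ => rfl, rfl⟩

lemma Same.set {x v : ℕ} (h : Same R I A A') (hx : x ∈ R) : Same R I A (A'.set x v) := by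
  refine ⟨fun y hy => ?_, h.a, h.inp⟩
  rw [set_r, if_neg (fun h' : y = x => hy (h' ▸ hx)), h.r y hy]

lemma Same.put {i j v : ℕ} (h : Same R I A A') (hi : i ∈ I) : Same R I A (A'.put i j v) := by
  refine ⟨h.r, fun i' hi' => ?_, h.inp⟩
  funext j'
  rw [put_a, if_neg (fun h' : i' = i ∧ j' = j => hi' (h'.1 ▸ hi)), h.a i' hi']

lemma Same.trans (h : Same R I A A') (h' : Same R' I' A' A'') (hR : R' ⊆ R) (hI : I' ⊆ I) :
    Same R I A A'' :=
  ⟨fun x hx => (h'.r x fun h => hx (hR h)).trans (h.r x hx),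
    fun i hi => (h'.a i fun h => hi (hI h)).trans (h.a i hi), h'.inp.trans h.inp⟩

end Abs

/-- Expressions over registers and arrays. -/
inductive AExpr where
  | lit (k : ℕ)
  | reg (x : ℕ)
  | get (i : Fin 16) (e : AExpr)
  | add (e₁ e₂ : AExpr)
  | sub (e₁ e₂ : AExpr)
  | lt (e₁ e₂ : AExpr)
  | eq (e₁ e₂ : AExpr)

/-- Twice the value of an expression. -/
def Expr.dbl (e : Expr) : Expr := .add e e

/-- The address of an entry of the array `i`. -/
def Expr.addr (i : ℕ) (e : Expr) : Expr := .add (.add (.reg 0) e.dbl.dbl.dbl.dbl) (.lit i)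

namespace AExpr

/-- The value of an expression. -/
@[simp] def eval (A : Abs) : AExpr → ℕ
  | lit k => k
  | reg x => A.r x
  | get i e => A.a i (e.eval A)
  | add e₁ e₂ => e₁.eval A + e₂.eval A
  | sub e₁ e₂ => e₁.eval A - e₂.eval A
  | lt e₁ e₂ => if e₁.eval A < e₂.eval A then 1 else 0
  | eq e₁ e₂ => if e₁.eval A = e₂.eval A then 1 else 0

/-- The machine expression that computes the value. -/
def compile : AExpr → Expr
  | lit k => .lit k
  | reg x => .reg x
  | get i e => .load (.addr i e.compile)
  | add e₁ e₂ => .add e₁.compile e₂.compile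
  | sub e₁ e₂ => .sub e₁.compile e₂.compile
  | lt e₁ e₂ => .lt e₁.compile e₂.compile
  | eq e₁ e₂ => .eq e₁.compile e₂.compile

end AExpr

/-- The sizes that occur in a computation: the length `L` of the input `inp`, the number `n` of
bits that index a bit array, the largest index `m` of a word array, and the largest value `W` of a
word. -/
structure Sizes where
  L : ℕ
  n : ℕ
  m : ℕ
  W : ℕ
  inp : ℕ → ℕ

/-- The bounds that all states satisfy.  The arrays `0, …, 12` contain words and the arrays
`13, 14, 15` contain bits. -/
structure Safe (P : Sizes) (A : Abs) : Prop where
  r_le : ∀ x, A.r x ≤ P.W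
  r_zero : ∀ x, 40 ≤ x → A.r x = 0
  inp_le : ∀ j, j < P.L → A.inp j ≤ max (P.inp j) 1
  word_le : ∀ i j, i < 13 → A.a i j ≤ P.W
  word_zero : ∀ i j, i < 13 → P.m < j → A.a i j = 0
  bit_le : ∀ i j, 13 ≤ i → A.a i j ≤ 1
  bit_zero : ∀ i j, 13 ≤ i → 2 ^ P.n ≤ j → A.a i j = 0

/-- The machine state `s` has the registers, input cells and arrays of `A`. -/
structure Layout (P : Sizes) (s : State) (A : Abs) : Prop where
  reg : s.reg = A.r
  inp : ∀ j, j < P.L → s.mem j = A.inp j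
  arr : ∀ i j, i < 16 → s.mem (P.L + 16 * j + i) = A.a i j

/-- The machine state `s` represents `A`, and register `0` holds the address of the arrays. -/
structure Rep (P : Sizes) (s : State) (A : Abs) : Prop extends Layout P s A where
  base : A.r 0 = P.L

lemma Expr.eval_addr {P : Sizes} {s : State} {A : Abs} (h : Rep P s A) (i : ℕ) (e : Expr) :
    (Expr.addr i e).eval s = P.L + 16 * e.eval s + i := by
  -- The machine has no multiplication; the arrays are interleaved with stride sixteen, which four
  -- doublings realize.
  simp only [addr, dbl, eval, h.reg, h.base]
  ring

lemma AExpr.eval_compile {P : Sizes} {s : State} {A : Abs} (h : Rep P s A) (e : AExpr) :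
    e.compile.eval s = e.eval A := by
  induction e with
  | lit k => rfl
  | reg x => exact congrFun h.reg x
  | get i e ih => simp only [compile, Expr.eval, Expr.eval_addr h, ih, h.arr _ _ i.2, eval]
  | add _ _ ih₁ ih₂ => simp only [compile, Expr.eval, ih₁, ih₂, eval]
  | sub _ _ ih₁ ih₂ => simp only [compile, Expr.eval, ih₁, ih₂, eval]
  | lt _ _ ih₁ ih₂ => simp only [compile, Expr.eval, ih₁, ih₂, eval]
  | eq _ _ ih₁ ih₂ => simp only [compile, Expr.eval, ih₁, ih₂, eval]

lemma Rep.set {P : Sizes} {s : State} {A : Abs} (h : Rep P s A) {x : ℕ} (hx : x ≠ 0) (v : ℕ) :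
    Rep P (s.setReg x v) (A.set x v) := by
  refine ⟨⟨?_, h.inp, h.arr⟩, ?_⟩
  · simp only [State.setReg, Abs.set, h.reg]
  · rw [Abs.set_r, if_neg hx.symm, h.base]

lemma Rep.put {P : Sizes} {s : State} {A : Abs} (h : Rep P s A) {i : ℕ} (hi : i < 16) (j v : ℕ) :
    Rep P (s.setMem (P.L + 16 * j + i) v) (A.put i j v) := by
  refine ⟨⟨h.reg, fun j' hj' => ?_, fun i' j' hi' => ?_⟩, h.base⟩
  · simp only [State.setMem, Abs.put]
    rw [Function.update_of_ne (by omega), h.inp j' hj']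
  · simp only [State.setMem, Abs.put, Function.update_apply]
    by_cases hc : i' = i ∧ j' = j
    · rw [if_pos (by rw [hc.1, hc.2]), if_pos hc]
    · rw [if_neg (by omega), if_neg hc, h.arr i' j' hi']

lemma Rep.wr {P : Sizes} {s : State} {A : Abs} (h : Rep P s A) {j : ℕ} (hj : j < P.L) (v : ℕ) :
    Rep P (s.setMem j v) (A.wr j v) := by
  refine ⟨⟨h.reg, fun j' hj' => ?_, fun i' j' hi' => ?_⟩, h.base⟩
  · simp only [State.setMem, Abs.wr, Function.update_apply, h.inp j' hj']
  · simp only [State.setMem, Abs.wr]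
    rw [Function.update_of_ne (by omega), h.arr i' j' hi']

lemma Safe.set {P : Sizes} {A : Abs} (h : Safe P A) {x v : ℕ} (hx : x < 40) (hv : v ≤ P.W) :
    Safe P (A.set x v) := by
  refine ⟨fun y => ?_, fun y hy => ?_, h.inp_le, h.word_le, h.word_zero, h.bit_le, h.bit_zero⟩
  · rw [Abs.set_r]
    split_ifs
    exacts [hv, h.r_le y]
  · rw [Abs.set_r, if_neg (by omega), h.r_zero y hy]

lemma Safe.putWord {P : Sizes} {A : Abs} (h : Safe P A) {i j v : ℕ} (hi : i < 13) (hj : j ≤ P.m)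
    (hv : v ≤ P.W) : Safe P (A.put i j v) := by
  refine ⟨h.r_le, h.r_zero, h.inp_le, fun i' j' hi' => ?_, fun i' j' hi' hj' => ?_,
    fun i' j' hi' => ?_, fun i' j' hi' hj' => ?_⟩
  · rw [Abs.put_a]
    split_ifs
    exacts [hv, h.word_le i' j' hi']
  · rw [Abs.put_a, if_neg (by omega), h.word_zero i' j' hi' hj']
  · rw [Abs.put_a, if_neg (by omega)]
    exact h.bit_le i' j' hi'
  · rw [Abs.put_a, if_neg (by omega), h.bit_zero i' j' hi' hj']

lemma Safe.putBit {P : Sizes} {A : Abs} (h : Safe P A) {i j v : ℕ} (hi : 13 ≤ i)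
    (hj : j < 2 ^ P.n) (hv : v ≤ 1) : Safe P (A.put i j v) := by
  refine ⟨h.r_le, h.r_zero, h.inp_le, fun i' j' hi' => ?_, fun i' j' hi' hj' => ?_,
    fun i' j' hi' => ?_, fun i' j' hi' hj' => ?_⟩
  · rw [Abs.put_a, if_neg (by omega)]
    exact h.word_le i' j' hi'
  · rw [Abs.put_a, if_neg (by omega), h.word_zero i' j' hi' hj']
  · rw [Abs.put_a]
    split_ifs
    exacts [hv, h.bit_le i' j' hi']
  · rw [Abs.put_a, if_neg (by omega), h.bit_zero i' j' hi' hj']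

/-- The input cells are reused for the output, which consists of bits; hence the maximum with `1` in
the bound on input cells. -/
lemma Safe.wr {P : Sizes} {A : Abs} (h : Safe P A) {j v : ℕ} (hv : v ≤ 1) :
    Safe P (A.wr j v) := by
  refine ⟨h.r_le, h.r_zero, fun j' hj' => ?_, h.word_le, h.word_zero, h.bit_le, h.bit_zero⟩
  rw [Abs.wr_inp]
  split_ifs
  · exact hv.trans (le_max_right _ _)
  · exact h.inp_le j' hj'

/-- Write the value of `e` into register `x`. -/
abbrev set (x : ℕ) (e : AExpr) : Program := .assign x e.compile

/-- Write the value of `e` into the entry `j` of the array `i`. -/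
abbrev put (i : ℕ) (j e : AExpr) : Program := .store (.addr i j.compile) e.compile

/-- Read the input cell `j` into register `x`. -/
abbrev rd (x : ℕ) (j : AExpr) : Program := .assign x (.load j.compile)

/-- Write the value of `e` into the input cell `j`. -/
abbrev wr (j e : AExpr) : Program := .store j.compile e.compile

/-- A conditional. -/
abbrev cond (e : AExpr) (p q : Program) : Program := .ite e.compile p q

/-- A loop. -/
abbrev loop (e : AExpr) (p : Program) : Program := .while e.compile p

/-- The number of machine steps that are counted as one unit of time. -/
def unit : ℕ := 10000

/-- Started in a state that represents `A`, the program `p` halts within `T` units of time in a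
state that represents an `A'` with `Q A'`, and all states on the way are safe. -/
def Runs (P : Sizes) (p : Program) (A : Abs) (T : ℕ) (Q : Abs → Prop) : Prop :=
  Safe P A → ∀ s, Rep P s A → ∃ t s' A', Run (fun s => ∃ A, Layout P s A ∧ Safe P A) p s t s' ∧
    t ≤ unit * T ∧ Rep P s' A' ∧ Safe P A' ∧ Q A'

namespace Runs

variable {P : Sizes} {p q : Program} {A : Abs} {T T₁ T₂ : ℕ} {Q Q₁ : Abs → Prop}

/-- The bounds in `Safe` also serve as facts about the current state, for instance that a stored
counter fits into a word. -/
lemma of_safe (h : Safe P A → Runs P p A T Q) : Runs P p A T Q := fun hA => h hA hA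

lemma mono (h : Runs P p A T₁ Q₁) (hT : T₁ ≤ T) (hQ : ∀ A', Safe P A' → Q₁ A' → Q A') :
    Runs P p A T Q := by
  intro hA s hs
  obtain ⟨t, s', A', h₁, h₂, h₃, h₄, h₅⟩ := h hA s hs
  exact ⟨t, s', A', h₁, h₂.trans (Nat.mul_le_mul_left _ hT), h₃, h₄, hQ A' h₄ h₅⟩

lemma mono_time (h : Runs P p A T₁ Q) (hT : T₁ ≤ T) : Runs P p A T Q :=
  h.mono hT fun _ _ h => h

lemma seq (hp : Runs P p A T₁ Q₁) (hq : ∀ A', Q₁ A' → Runs P q A' T₂ Q) :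
    Runs P (.seq p q) A (T₁ + T₂) Q := by
  intro hA s hs
  obtain ⟨t, s', A', h₁, h₂, h₃, h₄, h₅⟩ := hp hA s hs
  obtain ⟨t', s'', A'', k₁, k₂, k₃, k₄, k₅⟩ := hq A' h₅ h₄ s' h₃
  exact ⟨t + t', s'', A'', h₁.seq k₁, by rw [Nat.mul_add]; omega, k₃, k₄, k₅⟩

lemma skip (h : Q A) : Runs P .skip A 1 Q :=
  fun hA s hs => ⟨1, s, A, .skip s, by simp [unit], hs, hA, h⟩

lemma set {x : ℕ} {e : AExpr} (hc : e.compile.cost < unit) (hx : x ≠ 0 ∧ x < 40)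
    (hv : e.eval A ≤ P.W) (h : Q (A.set x (e.eval A))) : Runs P (set x e) A 1 Q := by
  intro hA s hs
  have hs' := hs.set hx.1 (e.eval A)
  have hA' := hA.set hx.2 hv
  rw [← e.eval_compile hs] at hs' hA' h
  exact ⟨_, _, _, .assign x e.compile s ⟨_, hs'.toLayout, hA'⟩, by omega, hs', hA', h⟩

lemma rd {x : ℕ} {j : AExpr} (hc : j.compile.cost + 1 < unit) (hx : x ≠ 0 ∧ x < 40)
    (hj : j.eval A < P.L) (hv : A.inp (j.eval A) ≤ P.W)
    (h : Q (A.set x (A.inp (j.eval A)))) : Runs P (rd x j) A 1 Q := by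
  intro hA s hs
  have hs' := hs.set hx.1 (A.inp (j.eval A))
  have hA' := hA.set hx.2 hv
  have hval : (Expr.load j.compile).eval s = A.inp (j.eval A) := by
    rw [Expr.eval, j.eval_compile hs, hs.inp _ hj]
  rw [← hval] at hs' hA' h
  exact ⟨_, _, _, .assign x (.load j.compile) s ⟨_, hs'.toLayout, hA'⟩,
    by simp only [Expr.cost]; omega, hs', hA', h⟩

lemma putWord {i : ℕ} {j e : AExpr} (hc : (Expr.addr i j.compile).cost + e.compile.cost < unit)
    (hi : i < 13) (hj : j.eval A ≤ P.m) (hv : e.eval A ≤ P.W)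
    (h : Q (A.put i (j.eval A) (e.eval A))) : Runs P (put i j e) A 1 Q := by
  intro hA s hs
  have hs' := hs.put (i := i) (by omega) (j.eval A) (e.eval A)
  have hA' := hA.putWord hi hj hv
  rw [← e.eval_compile hs, ← j.eval_compile hs, ← Expr.eval_addr hs] at hs'
  rw [← e.eval_compile hs, ← j.eval_compile hs] at hA' h
  exact ⟨_, _, _, .store _ e.compile s ⟨_, hs'.toLayout, hA'⟩, by omega, hs', hA', h⟩

lemma putBit {i : ℕ} {j e : AExpr} (hc : (Expr.addr i j.compile).cost + e.compile.cost < unit)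
    (hi : 13 ≤ i ∧ i < 16) (hj : j.eval A < 2 ^ P.n) (hv : e.eval A ≤ 1)
    (h : Q (A.put i (j.eval A) (e.eval A))) : Runs P (put i j e) A 1 Q := by
  intro hA s hs
  have hs' := hs.put (i := i) hi.2 (j.eval A) (e.eval A)
  have hA' := hA.putBit hi.1 hj hv
  rw [← e.eval_compile hs, ← j.eval_compile hs, ← Expr.eval_addr hs] at hs'
  rw [← e.eval_compile hs, ← j.eval_compile hs] at hA' h
  exact ⟨_, _, _, .store _ e.compile s ⟨_, hs'.toLayout, hA'⟩, by omega, hs', hA', h⟩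

lemma wr {j e : AExpr} (hc : j.compile.cost + e.compile.cost < unit)
    (hj : j.eval A < P.L) (hv : e.eval A ≤ 1)
    (h : Q (A.wr (j.eval A) (e.eval A))) : Runs P (wr j e) A 1 Q := by
  intro hA s hs
  have hs' := hs.wr hj (e.eval A)
  have hA' := hA.wr (j := j.eval A) hv
  rw [← e.eval_compile hs, ← j.eval_compile hs] at hs' hA' h
  exact ⟨_, _, _, .store _ e.compile s ⟨_, hs'.toLayout, hA'⟩, by omega, hs', hA', h⟩

lemma cond {e : AExpr} (v : ℕ) (hc : e.compile.cost < unit) (hv : e.eval A = v)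
    (hp : v ≠ 0 → Runs P p A T Q) (hq : v = 0 → Runs P q A T Q) :
    Runs P (cond e p q) A (T + 1) Q := by
  subst hv
  intro hA s hs
  by_cases he : e.eval A = 0
  · obtain ⟨t, s', A', h₁, h₂, h₃, h₄, h₅⟩ := hq he hA s hs
    exact ⟨_, s', A', .iteFalse (by rwa [e.eval_compile hs]) h₁, by rw [Nat.mul_add]; omega,
      h₃, h₄, h₅⟩
  · obtain ⟨t, s', A', h₁, h₂, h₃, h₄, h₅⟩ := hp he hA s hs
    exact ⟨_, s', A', .iteTrue (by rwa [e.eval_compile hs]) h₁, by rw [Nat.mul_add]; omega,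
      h₃, h₄, h₅⟩

/-- A loop whose running time is paid for by a potential. -/
lemma loop_potential {e : AExpr} (hc : e.compile.cost < unit) {Inv : ℕ → Abs → Prop}
    (hp : ∀ k A, Inv k A → Safe P A → e.eval A ≠ 0 →
      ∃ T k', T + 1 + k' ≤ k ∧ Runs P p A T (Inv k'))
    {k : ℕ} (h : Inv k A) :
    Runs P (loop e p) A (k + 1) fun A' => (∃ k', Inv k' A') ∧ e.eval A' = 0 := by
  intro hA s hs
  -- Each iteration pays for its body and its test out of the potential, so the potential decreases
  -- strictly.
  induction k using Nat.strong_induction_on generalizing A s with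
  | _ k ih =>
    by_cases he : e.eval A = 0
    · exact ⟨_, s, A, .whileFalse (by rwa [e.eval_compile hs]), by rw [Nat.mul_add]; omega,
        hs, hA, ⟨k, h⟩, he⟩
    · obtain ⟨T, k', hT, hrun⟩ := hp k A h hA he
      obtain ⟨t, s', A', h₁, h₂, h₃, h₄, h₅⟩ := hrun hA s hs
      obtain ⟨t', s'', A'', k₁, k₂, k₃, k₄, k₅⟩ := ih k' (by omega) h₅ h₄ s' h₃
      refine ⟨_, s'', A'', .whileTrue (by rwa [e.eval_compile hs]) h₁ k₁, ?_, k₃, k₄, k₅⟩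
      have : unit * (T + 1 + k') ≤ unit * k := Nat.mul_le_mul_left _ hT
      rw [Nat.mul_add] at k₂
      rw [Nat.mul_add, Nat.mul_add] at this
      rw [Nat.mul_add]
      omega

/-- A counting loop. -/
lemma loop_count {e : AExpr} (hc : e.compile.cost < unit) {Inv : ℕ → Abs → Prop} (N T : ℕ)
    (he : ∀ k A, Inv k A → k ≤ N → (e.eval A = 0 ↔ N ≤ k))
    (hp : ∀ k A, Inv k A → Safe P A → k < N → Runs P p A T (Inv (k + 1)))
    {k : ℕ} (hk : k ≤ N) (h : Inv k A) :
    Runs P (loop e p) A ((T + 1) * (N - k) + 1) (Inv N) := by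
  -- The potential is the cost of the remaining iterations.
  refine (loop_potential hc (Inv := fun b A => ∃ k, k ≤ N ∧ Inv k A ∧ b = (T + 1) * (N - k))
    ?_ ⟨k, hk, h, rfl⟩).mono le_rfl ?_
  · rintro b A ⟨k, hk, h, rfl⟩ hA h0
    have hlt : k < N := by
      by_contra hcon
      exact h0 ((he k A h hk).2 (not_lt.1 hcon))
    refine ⟨T, (T + 1) * (N - (k + 1)), ?_, (hp k A h hA hlt).mono le_rfl
      fun A' _ h' => ⟨k + 1, hlt, h', rfl⟩⟩
    rw [show N - k = N - (k + 1) + 1 by omega, Nat.mul_add]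
    omega
  · rintro A' _ ⟨⟨_, k, hk, h, -⟩, h0⟩
    have := (he k A' h hk).1 h0
    rwa [show N = k by omega]

end Runs

/-- A sequence of programs. -/
def block : List Program → Program
  | [] => .skip
  | p :: l => .seq p (block l)

namespace Runs

variable {P : Sizes} {p : Program} {l : List Program} {A : Abs} {T T₁ T₂ : ℕ} {Q Q₁ : Abs → Prop}

lemma block_nil (h : Q A) : Runs P (block []) A (T + 1) Q := (skip h).mono_time (by omega)

lemma block_cons (hp : Runs P p A T₁ Q₁) (hq : ∀ A', Q₁ A' → Runs P (block l) A' T₂ Q) :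
    Runs P (block (p :: l)) A (T₁ + T₂) Q := seq hp hq

/-- The written value `v` is a parameter separate from the expression, so that the next state
carries its mathematical meaning instead of an unevaluated term. -/
lemma block_set {x : ℕ} {e : AExpr} (v : ℕ) (hc : e.compile.cost < unit) (hx : x ≠ 0 ∧ x < 40)
    (he : e.eval A = v) (hv : v ≤ P.W) (h : Runs P (block l) (A.set x v) T Q) :
    Runs P (block (RAM.set x e :: l)) A (T + 1) Q := by
  subst he
  exact (seq (set (Q := (· = A.set x (e.eval A))) hc hx hv rfl)
    (by rintro _ rfl; exact h)).mono_time (Nat.add_comm 1 T).le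

lemma block_rd {x : ℕ} {e : AExpr} (j v : ℕ) (hc : e.compile.cost + 1 < unit)
    (hx : x ≠ 0 ∧ x < 40) (he : e.eval A = j) (hj : j < P.L) (hjv : A.inp j = v) (hv : v ≤ P.W)
    (h : Runs P (block l) (A.set x v) T Q) :
    Runs P (block (RAM.rd x e :: l)) A (T + 1) Q := by
  subst he hjv
  exact (seq (rd (Q := (· = A.set x (A.inp (e.eval A)))) hc hx hj hv rfl)
    (by rintro _ rfl; exact h)).mono_time (Nat.add_comm 1 T).le

lemma block_put {i : ℕ} {e₁ e₂ : AExpr} (j v : ℕ)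
    (hc : (Expr.addr i e₁.compile).cost + e₂.compile.cost < unit)
    (hi : i < 13) (hj : e₁.eval A = j) (hv : e₂.eval A = v) (hj' : j ≤ P.m) (hv' : v ≤ P.W)
    (h : Runs P (block l) (A.put i j v) T Q) :
    Runs P (block (RAM.put i e₁ e₂ :: l)) A (T + 1) Q := by
  subst hj hv
  exact (seq (putWord (Q := (· = A.put i (e₁.eval A) (e₂.eval A))) hc hi hj' hv' rfl)
    (by rintro _ rfl; exact h)).mono_time (Nat.add_comm 1 T).le

lemma block_putBit {i : ℕ} {e₁ e₂ : AExpr} (j v : ℕ)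
    (hc : (Expr.addr i e₁.compile).cost + e₂.compile.cost < unit)
    (hi : 13 ≤ i ∧ i < 16) (hj : e₁.eval A = j) (hv : e₂.eval A = v) (hj' : j < 2 ^ P.n)
    (hv' : v ≤ 1) (h : Runs P (block l) (A.put i j v) T Q) :
    Runs P (block (RAM.put i e₁ e₂ :: l)) A (T + 1) Q := by
  subst hj hv
  exact (seq (putBit (Q := (· = A.put i (e₁.eval A) (e₂.eval A))) hc hi hj' hv' rfl)
    (by rintro _ rfl; exact h)).mono_time (Nat.add_comm 1 T).le

lemma block_wr {e₁ e₂ : AExpr} (j v : ℕ) (hc : e₁.compile.cost + e₂.compile.cost < unit)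
    (hj : e₁.eval A = j) (hv : e₂.eval A = v) (hj' : j < P.L) (hv' : v ≤ 1)
    (h : Runs P (block l) (A.wr j v) T Q) :
    Runs P (block (RAM.wr e₁ e₂ :: l)) A (T + 1) Q := by
  subst hj hv
  exact (seq (wr (Q := (· = A.wr (e₁.eval A) (e₂.eval A))) hc hj' hv' rfl)
    (by rintro _ rfl; exact h)).mono_time (Nat.add_comm 1 T).le

end Runs

/-- The program `p` for `x = 0, …, N - 1`, where `N` is the value of `e`. -/
def forLoop (x : ℕ) (e : AExpr) (p : Program) : Program :=
  .seq (set x (.lit 0)) (loop (.lt (.reg x) e) (.seq p (set x (.add (.reg x) (.lit 1)))))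

/-- The invariant must not depend on the counter register (`hset`), so that resetting and
incrementing the counter preserve it. Each round costs the body, the increment and the test. -/
lemma Runs.forLoop {P : Sizes} {p : Program} {A : Abs} {x : ℕ} {e : AExpr} (Inv : ℕ → Abs → Prop)
    (N T : ℕ) (hc : e.compile.cost + 10 < unit) (hx : x ≠ 0 ∧ x < 40) (hN : N ≤ P.W)
    (hset : ∀ k A v, Inv k A → Inv k (A.set x v)) (he : ∀ k A, Inv k A → e.eval A = N)
    (hp : ∀ k A, Inv k A → Safe P A → A.r x = k → k < N →
      Runs P p A T fun A' => Inv (k + 1) A' ∧ A'.r x = k)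
    (h : Inv 0 A) : Runs P (forLoop x e p) A ((T + 2) * N + 2) (Inv N) := by
  have hc' : (AExpr.lt (.reg x) e).compile.cost < unit := by
    simp only [AExpr.compile, Expr.cost]
    omega
  have h₁ : Runs P (RAM.set x (.lit 0)) A 1 fun A' => Inv 0 A' ∧ A'.r x = 0 :=
    set (by simp only [AExpr.compile, Expr.cost, unit]; omega) hx (Nat.zero_le _)
      ⟨hset 0 A _ h, by simp⟩
  refine (h₁.seq (T₂ := (T + 1 + 1) * (N - 0) + 1) fun A' hA' =>
    (loop_count (Inv := fun k A => Inv k A ∧ A.r x = k) hc' N (T + 1) ?_ ?_ (Nat.zero_le _)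
      hA').mono le_rfl fun _ _ h => h.1).mono_time ?_
  · rintro k A ⟨hI, rfl⟩ _
    simp [he _ A hI]
  · rintro k A ⟨hI, hk⟩ hA hkN
    refine seq (hp k A hI hA hk hkN) fun A' h' => ?_
    refine set (by simp only [AExpr.compile, Expr.cost, unit]; omega) hx ?_ ⟨hset _ _ _ h'.1, ?_⟩
    · simp [h'.2]
      omega
    · simp [h'.2]
  · rw [Nat.sub_zero]
    change 1 + ((T + 2) * N + 1) ≤ _
    omega

end RAM

/-! ## Attractors by a worklist -/

namespace MullerGame

variable {n : ℕ}

/-- The edges of an arena are `(src e, dst e)` for `e < m`, and the edges into `u` are those with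
`st u ≤ e < st (u + 1)`. -/
structure IsAdjacency (A : Arena (Fin n)) (m : ℕ) (src dst : ℕ → Fin n) (st : ℕ → ℕ) : Prop where
  mem_iff : ∀ u w, (u, w) ∈ A.edges ↔ ∃ e < m, src e = u ∧ dst e = w
  seg : ∀ u : Fin n, ∀ e, st u ≤ e ∧ e < st (u + 1) ↔ e < m ∧ dst e = u
  mono : ∀ u : Fin n, st u ≤ st (u + 1)
  le : st n ≤ m

section

variable (A : Arena (Fin n)) (m : ℕ) (src dst : ℕ → Fin n)

open Classical in
/-- The number of edges from `w` into `S` that are not in `D`. -/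
noncomputable def outCount (S : Finset (Fin n)) (D : ℕ → Prop) (w : Fin n) : ℕ :=
  ((Finset.range m).filter fun e => src e = w ∧ dst e ∈ S ∧ ¬ D e).card

/-- The number of edges from `w` that have to be processed until `w` is known to be in the
attractor; it is `0` if `w` is already known to be there, or not in `S`. -/
noncomputable def need (σ : Fin 2) (S : Finset (Fin n)) (l : List (Fin n)) (D : ℕ → Prop)
    (w : Fin n) : ℕ :=
  if w ∈ S ∧ w ∉ l then (if A.owner w = σ then 1 else outCount m src dst S D w) else 0

/-- `l` lists positions that have been found to be in the attractor of `v` after the edges in `D`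
have been processed. -/
structure Worklist (σ : Fin 2) (S : Finset (Fin n)) (v : Fin n) (l : List (Fin n))
    (D : ℕ → Prop) : Prop where
  nodup : l.Nodup
  sub : ∀ u ∈ l, u ∈ attr A σ S {v}
  mem : v ∈ l
  own : ∀ e, e < m → D e → src e ∈ S → src e ∉ l → A.owner (src e) ≠ σ
  pos : ∀ w ∈ S, w ∉ l → A.owner w ≠ σ → 0 < outCount m src dst S D w

end

variable {A : Arena (Fin n)} {m : ℕ} {src dst : ℕ → Fin n} {st : ℕ → ℕ}
  {σ : Fin 2} {S : Finset (Fin n)} {v : Fin n} {l : List (Fin n)} {D D' : ℕ → Prop}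

lemma outCount_pos {w : Fin n} : 0 < outCount m src dst S D w ↔
    ∃ e < m, src e = w ∧ dst e ∈ S ∧ ¬ D e := by
  classical
  simp only [outCount, Finset.card_pos, Finset.Nonempty, Finset.mem_filter, Finset.mem_range]

lemma outCount_congr {w : Fin n} (h : ∀ e < m, src e = w → dst e ∈ S → (D e ↔ D' e)) :
    outCount m src dst S D w = outCount m src dst S D' w := by
  classical
  unfold outCount
  congr 1
  refine Finset.filter_congr fun e he => ?_
  rw [Finset.mem_range] at he
  constructor
  · rintro ⟨h₁, h₂, h₃⟩
    exact ⟨h₁, h₂, fun h' => h₃ ((h e he h₁ h₂).2 h')⟩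
  · rintro ⟨h₁, h₂, h₃⟩
    exact ⟨h₁, h₂, fun h' => h₃ ((h e he h₁ h₂).1 h')⟩

lemma outCount_insert {e : ℕ} (he : e < m) (heS : dst e ∈ S) (heD : ¬ D e) :
    outCount m src dst S D (src e) =
      outCount m src dst S (fun e' => D e' ∨ e' = e) (src e) + 1 := by
  classical
  unfold outCount
  rw [← Finset.card_erase_add_one (a := e)]
  · congr 2
    ext e'
    simp only [Finset.mem_erase, Finset.mem_filter, Finset.mem_range]
    tauto
  · simp [he, heS, heD]

lemma Worklist.congr (h : Worklist A m src dst σ S v l D) (hD : ∀ e < m, D e ↔ D' e) :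
    Worklist A m src dst σ S v l D' where
  nodup := h.nodup
  sub := h.sub
  mem := h.mem
  own e he hDe := h.own e he ((hD e he).2 hDe)
  pos w hw hwl ho := by
    rw [← outCount_congr (D := D) fun e he _ _ => hD e he]
    exact h.pos w hw hwl ho

lemma need_congr (hD : ∀ e < m, D e ↔ D' e) (w : Fin n) :
    need A m src dst σ S l D w = need A m src dst σ S l D' w := by
  unfold need
  rw [outCount_congr (D := D) fun e he _ _ => hD e he]

/-- With no edge processed, the count of a position is its number of edges into $S$. -/
lemma isSubarena_iff_outCount (hE : IsAdjacency A m src dst st) :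
    IsSubarena A S ↔ ∀ u ∈ S, outCount m src dst S (fun _ => False) u ≠ 0 := by
  refine forall₂_congr fun u _ => ?_
  rw [← Nat.pos_iff_ne_zero, outCount_pos]
  constructor
  · rintro ⟨w, hw, he⟩
    obtain ⟨e, hem, rfl, rfl⟩ := (hE.mem_iff u w).1 he
    exact ⟨e, hem, rfl, hw, id⟩
  · rintro ⟨e, he, rfl, hw, -⟩
    exact ⟨_, hw, (hE.mem_iff _ _).2 ⟨e, he, rfl, rfl⟩⟩

/-- That $S$ is a subarena is needed for `pos`: a dead end of the opponent would be attracted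
vacuously, without any edge that announces it. -/
lemma Worklist.init (hE : IsAdjacency A m src dst st) (hS : IsSubarena A S) (hv : v ∈ S) :
    Worklist A m src dst σ S v [v] (fun _ => False) where
  nodup := List.nodup_singleton v
  sub u hu := by
    rw [List.mem_singleton.1 hu]
    exact subset_attr (Finset.singleton_subset_iff.2 hv) (Finset.mem_singleton_self v)
  mem := List.mem_singleton_self v
  own _ _ h := h.elim
  pos w hw _ _ := Nat.pos_iff_ne_zero.2 ((isSubarena_iff_outCount hE).1 hS w hw)

/-- A zero counter marks a position as irrelevant, so one array serves both as counter and as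
membership test. An undecided position of σ has counter one, so both owners are treated alike:
decrease, and attract at zero. -/
lemma Worklist.need_eq_zero (h : Worklist A m src dst σ S v l D) {w : Fin n} :
    need A m src dst σ S l D w = 0 ↔ ¬ (w ∈ S ∧ w ∉ l) := by
  unfold need
  split_ifs with h₁ h₂
  · simp [h₁]
  · have := h.pos w h₁.1 h₁.2 h₂
    simp [h₁, this.ne']
  · simp [h₁]

lemma need_insert_of_ne {e : ℕ} {w : Fin n} (hw : w ≠ src e) :
    need A m src dst σ S l (fun e' => D e' ∨ e' = e) w = need A m src dst σ S l D w := by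
  unfold need
  rw [outCount_congr (D := D)]
  rintro e' _ rfl _
  simp only [iff_self_or]
  rintro rfl
  exact absurd rfl hw

variable {e : ℕ}

/-- An edge from a position that is not in question. -/
lemma Worklist.skip (h : Worklist A m src dst σ S v l D)
    (h0 : need A m src dst σ S l D (src e) = 0) :
    Worklist A m src dst σ S v l (fun e' => D e' ∨ e' = e) ∧
      need A m src dst σ S l (fun e' => D e' ∨ e' = e) = need A m src dst σ S l D := by
  rw [h.need_eq_zero] at h0
  constructor
  · refine ⟨h.nodup, h.sub, h.mem, ?_, fun w hw hwl ho => ?_⟩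
    · rintro e' he' (hD | rfl) h₁ h₂
      · exact h.own e' he' hD h₁ h₂
      · exact absurd ⟨h₁, h₂⟩ h0
    · rw [outCount_congr (D' := D)]
      · exact h.pos w hw hwl ho
      · rintro e' _ rfl _
        simp only [or_iff_left_iff_imp]
        rintro rfl
        exact absurd ⟨hw, hwl⟩ h0
  · funext w
    by_cases hw : w = src e
    · subst hw
      rw [need, need, if_neg h0, if_neg h0]
    · exact need_insert_of_ne hw

/-- An edge that does not yet decide about its source. -/
lemma Worklist.decrease (h : Worklist A m src dst σ S v l D) (he : e < m) (heS : dst e ∈ S)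
    (heD : ¬ D e) (h0 : 1 < need A m src dst σ S l D (src e)) :
    Worklist A m src dst σ S v l (fun e' => D e' ∨ e' = e) ∧
      need A m src dst σ S l (fun e' => D e' ∨ e' = e) (src e) + 1 =
        need A m src dst σ S l D (src e) := by
  unfold need at h0 ⊢
  split_ifs at h0 with h₁ h₂
  · omega
  swap
  · omega
  rw [if_pos h₁, if_neg h₂, if_pos h₁, if_neg h₂]
  rw [outCount_insert he heS heD] at h0 ⊢
  refine ⟨⟨h.nodup, h.sub, h.mem, ?_, fun w hw hwl ho => ?_⟩, rfl⟩
  · rintro e' he' (hD | rfl) h₃ h₄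
    · exact h.own e' he' hD h₃ h₄
    · exact h₂
  · by_cases hw' : w = src e
    · rw [hw']
      omega
    · rw [outCount_congr (D' := D)]
      · exact h.pos w hw hwl ho
      · rintro e' _ rfl _
        simp only [or_iff_left_iff_imp]
        rintro rfl
        exact absurd rfl hw'

/-- An edge that puts its source into the attractor. -/
lemma Worklist.attract (hE : IsAdjacency A m src dst st) (h : Worklist A m src dst σ S v l D)
    (he : e < m) (hel : dst e ∈ l) (heD : ¬ D e) (hDl : ∀ e < m, D e → dst e ∈ l)
    (h0 : need A m src dst σ S l D (src e) = 1) :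
    (src e ∈ S ∧ src e ∉ l) ∧
    Worklist A m src dst σ S v (l ++ [src e]) (fun e' => D e' ∨ e' = e) ∧
      ∀ w, need A m src dst σ S (l ++ [src e]) (fun e' => D e' ∨ e' = e) w =
        if w = src e then 0 else need A m src dst σ S l D w := by
  have heS : dst e ∈ S := attr_subset (h.sub _ hel)
  have h₁ : src e ∈ S ∧ src e ∉ l := by
    by_contra hcon
    rw [h.need_eq_zero.2 hcon] at h0
    omega
  refine ⟨h₁, ⟨?_, ?_, List.mem_append_left _ h.mem, ?_, ?_⟩, fun w => ?_⟩
  · rw [List.nodup_append]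
    refine ⟨h.nodup, List.nodup_singleton _, fun a ha b hb => ?_⟩
    rw [List.mem_singleton.1 hb]
    exact fun h' => h₁.2 (h' ▸ ha)
  · intro u hu
    rcases List.mem_append.1 hu with hu | hu
    · exact h.sub u hu
    · rw [List.mem_singleton.1 hu]
      by_cases ho : A.owner (src e) = σ
      · exact mem_attr_of_owner h₁.1 ho (h.sub _ hel) ((hE.mem_iff _ _).2 ⟨e, he, rfl, rfl⟩)
      · rw [need, if_pos h₁, if_neg ho, outCount_insert he heS heD] at h0
        -- After this edge no edge from its source into $S$ is unprocessed, and processed edges end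
        -- in listed positions.
        refine mem_attr_of_forall h₁.1 ho fun w hw hew => ?_
        obtain ⟨e', he', hs, rfl⟩ := (hE.mem_iff _ _).1 hew
        by_contra hcon
        have : 0 < outCount m src dst S (fun e' => D e' ∨ e' = e) (src e) := by
          refine outCount_pos.2 ⟨e', he', hs, hw, ?_⟩
          rintro (hD | rfl)
          · exact hcon (h.sub _ (hDl e' he' hD))
          · exact hcon (h.sub _ hel)
        omega
  · rintro e' he' (hD | rfl) h₃ h₄
    · exact h.own e' he' hD h₃ fun h' => h₄ (List.mem_append_left _ h')
    · exact absurd (List.mem_append_right _ (List.mem_singleton_self _)) h₄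
  · intro w hw hwl ho
    have hwe : w ≠ src e := fun h' =>
      hwl (h' ▸ List.mem_append_right _ (List.mem_singleton_self _))
    rw [outCount_congr (D' := D)]
    · exact h.pos w hw (fun h' => hwl (List.mem_append_left _ h')) ho
    · rintro e' _ rfl _
      simp only [or_iff_left_iff_imp]
      rintro rfl
      exact absurd rfl hwe
  · split_ifs with hw
    · rw [need, if_neg]
      simp [hw]
    · have := need_insert_of_ne (A := A) (m := m) (dst := dst) (σ := σ) (S := S) (l := l)
        (D := D) hw
      rw [← this]
      simp [need, hw]

/-- When the edges into all listed positions have been processed, the list is the attractor. -/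
lemma Worklist.eq_attr (hE : IsAdjacency A m src dst st) (h : Worklist A m src dst σ S v l D)
    (hD : ∀ e < m, D e ↔ dst e ∈ l) : l.toFinset = attr A σ S {v} := by
  apply subset_antisymm
  · exact fun u hu => h.sub u (List.mem_toFinset.1 hu)
  · refine attr_subset_of_closed ?_ ?_ ?_
    · rw [Finset.singleton_subset_iff, List.mem_toFinset]
      exact h.mem
    · intro u hu w _ hwl ho he
      rw [List.mem_toFinset] at hwl ⊢
      obtain ⟨e, hem, rfl, rfl⟩ := (hE.mem_iff _ _).1 he
      by_contra hul
      exact h.own e hem ((hD e hem).2 hwl) hu hul ho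
    · intro u hu ho hall
      rw [List.mem_toFinset]
      by_contra hul
      obtain ⟨e, he, rfl, heS, heD⟩ := outCount_pos.1 (h.pos u hu hul ho)
      refine heD ((hD e he).2 (List.mem_toFinset.1 (hall _ heS ?_)))
      exact (hE.mem_iff _ _).2 ⟨e, he, rfl, rfl⟩

/-! ## Sets of positions as numbers -/

/-- The number whose binary digits are given by `S`. -/
def mask (S : Finset (Fin n)) : ℕ := ∑ v ∈ S, 2 ^ (v : ℕ)

lemma mask_eq_sum_image (S : Finset (Fin n)) :
    mask S = ∑ i ∈ S.map Fin.valEmbedding, 2 ^ i := by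
  rw [Finset.sum_map]
  rfl

lemma mask_injective : Function.Injective (mask (n := n)) := by
  intro S T h
  rw [mask_eq_sum_image, mask_eq_sum_image] at h
  exact Finset.map_injective _ (Finset.geomSum_injective le_rfl h)

lemma mask_univ_le : mask (Finset.univ : Finset (Fin n)) + 1 = 2 ^ n := by
  rw [mask, Fin.sum_univ_eq_sum_range (fun i => 2 ^ i), Nat.geomSum_eq le_rfl]
  have := Nat.one_le_two_pow (n := n)
  simp
  omega

lemma mask_le_of_subset {S T : Finset (Fin n)} (h : S ⊆ T) : mask S ≤ mask T :=
  Finset.sum_le_sum_of_subset h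

lemma mask_lt (S : Finset (Fin n)) : mask S < 2 ^ n := by
  have := mask_le_of_subset (Finset.subset_univ S)
  have := mask_univ_le (n := n)
  omega

lemma mask_empty : mask (∅ : Finset (Fin n)) = 0 := rfl

/-- This is why increasing order of the numbers is an admissible order for the dynamic program. -/
lemma mask_lt_of_ssubset {S T : Finset (Fin n)} (h : S ⊂ T) : mask S < mask T :=
  lt_of_le_of_ne (mask_le_of_subset h.1) fun h' => h.ne (mask_injective h')

lemma mask_erase {S : Finset (Fin n)} (h : v ∈ S) : mask (S.erase v) = mask S - 2 ^ (v : ℕ) := by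
  have := Finset.sum_erase_add S (fun v : Fin n => 2 ^ (v : ℕ)) h
  unfold mask
  omega

lemma exists_mask_eq {k : ℕ} (h : k < 2 ^ n) : ∃ S : Finset (Fin n), mask S = k := by
  let f : Finset (Fin n) → Fin (2 ^ n) := fun S => ⟨mask S, mask_lt S⟩
  -- Surjectivity by counting: an injective map between finite sets of equal size $2^n$.
  have hf : Function.Bijective f := by
    rw [Fintype.bijective_iff_injective_and_card]
    exact ⟨fun S T h => mask_injective (Fin.mk.inj h), by simp⟩
  obtain ⟨S, hS⟩ := hf.2 ⟨k, h⟩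
  exact ⟨S, congrArg Fin.val hS⟩

end MullerGame

/-! ### The worklist algorithm as a program -/

namespace MullerGame

open RAM RAM.AExpr

variable {n : ℕ}

/-- The game as it is stored in the arrays. -/
structure Env (G : MullerGame (Fin n)) (m : ℕ) (src dst : ℕ → Fin n) (st : ℕ → ℕ) (A : Abs) :
    Prop where
  r1 : A.r 1 = n
  r2 : A.r 2 = m
  r4 : A.r 4 = 2 ^ n
  pow : ∀ v : Fin n, A.a 0 v = 2 ^ (v : ℕ)
  own : ∀ v : Fin n, A.a 1 v = G.owner v
  start : ∀ u, u ≤ n → A.a 2 u = st u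
  src : ∀ e, e < m → A.a 3 e = src e
  dst : ∀ e, e < m → A.a 4 e = dst e
  win : ∀ S : Finset (Fin n), A.a 13 (mask S) = if S ∈ G.F 0 then 1 else 0

/-- The sizes of a computation suffice for a game with `n` positions and `m` edges. -/
structure Fits (P : Sizes) (n m : ℕ) : Prop where
  n_eq : P.n = n
  m_le : n + m ≤ P.m
  W_le : n + m + 2 ≤ P.W
  pow_le : 2 ^ n ≤ P.W

variable {G : MullerGame (Fin n)} {m : ℕ} {src dst : ℕ → Fin n} {st : ℕ → ℕ} {A A' : Abs}
  {P : Sizes} {σ : Fin 2} {S : Finset (Fin n)} {v : Fin n} {l : List (Fin n)} {D : ℕ → Prop}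

/-- The frame rule: the stored game survives every program that leaves its registers and arrays
alone. -/
lemma Env.of_same {R I : List ℕ} (hE : Env G m src dst st A) (h : Abs.Same R I A A')
    (hR : ∀ x ∈ [1, 2, 4], x ∉ R) (hI : ∀ i ∈ [0, 1, 2, 3, 4, 13], i ∉ I) :
    Env G m src dst st A' where
  r1 := by rw [h.r 1 (hR 1 (by decide)), hE.r1]
  r2 := by rw [h.r 2 (hR 2 (by decide)), hE.r2]
  r4 := by rw [h.r 4 (hR 4 (by decide)), hE.r4]
  pow v := by rw [h.a 0 (hI 0 (by decide)), hE.pow]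
  own v := by rw [h.a 1 (hI 1 (by decide)), hE.own]
  start u hu := by rw [h.a 2 (hI 2 (by decide)), hE.start u hu]
  src e he := by rw [h.a 3 (hI 3 (by decide)), hE.src e he]
  dst e he := by rw [h.a 4 (hI 4 (by decide)), hE.dst e he]
  win S := by rw [h.a 13 (hI 13 (by decide)), hE.win]

/-- The state of the computation of an attractor. -/
structure AttrInv (G : MullerGame (Fin n)) (m : ℕ) (src dst : ℕ → Fin n) (σ : Fin 2)
    (S : Finset (Fin n)) (v : Fin n) (l : List (Fin n)) (D : ℕ → Prop) (A : Abs) : Prop where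
  wl : Worklist G.toArena m src dst σ S v l D
  cnt : ∀ w : Fin n, A.a 7 w = need G.toArena m src dst σ S l D w
  queue : ∀ (j : ℕ) (hj : j < l.length), A.a 9 j = (l[j] : Fin n)
  tail : A.r 14 = l.length
  rest : A.r 12 = mask (S \ l.toFinset)

/-- Process the edge with index `r16`. -/
def edgeStep : Program := block [
  set 18 (get 3 (reg 16)),
  cond (get 7 (reg 18))
    (block [
      put 7 (reg 18) (sub (get 7 (reg 18)) (lit 1)),
      cond (get 7 (reg 18)) .skip
        (block [
          set 12 (sub (reg 12) (get 0 (reg 18))),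
          put 9 (reg 14) (reg 18),
          set 14 (add (reg 14) (lit 1))])])
    .skip,
  set 16 (add (reg 16) (lit 1))]

/-- The three outcomes for the counter of the source (zero, still positive after the decrease,
dropping to zero) are `Worklist.skip`, `Worklist.decrease` and `Worklist.attract`. -/
lemma edgeStep_runs (hP : Fits P n m) (hG : IsAdjacency G.toArena m src dst st)
    (hE : Env G m src dst st A) {e : ℕ} (he : A.r 16 = e) (hem : e < m)
    (h : AttrInv G m src dst σ S v l D A) (hel : dst e ∈ l) (heD : ¬ D e)
    (hDl : ∀ e < m, D e → dst e ∈ l) :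
    Runs P edgeStep A 15 fun A' => Abs.Same [12, 14, 16, 18] [7, 9] A A' ∧ A'.r 16 = e + 1 ∧
      ∃ l', l <+: l' ∧ AttrInv G m src dst σ S v l' (fun e' => D e' ∨ e' = e) A' := by
  have hW := hP.W_le
  have hm := hP.m_le
  have hw : (src e : ℕ) < n := (src e).2
  refine Runs.of_safe fun hA => ?_
  refine Runs.block_set (src e) (by decide) (by decide) (by simp [he, hE.src e hem]) (by omega) ?_
  refine Runs.block_cons (T₁ := 10) (T₂ := 4) (Q₁ := fun A' => Abs.Same [12, 14, 18] [7, 9] A A' ∧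
    ∃ l', l <+: l' ∧ AttrInv G m src dst σ S v l' (fun e' => D e' ∨ e' = e) A') ?_ ?_
  · have hS₀ : Abs.Same [12, 14, 18] [7, 9] A (A.set 18 (src e)) :=
      (Abs.Same.refl _ _ A).set (by decide)
    refine Runs.cond (need G.toArena m src dst σ S l D (src e)) (by decide)
      (by simp [h.cnt]) ?_ ?_
    · intro h0
      refine Runs.block_put (src e) (need G.toArena m src dst σ S l D (src e) - 1) (by decide)
        (by decide) (by simp) (by simp [h.cnt]) (by omega) ?_ ?_
      · have := hA.word_le 7 (src e) (by decide)
        rw [h.cnt] at this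
        omega
      refine Runs.block_cons (T₁ := 7) (T₂ := 1) (Q₁ := fun A' =>
        Abs.Same [12, 14, 18] [7, 9] A A' ∧
        ∃ l', l <+: l' ∧ AttrInv G m src dst σ S v l' (fun e' => D e' ∨ e' = e) A') ?_
        fun A' h => Runs.block_nil h
      refine Runs.cond (need G.toArena m src dst σ S l D (src e) - 1) (by decide)
        (by simp) ?_ ?_
      · intro h1
        refine (Runs.skip ⟨hS₀.put (by decide), l, List.prefix_rfl, ?_⟩).mono_time (by omega)
        obtain ⟨hwl, hn⟩ := h.wl.decrease hem (attr_subset (h.wl.sub _ hel)) heD (by omega)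
        refine ⟨hwl, fun w => ?_, by simpa using h.queue, by simpa using h.tail,
          by simpa using h.rest⟩
        by_cases hwe : w = src e
        · simp [hwe, ← hn]
        · simp [Fin.val_inj, hwe, need_insert_of_ne hwe, h.cnt]
      · intro h1
        obtain ⟨⟨hS, hnl⟩, hwl, hn⟩ := h.wl.attract hG hem hel heD hDl (by omega)
        -- The list has no repetitions, so the queue never outgrows the $n$ available cells.
        have hlen := hwl.nodup.length_le_card
        simp only [List.length_append, List.length_singleton, Fintype.card_fin] at hlen
        refine Runs.block_set (mask (S \ (l ++ [src e]).toFinset)) (by decide) (by decide) ?_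
          ((mask_lt _).le.trans hP.pow_le) ?_
        -- Keeping the number of the complement up to date costs one subtraction per attracted
        -- position, and at the end it is directly the index into the tables.
        · have : S \ (l ++ [src e]).toFinset = (S \ l.toFinset).erase (src e) := by
            ext w
            simp
            tauto
          rw [this, mask_erase (Finset.mem_sdiff.2 ⟨hS, fun h' => hnl (List.mem_toFinset.1 h')⟩)]
          simp [h.rest, hE.pow]
        refine Runs.block_put l.length (src e) (by decide) (by decide) (by simp [h.tail])
          (by simp) (by omega) (by omega) ?_
        refine Runs.block_set (l.length + 1) (by decide) (by decide) (by simp [h.tail])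
          (by omega) (Runs.block_nil ⟨?_, _, List.prefix_append _ _, hwl, ?_, ?_, ?_, ?_⟩)
        · exact ((((hS₀.put (by decide)).set (by decide)).put (by decide)).set (by decide))
        · intro w
          by_cases hwe : w = src e
          · simp [hwe, hn, h1]
          · simp [Fin.val_inj, hwe, hn, h.cnt]
        · intro j hj
          rw [List.length_append, List.length_singleton] at hj
          rcases (Nat.lt_succ_iff.1 hj).eq_or_lt with rfl | hj'
          · simp
          · simp [hj'.ne, h.queue j hj', List.getElem_append_left hj']
        · simp
        · simp
    · intro h0
      obtain ⟨hwl, hn⟩ := h.wl.skip (e := e) h0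
      refine (Runs.skip ⟨hS₀, l, List.prefix_rfl, hwl, ?_, by simpa using h.queue,
        by simpa using h.tail, by simpa using h.rest⟩).mono_time (by omega)
      simpa [hn] using h.cnt
  · rintro A' ⟨hS, l', hl', hI⟩
    refine Runs.block_set (e + 1) (by decide) (by decide) (by simp [hS.r 16 (by decide), he])
      (by omega) (Runs.block_nil ⟨?_, by simp, l', hl', ?_⟩)
    · exact ((Abs.Same.refl _ _ A).trans hS (by simp) (by simp)).set (by decide)
    · exact ⟨hI.wl, hI.cnt, hI.queue, by simpa using hI.tail, by simpa using hI.rest⟩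

lemma AttrInv.congr {D' : ℕ → Prop} (h : AttrInv G m src dst σ S v l D A)
    (hD : ∀ e < m, D e ↔ D' e) : AttrInv G m src dst σ S v l D' A where
  wl := h.wl.congr hD
  cnt w := by rw [h.cnt, need_congr hD]
  queue := h.queue
  tail := h.tail
  rest := h.rest

lemma AttrInv.of_same {R : List ℕ} (h : AttrInv G m src dst σ S v l D A)
    (hS : Abs.Same R [] A A') (h12 : 12 ∉ R) (h14 : 14 ∉ R) :
    AttrInv G m src dst σ S v l D A' where
  wl := h.wl
  cnt w := by rw [hS.a 7 (by decide), h.cnt]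
  queue j hj := by rw [hS.a 9 (by decide), h.queue j hj]
  tail := by rw [hS.r 14 h14, h.tail]
  rest := by rw [hS.r 12 h12, h.rest]

/-- Process the edges into the position at the head of the queue. -/
def queueStep : Program := block [
  set 15 (get 9 (reg 13)),
  set 16 (get 2 (reg 15)),
  set 17 (get 2 (add (reg 15) (lit 1))),
  set 13 (add (reg 13) (lit 1)),
  loop (lt (reg 16) (reg 17)) edgeStep]

lemma queueStep_runs (hP : Fits P n m) (hG : IsAdjacency G.toArena m src dst st)
    (hE : Env G m src dst st A) {h : ℕ} (hh : h < l.length) (hr : A.r 13 = h)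
    (hI : AttrInv G m src dst σ S v l (fun e => dst e ∈ l.take h) A) :
    Runs P queueStep A (16 * (st (l[h] + 1) - st l[h]) + 6) fun A' =>
      Abs.Same [12, 13, 14, 15, 16, 17, 18] [7, 9] A A' ∧ A'.r 13 = h + 1 ∧
      ∃ l', l <+: l' ∧ AttrInv G m src dst σ S v l' (fun e => dst e ∈ l'.take (h + 1)) A' := by
  have hW := hP.W_le
  obtain ⟨u, hu⟩ : ∃ u, u = l[h] := ⟨_, rfl⟩
  rw [← hu]
  have hul : u ∈ l := hu ▸ List.getElem_mem hh
  have hun : (u : ℕ) < n := u.2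
  have hlen := hI.wl.nodup.length_le_card
  rw [Fintype.card_fin] at hlen
  have htake : l.take (h + 1) = l.take h ++ [u] := by rw [hu, List.take_append_getElem]
  have hunt : u ∉ l.take h := by
    have := (hI.wl.nodup.sublist (List.take_sublist (h + 1) l))
    rw [htake, List.nodup_append] at this
    exact fun hcon => this.2.2 u hcon u (List.mem_singleton_self u) rfl
  refine Runs.of_safe fun hA => ?_
  have hst : ∀ k ≤ n, st k ≤ P.W := fun k hk => by
    rw [← hE.start k hk]
    exact hA.word_le 2 k (by decide)
  have hq : A.a 9 h = u := by rw [hI.queue h hh, hu]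
  refine (Runs.block_set (T := 16 * (st (u + 1) - st u) + 2 + 3) u (by decide) (by decide)
    (by simp [hr, hq]) (by omega) ?_).mono_time (by omega)
  refine Runs.block_set (st u) (by decide) (by decide) (by simp [hE.start u hun.le])
    (hst _ hun.le) ?_
  refine Runs.block_set (st (u + 1)) (by decide) (by decide) (by simp [hE.start (u + 1) hun])
    (hst _ hun) ?_
  refine Runs.block_set (h + 1) (by decide) (by decide) (by simp [hr]) (by omega) ?_
  refine (Runs.block_cons (T₁ := (15 + 1) * (st (u + 1) - st u) + 1) (T₂ := 1)
    (Runs.loop_count (by decide) (st (u + 1)) 15 (Inv := fun k A' => st u ≤ k ∧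
      Abs.Same [12, 13, 14, 15, 16, 17, 18] [7, 9] A A' ∧ A'.r 13 = h + 1 ∧ A'.r 16 = k ∧
      A'.r 17 = st (u + 1) ∧ ∃ l', l <+: l' ∧
        AttrInv G m src dst σ S v l' (fun e => dst e ∈ l.take h ∨ (st u ≤ e ∧ e < k)) A')
      ?_ ?_ (hG.mono u) ?_) ?_).mono_time (by omega)
  · rintro k A' ⟨-, -, -, h16, h17, -⟩ -
    simp [h16, h17]
  · rintro k A' ⟨hk, hS, h13, h16, h17, l', hl', hI'⟩ _ hk'
    obtain ⟨hkm, hku⟩ := (hG.seg u k).1 ⟨hk, hk'⟩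
    refine (edgeStep_runs hP hG (hE.of_same hS (by decide) (by decide)) h16 hkm hI'
      (hl'.subset (hku ▸ hul)) ?_ ?_).mono le_rfl ?_
    · rw [hku]
      rintro (h' | h')
      · exact hunt h'
      · omega
    · rintro e he (h' | h')
      · exact hl'.subset (List.mem_of_mem_take h')
      · rw [((hG.seg u e).1 ⟨h'.1, by omega⟩).2]
        exact hl'.subset hul
    · rintro A'' - ⟨hS', h16', l'', hl'', hI''⟩
      refine ⟨by omega, hS.trans hS' (by simp) (by simp), ?_, h16', ?_, l'', hl'.trans hl'',
        hI''.congr fun e _ => ?_⟩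
      · rw [hS'.r 13 (by decide), h13]
      · rw [hS'.r 17 (by decide), h17]
      · constructor
        · rintro ((h' | h') | rfl)
          · exact Or.inl h'
          · exact Or.inr (by omega)
          · exact Or.inr (by omega)
        · rintro (h' | h')
          · exact Or.inl (Or.inl h')
          · by_cases hek : e = k
            · exact Or.inr hek
            · exact Or.inl (Or.inr (by omega))
  · have hS : ∀ R, 15 ∈ R → 16 ∈ R → 17 ∈ R → 13 ∈ R → ∀ I, Abs.Same R I A
        ((((A.set 15 u).set 16 (st u)).set 17 (st (u + 1))).set 13 (h + 1)) :=
      fun R h₁ h₂ h₃ h₄ I => ((((Abs.Same.refl _ _ A).set h₁).set h₂).set h₃).set h₄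
    refine ⟨le_rfl, hS _ (by decide) (by decide) (by decide) (by decide) _, by simp, by simp,
      by simp, l, List.prefix_rfl, ?_⟩
    refine (hI.of_same (hS [13, 15, 16, 17] (by decide) (by decide) (by decide) (by decide) _)
      (by decide) (by decide)).congr fun e _ => ?_
    constructor
    · exact Or.inl
    · rintro (h' | h')
      · exact h'
      · omega
  · rintro A' ⟨-, hS, h13, -, -, l', hl', hI'⟩
    refine Runs.block_nil ⟨hS, h13, l', hl', hI'.congr fun e he => ?_⟩
    -- The queue only grows at its end, so its processed prefix is unchanged.
    have : l'.take (h + 1) = l.take (h + 1) := by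
      obtain ⟨t, rfl⟩ := hl'
      rw [List.take_append_of_le_length (by omega)]
    rw [this, htake, List.mem_append, List.mem_singleton, hG.seg u e]
    simp [he]

end MullerGame

/-! ### The program for a single attractor -/

namespace MullerGame

open RAM RAM.AExpr

variable {n : ℕ} {G : MullerGame (Fin n)} {m : ℕ} {src dst : ℕ → Fin n} {st : ℕ → ℕ} {A A' : Abs}
  {P : Sizes} {σ : Fin 2} {S : Finset (Fin n)} {v : Fin n} {l : List (Fin n)} {D : ℕ → Prop}

/-- The set `S` as it is stored in the arrays. -/
structure SetInv (m : ℕ) (src dst : ℕ → Fin n) (S : Finset (Fin n)) (A : Abs) : Prop where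
  r5 : A.r 5 = mask S
  mem : ∀ w : Fin n, A.a 5 w = if w ∈ S then 1 else 0
  out : ∀ w : Fin n, A.a 6 w = outCount m src dst S (fun _ => False) w

lemma SetInv.of_same {R I : List ℕ} (h : SetInv m src dst S A) (hS : Abs.Same R I A A')
    (hR : 5 ∉ R) (hI : 5 ∉ I ∧ 6 ∉ I) : SetInv m src dst S A' where
  r5 := by rw [hS.r 5 hR, h.r5]
  mem w := by rw [hS.a 5 hI.1, h.mem]
  out w := by rw [hS.a 6 hI.2, h.out]

/-- Initialize the counters. -/
def initCounters : Program := forLoop 15 (reg 1) (block [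
  cond (get 5 (reg 15))
    (cond (eq (get 1 (reg 15)) (reg 9))
      (block [put 7 (reg 15) (lit 1)])
      (block [put 7 (reg 15) (get 6 (reg 15))]))
    (block [put 7 (reg 15) (lit 0)])])

lemma initCounters_runs (hP : Fits P n m) (hE : Env G m src dst st A)
    (hS : SetInv m src dst S A) (hσ : A.r 9 = σ) :
    Runs P initCounters A (7 * n + 2) fun A' => Abs.Same [15] [7] A A' ∧
      ∀ w : Fin n, A'.a 7 w = need G.toArena m src dst σ S [] (fun _ => False) w := by
  have hW := hP.W_le
  have hm := hP.m_le
  refine (Runs.forLoop (fun k A' => Abs.Same [15] [7] A A' ∧ ∀ w : Fin n, (w : ℕ) < k →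
    A'.a 7 w = need G.toArena m src dst σ S [] (fun _ => False) w) n 5 (by decide) (by decide)
    (by omega) ?_ ?_ ?_ ?_).mono le_rfl fun A' _ h => ⟨h.1, fun w => h.2 w w.2⟩
  · exact fun k A' v h => ⟨h.1.set (by decide), h.2⟩
  · exact fun k A' h => by simp [h.1.r 1 (by decide), hE.r1]
  · rintro k A' ⟨hA', hk⟩ hsafe h15 hkn
    have hE' := hE.of_same hA' (by decide) (by decide)
    have hS' := hS.of_same hA' (by decide) (by decide)
    have h9 : A'.r 9 = σ := by rw [hA'.r 9 (by decide), hσ]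
    let w : Fin n := ⟨k, hkn⟩
    have h15' : A'.r 15 = (w : ℕ) := h15
    -- All branches store one value in the same cell, so they are handled together once the value is
    -- known to be the counter.
    suffices hput : ∀ e : AExpr, (Expr.addr 7 (reg 15).compile).cost + e.compile.cost < unit →
        e.eval A' = need G.toArena m src dst σ S [] (fun _ => False) w →
        e.eval A' ≤ P.W → Runs P (block [put 7 (reg 15) e]) A' 2 fun A'' =>
          (Abs.Same [15] [7] A A'' ∧ ∀ w : Fin n, (w : ℕ) < k + 1 →
            A''.a 7 w = need G.toArena m src dst σ S [] (fun _ => False) w) ∧ A''.r 15 = k by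
      refine Runs.block_cons (T₁ := 4) (T₂ := 1) ?_ fun A'' h => Runs.block_nil h
      refine Runs.cond (T := 3) (if w ∈ S then 1 else 0) (by decide) (by simp [h15', hS'.mem])
        ?_ ?_
      · intro h0
        have hwS : w ∈ S := by simpa using h0
        refine Runs.cond (T := 2) (if G.owner w = σ then 1 else 0) (by decide)
          (by simp [h15', hE'.own, h9, Fin.val_inj]) ?_ ?_
        · intro h1
          have ho : G.owner w = σ := by simpa using h1
          exact hput _ (by decide) (by simp [need, hwS, ho]) (by simp; omega)
        · intro h1
          have ho : G.owner w ≠ σ := by simpa using h1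
          exact hput _ (by decide) (by simp [need, hwS, ho, h15', hS'.out])
            (hsafe.word_le 6 _ (by decide))
      · intro h0
        have hwS : w ∉ S := by simpa using h0
        exact (hput _ (by decide) (by simp [need, hwS]) (by simp)).mono_time (by omega)
    intro e hc he hle
    refine Runs.block_put w _ hc (by decide) (by simp [h15']) he (by simp only [w]; omega)
      (he ▸ hle) (Runs.block_nil ⟨⟨hA'.put (by decide), fun x hx => ?_⟩, by simp [h15]⟩)
    by_cases hxw : x = w
    · simp [hxw]
    · have hxk : (x : ℕ) ≠ k := fun h => hxw (Fin.ext h)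
      rw [Abs.put_a, if_neg (by simpa [Fin.val_inj] using hxw), hk x (by omega)]
  · exact ⟨Abs.Same.refl _ _ _, fun w hw => absurd hw (Nat.not_lt_zero _)⟩

/-- Compute the complement in `S` of the attractor of the position in `r11`. -/
def attractor : Program := block [
  initCounters,
  put 7 (reg 11) (lit 0),
  set 12 (sub (reg 5) (get 0 (reg 11))),
  put 9 (lit 0) (reg 11),
  set 13 (lit 0),
  set 14 (lit 1),
  loop (lt (reg 13) (reg 14)) queueStep]

/-- The time is linear in $n + m$ because each position leaves the queue at most once and its
incoming edges form one segment of the sorted edges. -/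
lemma attractor_runs (hP : Fits P n m) (hG : IsAdjacency G.toArena m src dst st)
    (hE : Env G m src dst st A) (hS : SetInv m src dst S A) (hsub : IsSubarena G.toArena S)
    (hσ : A.r 9 = σ) (hv : A.r 11 = v) (hvS : v ∈ S) :
    Runs P attractor A (14 * n + 16 * m + 10) fun A' =>
      Abs.Same [12, 13, 14, 15, 16, 17, 18] [7, 9] A A' ∧
      A'.r 12 = mask (S \ attr G.toArena σ S {v}) := by
  have hW := hP.W_le
  have hm := hP.m_le
  have hvn : (v : ℕ) < n := v.2
  refine (Runs.block_cons (T₂ := 7 * n + 16 * m + 8) (initCounters_runs hP hE hS hσ)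
    ?_).mono_time (by omega)
  rintro A₁ ⟨hA₁, hcnt⟩
  have hE₁ := hE.of_same hA₁ (by decide) (by decide)
  have hv₁ : A₁.r 11 = v := by rw [hA₁.r 11 (by decide), hv]
  have h5₁ : A₁.r 5 = mask S := by rw [hA₁.r 5 (by decide), hS.r5]
  refine Runs.block_put v 0 (by decide) (by decide) (by simp [hv₁]) (by simp) (by omega)
    (by omega) ?_
  refine Runs.block_set (mask (S.erase v)) (by decide) (by decide) ?_
    ((mask_lt _).le.trans hP.pow_le) ?_
  · simp [hv₁, h5₁, hE₁.pow, mask_erase hvS]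
  refine Runs.block_put 0 v (by decide) (by decide) (by simp) (by simp [hv₁]) (by omega)
    (by omega) ?_
  refine Runs.block_set 0 (by decide) (by decide) (by simp) (by omega) ?_
  refine Runs.block_set 1 (by decide) (by decide) (by simp) (by omega) ?_
  -- The price of dequeuing `u`: the `queueStep` bound plus one for the loop test. The potential is
  -- the total price of all positions not yet dequeued.
  let f : Fin n → ℕ := fun u => 16 * (st (u + 1) - st u) + 7
  have hf : ∑ u, f u ≤ 16 * m + 7 * n := by
    simp only [f, Finset.sum_add_distrib, ← Finset.mul_sum, Finset.sum_const, Finset.card_univ,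
      Fintype.card_fin, smul_eq_mul]
    have h₁ : ∀ k ≤ n, ∑ i ∈ Finset.range k, (st (i + 1) - st i) ≤ st k := by
      intro k hk
      induction k with
      | zero => simp
      | succ k ih =>
        rw [Finset.sum_range_succ]
        have := ih (by omega)
        have := hG.mono ⟨k, by omega⟩
        simp only at this
        omega
    have h₂ := h₁ n le_rfl
    rw [Fin.sum_univ_eq_sum_range (fun i => st (i + 1) - st i)]
    have h₃ := hG.le
    omega
  refine (Runs.block_cons (T₁ := ∑ u, f u + 1) (T₂ := 1)
    (Runs.loop_potential (by decide) (Inv := fun k A' =>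
      Abs.Same [12, 13, 14, 15, 16, 17, 18] [7, 9] A A' ∧
      ∃ l h, h ≤ l.length ∧ A'.r 13 = h ∧
        AttrInv G m src dst σ S v l (fun e => dst e ∈ l.take h) A' ∧
        k = ∑ u ∈ Finset.univ \ (l.take h).toFinset, f u) ?_ ?_) ?_).mono_time (by omega)
  · rintro k A' ⟨hA', l, h, hl, h13, hI, rfl⟩ - h0
    have hh : h < l.length := by
      by_contra hcon
      simp [h13, hI.tail, hcon] at h0
    refine ⟨16 * (st (l[h] + 1) - st l[h]) + 6, ∑ u ∈ Finset.univ \ (l.take (h + 1)).toFinset, f u,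
      ?_, (queueStep_runs hP hG (hE.of_same hA' (by decide) (by decide)) hh h13 hI).mono
      le_rfl ?_⟩
    · have hunt : l[h] ∉ l.take h := by
        have := (hI.wl.nodup.sublist (List.take_sublist (h + 1) l))
        rw [← List.take_append_getElem hh, List.nodup_append] at this
        exact fun hcon => this.2.2 _ hcon _ (List.mem_singleton_self _) rfl
      have : Finset.univ \ (l.take (h + 1)).toFinset =
          (Finset.univ \ (l.take h).toFinset).erase l[h] := by
        ext w
        rw [← List.take_append_getElem hh]
        simp only [Finset.mem_sdiff, Finset.mem_univ, true_and, List.mem_toFinset,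
          List.mem_append, List.mem_singleton, Finset.mem_erase, ne_eq]
        tauto
      rw [this, ← Finset.sum_erase_add _ f
        (Finset.mem_sdiff.2 ⟨Finset.mem_univ _, fun h' => hunt (List.mem_toFinset.1 h')⟩)]
      simp only [f]
      omega
    · rintro A'' - ⟨hA'', h13', l', hl', hI'⟩
      refine ⟨hA'.trans hA'' (by simp) (by simp), l', h + 1, ?_, h13', hI', ?_⟩
      · exact hh.trans_le hl'.length_le
      · obtain ⟨t, rfl⟩ := hl'
        rw [List.take_append_of_le_length (by omega)]
  · refine ⟨?_, [v], 0, by simp, by simp, ?_, by simp⟩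
    · exact ((((((Abs.Same.refl _ _ A).trans hA₁ (by simp) (by simp)).put (by decide)).set
        (by decide)).put (by decide)).set (by decide)).set (by decide)
    · refine ⟨(Worklist.init hG hsub hvS).congr (by simp), fun w => ?_, ?_, by simp, ?_⟩
      -- The counters were initialized for the empty list; listing `v` changes only its own counter,
      -- to zero.
      · have : need G.toArena m src dst σ S [v] (fun e => dst e ∈ [v].take 0) w =
            if w = v then 0 else need G.toArena m src dst σ S [] (fun _ => False) w := by
          split_ifs with h <;> simp [need, h]
        rw [this]
        simp [Fin.val_inj, hcnt]
      · intro j hj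
        simp at hj
        simp [hj]
      · simp [Finset.sdiff_singleton_eq_erase]
  · rintro A' ⟨⟨_, hA', l, h, hl, h13, hI, -⟩, h0⟩
    have hh : h = l.length := by
      by_contra hcon
      simp [h13, hI.tail] at h0
      omega
    refine Runs.block_nil ⟨hA', ?_⟩
    rw [hI.rest, hI.wl.eq_attr hG fun e _ => by rw [hh, List.take_length]]

end MullerGame

/-! ### Loading a set and testing the complements of its attractors -/

namespace MullerGame

open RAM RAM.AExpr

variable {n : ℕ} {G : MullerGame (Fin n)} {m : ℕ} {src dst : ℕ → Fin n} {st : ℕ → ℕ} {A A' : Abs}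
  {P : Sizes} {σ τ : Fin 2} {S : Finset (Fin n)}

/-- The lower digits sum to less than the next power of two, so comparing with that power reveals
the top digit. -/
lemma mask_filter_lt (S : Finset (Fin n)) (j : ℕ) :
    mask (S.filter fun v : Fin n => (v : ℕ) < j) < 2 ^ j := by
  rw [mask_eq_sum_image]
  refine Nat.geomSum_lt le_rfl fun k hk => ?_
  obtain ⟨v, hv, rfl⟩ := Finset.mem_map.1 hk
  exact (Finset.mem_filter.1 hv).2

lemma mask_filter_succ (S : Finset (Fin n)) (v : Fin n) :
    mask (S.filter fun w : Fin n => (w : ℕ) < v + 1) =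
      mask (S.filter fun w : Fin n => (w : ℕ) < v) + if v ∈ S then 2 ^ (v : ℕ) else 0 := by
  simp only [mask, Finset.sum_filter]
  have : ∀ w : Fin n, (if (w : ℕ) < v + 1 then 2 ^ (w : ℕ) else 0) =
      (if (w : ℕ) < v then 2 ^ (w : ℕ) else 0) + if v = w then 2 ^ (v : ℕ) else 0 := by
    intro w
    by_cases h : v = w
    · simp [h]
    · have h' : (v : ℕ) ≠ w := fun h' => h (Fin.ext h')
      simp only [h, if_false, add_zero]
      split_ifs <;> omega
  simp only [this, Finset.sum_add_distrib, Finset.sum_ite_eq]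

lemma outCount_succ (k : ℕ) (w : Fin n) : outCount (k + 1) src dst S (fun _ => False) w =
    outCount k src dst S (fun _ => False) w + if src k = w ∧ dst k ∈ S then 1 else 0 := by
  classical
  simp only [outCount, not_false_eq_true, and_true]
  rw [Finset.range_add_one, Finset.filter_insert]
  split_ifs with h
  · rw [Finset.card_insert_of_notMem (by simp)]
  · rfl

lemma outCount_le (D : ℕ → Prop) (w : Fin n) : outCount m src dst S D w ≤ m := by
  classical
  unfold outCount
  exact (Finset.card_filter_le _ _).trans (by simp)

/-- Compute the characteristic function of the set that is given by the number in `r5`. -/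
def decode : Program := block [
  set 6 (reg 5),
  set 7 (reg 1),
  loop (lt (lit 0) (reg 7)) (block [
    set 7 (sub (reg 7) (lit 1)),
    cond (lt (reg 6) (get 0 (reg 7)))
      (block [put 5 (reg 7) (lit 0)])
      (block [put 5 (reg 7) (lit 1), set 6 (sub (reg 6) (get 0 (reg 7)))])])]

lemma decode_runs (hP : Fits P n m) (hE : Env G m src dst st A) (h5 : A.r 5 = mask S) :
    Runs P decode A (7 * n + 4) fun A' => Abs.Same [6, 7] [5] A A' ∧
      ∀ w : Fin n, A'.a 5 w = if w ∈ S then 1 else 0 := by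
  have hW := hP.W_le
  have hm := hP.m_le
  have hN := hP.pow_le
  refine (Runs.block_set (T := 7 * n + 3) (mask S) (by decide) (by decide) (by simp [h5])
    ((mask_lt _).le.trans hN) ?_).mono_time (by omega)
  refine Runs.block_set n (by decide) (by decide) (by simp [hE.r1]) (by omega) ?_
  refine (Runs.block_cons (T₁ := (6 + 1) * (n - 0) + 1) (T₂ := 1) (Runs.loop_count (by decide) n 6
    (Inv := fun k A' => Abs.Same [6, 7] [5] A A' ∧ A'.r 7 = n - k ∧
      A'.r 6 = mask (S.filter fun w : Fin n => (w : ℕ) < n - k) ∧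
      ∀ w : Fin n, n - k ≤ w → A'.a 5 w = if w ∈ S then 1 else 0) ?_ ?_ (Nat.zero_le n) ?_)
      ?_).mono_time (by omega)
  · rintro k A' ⟨-, h7, -⟩ hk
    simp [h7]
  · rintro k A' ⟨hA', h7, h6, hw⟩ - hk
    have hE' := hE.of_same hA' (by decide) (by decide)
    let v : Fin n := ⟨n - (k + 1), by omega⟩
    have hv : n - k = (v : ℕ) + 1 := by simp only [v]; omega
    have hv' : n - (k + 1) = (v : ℕ) := rfl
    rw [hv] at h6 h7 hw
    rw [hv']
    rw [mask_filter_succ] at h6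
    have hvn := v.2
    have hlt := mask_filter_lt S v
    have hpow : 2 ^ (v : ℕ) ≤ 2 ^ n := Nat.pow_le_pow_right (by decide) hvn.le
    have hnew : ∀ b, b = (if v ∈ S then 1 else 0) → ∀ w : Fin n, (v : ℕ) ≤ w →
        (if (w : ℕ) = v then b else A'.a 5 w) = if w ∈ S then 1 else 0 := by
      intro b hb w hvw
      split_ifs with h₁ h₂ h₂
      · rw [hb, ← Fin.ext h₁, if_pos h₂]
      · rw [hb, ← Fin.ext h₁, if_neg h₂]
      · rw [hw w (by omega), if_pos h₂]
      · rw [hw w (by omega), if_neg h₂]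
    refine Runs.block_set (T := 5) v (by decide) (by decide) (by simp [h7]) (by omega) ?_
    refine Runs.block_cons (T₁ := 4) (T₂ := 1) ?_ fun A'' h => Runs.block_nil h
    refine Runs.cond (T := 3) (if v ∈ S then 0 else 1) (by decide) ?_ ?_ ?_
    -- The remaining number is below $2^v$ exactly if digit $v$ is zero.
    · obtain ⟨M, hM⟩ : ∃ M, M = mask (S.filter fun w : Fin n => (w : ℕ) < v) := ⟨_, rfl⟩
      rw [← hM] at h6 hlt
      simp [h6, hE'.pow]
      split_ifs <;> omega
    · intro h0
      have hvS : v ∉ S := by simpa using h0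
      refine Runs.block_put v 0 (by decide) (by decide) (by simp) (by simp) (by omega)
        (by omega) (Runs.block_nil ⟨(hA'.set (by decide)).put (by decide), by simp, ?_, ?_⟩)
      · simp [h6, hvS]
      · intro w hvw
        simpa using hnew 0 (by simp [hvS]) w hvw
    · intro h0
      have hvS : v ∈ S := by simpa using h0
      refine Runs.block_put v 1 (by decide) (by decide) (by simp) (by simp) (by omega)
        (by omega) ?_
      refine Runs.block_set (mask (S.filter fun w : Fin n => (w : ℕ) < v)) (by decide) (by decide)
        (by simp [h6, hE'.pow, hvS]) (by omega) (Runs.block_nil ⟨?_, by simp, by simp, ?_⟩)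
      · exact ((hA'.set (by decide)).put (by decide)).set (by decide)
      · intro w hvw
        simpa using hnew 1 (by simp [hvS]) w hvw
  · refine ⟨((Abs.Same.refl _ _ A).set (by decide)).set (by decide), by simp, ?_, ?_⟩
    · simp
    · intro w hw
      have := w.2
      omega
  · rintro A' ⟨hA', -, -, hw⟩
    exact Runs.block_nil ⟨hA', fun w => hw w (by omega)⟩

/-- Count the edges from each position into the set in the array `5`. -/
def countEdges : Program := block [
  forLoop 7 (reg 1) (block [put 6 (reg 7) (lit 0)]),
  forLoop 16 (reg 2) (block [
    put 6 (get 3 (reg 16)) (add (get 6 (get 3 (reg 16))) (get 5 (get 4 (reg 16))))])]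

lemma countEdges_runs (hP : Fits P n m) (hE : Env G m src dst st A)
    (h5 : ∀ w : Fin n, A.a 5 w = if w ∈ S then 1 else 0) :
    Runs P countEdges A (4 * n + 4 * m + 6) fun A' => Abs.Same [7, 16] [6] A A' ∧
      ∀ w : Fin n, A'.a 6 w = outCount m src dst S (fun _ => False) w := by
  have hW := hP.W_le
  have hm := hP.m_le
  refine (Runs.block_cons (T₁ := (2 + 2) * n + 2) (T₂ := (2 + 2) * m + 3)
    (Runs.forLoop (fun k A' => Abs.Same [7, 16] [6] A A' ∧ ∀ w : Fin n, (w : ℕ) < k →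
      A'.a 6 w = 0) n 2 (by decide) (by decide) (by omega) ?_ ?_ ?_
      ⟨Abs.Same.refl _ _ _, fun w hw => absurd hw (Nat.not_lt_zero _)⟩) ?_).mono_time (by omega)
  · exact fun k A' v h => ⟨h.1.set (by decide), h.2⟩
  · exact fun k A' h => by simp [h.1.r 1 (by decide), hE.r1]
  · rintro k A' ⟨hA', hk⟩ - h7 hkn
    refine Runs.block_put k 0 (by decide) (by decide) (by simp [h7]) (by simp) (by omega)
      (by omega) (Runs.block_nil ⟨⟨hA'.put (by decide), fun w hw => ?_⟩, by simp [h7]⟩)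
    by_cases hwk : (w : ℕ) = k
    · simp [hwk]
    · simpa [hwk] using hk w (by omega)
  · rintro A₁ ⟨hA₁, h0⟩
    refine (Runs.block_cons (T₁ := (2 + 2) * m + 2) (T₂ := 1)
      (Runs.forLoop (fun k A' => Abs.Same [7, 16] [6] A A' ∧ ∀ w : Fin n,
        A'.a 6 w = outCount k src dst S (fun _ => False) w) m 2 (by decide) (by decide)
        (by omega) ?_ ?_ ?_ ⟨hA₁, fun w => ?_⟩) fun A'' h => Runs.block_nil h).mono_time
        (by omega)
    · exact fun k A' v h => ⟨h.1.set (by decide), h.2⟩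
    · exact fun k A' h => by simp [h.1.r 2 (by decide), hE.r2]
    · rintro k A' ⟨hA', hk⟩ - h16 hkm
      have hE' := hE.of_same hA' (by decide) (by decide)
      have hs := (src k).2
      have h5' : A'.a 5 = A.a 5 := hA'.a 5 (by decide)
      have hle : outCount (k + 1) src dst S (fun _ => False) (src k) ≤ k + 1 :=
        outCount_le _ _
      refine Runs.block_put (src k) (outCount (k + 1) src dst S (fun _ => False) (src k))
        (by decide) (by decide) (by simp [h16, hE'.src k hkm])
        (by simp [h16, hE'.src k hkm, hE'.dst k hkm, hk, h5', h5, outCount_succ])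
        (by omega) (by omega)
        (Runs.block_nil ⟨⟨hA'.put (by decide), fun w => ?_⟩, by simp [h16]⟩)
      by_cases hw : w = src k
      · simp [hw]
      · simp [Fin.val_inj, hw, hk, outCount_succ, Ne.symm hw]
    · simp [h0 w w.2, outCount]

/-- Load the set that is given by the number in `r5`; `r8` tells whether it is a subarena. -/
def loadSet : Program := block [
  decode,
  countEdges,
  set 8 (lit 1),
  forLoop 7 (reg 1) (block [
    cond (get 5 (reg 7)) (cond (get 6 (reg 7)) .skip (block [set 8 (lit 0)])) .skip])]

/-- The counts of edges into $S$ are stored once per set: they decide whether $S$ is a subarena and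
initialize the counters of all attractor computations on $S$. -/
lemma loadSet_runs (hP : Fits P n m) (hG : IsAdjacency G.toArena m src dst st)
    (hE : Env G m src dst st A) (h5 : A.r 5 = mask S) :
    Runs P loadSet A (18 * n + 4 * m + 14) fun A' => Abs.Same [6, 7, 8, 16] [5, 6] A A' ∧
      SetInv m src dst S A' ∧ (A'.r 8 ≠ 0 ↔ IsSubarena G.toArena S) := by
  have hW := hP.W_le
  refine (Runs.block_cons (T₂ := 11 * n + 4 * m + 10) (decode_runs hP hE h5) ?_).mono_time
    (by omega)
  rintro A₁ ⟨hA₁, hS₁⟩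
  have hE₁ := hE.of_same hA₁ (by decide) (by decide)
  refine (Runs.block_cons (T₂ := 7 * n + 3 + 1) (countEdges_runs hP hE₁ hS₁) ?_).mono_time
    (by omega)
  rintro A₂ ⟨hA₂, hc₂⟩
  have hE₂ := hE₁.of_same hA₂ (by decide) (by decide)
  have hS₂ : ∀ w : Fin n, A₂.a 5 w = if w ∈ S then 1 else 0 := fun w => by
    rw [hA₂.a 5 (by decide), hS₁]
  have hA : Abs.Same [6, 7, 8, 16] [5, 6] A A₂ :=
    ((Abs.Same.refl _ _ A).trans hA₁ (by simp) (by simp)).trans hA₂ (by simp) (by simp)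
  refine Runs.block_set 1 (by decide) (by decide) (by simp) (by omega) ?_
  refine Runs.block_cons (T₁ := (5 + 2) * n + 2) (T₂ := 1) (Runs.forLoop
    (fun k A' => Abs.Same [7, 8] [] A₂ A' ∧ (A'.r 8 ≠ 0 ↔ ∀ w : Fin n, (w : ℕ) < k → w ∈ S →
      outCount m src dst S (fun _ => False) w ≠ 0)) n 5 (by decide) (by decide) (by omega)
      ?_ ?_ ?_ ?_) ?_
  · exact fun k A' v h => ⟨h.1.set (by decide), by simpa using h.2⟩
  · exact fun k A' h => by simp [h.1.r 1 (by decide), hE₂.r1]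
  · rintro k A' ⟨hA', hk⟩ - h7 hkn
    let w : Fin n := ⟨k, hkn⟩
    have h7' : A'.r 7 = (w : ℕ) := h7
    have h5' : A'.a 5 = A₂.a 5 := hA'.a 5 (by decide)
    have h6' : A'.a 6 = A₂.a 6 := hA'.a 6 (by decide)
    have hsucc : (∀ x : Fin n, (x : ℕ) < k + 1 → x ∈ S →
          outCount m src dst S (fun _ => False) x ≠ 0) ↔
        (∀ x : Fin n, (x : ℕ) < k → x ∈ S → outCount m src dst S (fun _ => False) x ≠ 0) ∧
          (w ∈ S → outCount m src dst S (fun _ => False) w ≠ 0) := by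
      constructor
      · exact fun h => ⟨fun x hx => h x (by omega), h w (Nat.lt_succ_self k)⟩
      · rintro ⟨h, hw⟩ x hx
        by_cases hxw : x = w
        · rwa [hxw]
        · exact h x (by have : (x : ℕ) ≠ k := fun h => hxw (Fin.ext h)
                        omega)
    refine Runs.block_cons (T₁ := 4) (T₂ := 1) ?_ fun A'' h => Runs.block_nil h
    refine Runs.cond (T := 3) (if w ∈ S then 1 else 0) (by decide) (by simp [h7', h5', hS₂]) ?_ ?_
    · intro h0
      have hw : w ∈ S := by simpa using h0
      refine Runs.cond (T := 2) (outCount m src dst S (fun _ => False) w) (by decide)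
        (by simp [h7', h6', hc₂]) ?_ ?_
      · intro h1
        refine (Runs.skip ⟨⟨hA', ?_⟩, h7⟩).mono_time (by omega)
        rw [hk, hsucc]
        simp [h1]
      · intro h1
        refine Runs.block_set 0 (by decide) (by decide) (by simp) (by omega)
          (Runs.block_nil ⟨⟨hA'.set (by decide), ?_⟩, by simp [h7]⟩)
        rw [hsucc]
        simp [h1, hw]
    · intro h0
      have hw : w ∉ S := by simpa using h0
      refine (Runs.skip ⟨⟨hA', ?_⟩, h7⟩).mono_time (by omega)
      rw [hk, hsucc]
      simp [hw]
  · exact ⟨(Abs.Same.refl _ _ _).set (by decide), by simp⟩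
  · rintro A' ⟨hA', h8⟩
    refine Runs.block_nil ⟨hA.trans hA' (by simp) (by simp), ⟨?_, fun w => ?_, fun w => ?_⟩, ?_⟩
    · rw [hA'.r 5 (by decide), hA.r 5 (by decide), h5]
    · rw [hA'.a 5 (by decide), hS₂]
    · rw [hA'.a 6 (by decide), hc₂]
    · rw [h8, isSubarena_iff_outCount hG]
      exact ⟨fun h w => h w w.2, fun h w _ => h w⟩

open Classical in
/-- The tables of the sets on which the players win are correct for the sets with numbers less than
`k`, and empty otherwise. -/
def TableInv (G : MullerGame (Fin n)) (k : ℕ) (A : Abs) : Prop :=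
  ∀ (σ : Fin 2) (S : Finset (Fin n)),
    A.a (14 + σ) (mask S) = if mask S < k ∧ Good G σ S then 1 else 0

lemma TableInv.of_same {R I : List ℕ} {k : ℕ} (h : TableInv G k A) (hS : Abs.Same R I A A')
    (hI : 14 ∉ I ∧ 15 ∉ I) : TableInv G k A' := by
  intro σ S
  have := h σ S
  fin_cases σ
  · rw [← this]
    exact congrFun (hS.a 14 hI.1) _
  · rw [← this]
    exact congrFun (hS.a 15 hI.2) _

lemma TableInv.eq_zero_iff {k : ℕ} (h : TableInv G k A) (hS : mask S < k) :
    A.a (14 + σ) (mask S) = 0 ↔ ¬ Good G σ S := by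
  rw [h σ S]
  by_cases hg : Good G σ S
  · rw [if_pos ⟨hS, hg⟩]
    simp [hg]
  · rw [if_neg fun h => hg h.2]
    simp [hg]

/-- Test whether the player in `r9` wins on all complements of attractors of positions. -/
def testAll : Program := block [
  set 10 (lit 1),
  forLoop 11 (reg 1) (block [
    cond (get 5 (reg 11))
      (block [
        attractor,
        cond (reg 9) (block [set 19 (get 15 (reg 12))]) (block [set 19 (get 14 (reg 12))]),
        cond (reg 19) .skip (block [set 10 (lit 0)])])
      .skip])]

lemma testAll_runs (hP : Fits P n m) (hG : IsAdjacency G.toArena m src dst st)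
    (hE : Env G m src dst st A) (hS : SetInv m src dst S A) (hsub : IsSubarena G.toArena S)
    (hσ : A.r 9 = σ) (hT : TableInv G (mask S) A) :
    Runs P testAll A ((14 * n + 16 * m + 21) * n + 4) fun A' =>
      Abs.Same [10, 11, 12, 13, 14, 15, 16, 17, 18, 19] [7, 9] A A' ∧
      (A'.r 10 ≠ 0 ↔ ∀ v ∈ S, Good G σ (S \ attr G.toArena σ S {v})) := by
  have hW := hP.W_le
  refine Runs.block_set 1 (by decide) (by decide) (by simp) (by omega) ?_
  refine Runs.block_cons (T₁ := ((14 * n + 16 * m + 19) + 2) * n + 2) (T₂ := 1) (Runs.forLoop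
    (fun k A' => Abs.Same [10, 11, 12, 13, 14, 15, 16, 17, 18, 19] [7, 9] A A' ∧
      (A'.r 10 ≠ 0 ↔ ∀ w : Fin n, (w : ℕ) < k → w ∈ S →
        Good G σ (S \ attr G.toArena σ S {w}))) n (14 * n + 16 * m + 19) (by decide) (by decide)
      (by omega) ?_ ?_ ?_ ?_) ?_
  · exact fun k A' v h => ⟨h.1.set (by decide), by simpa using h.2⟩
  · exact fun k A' h => by simp [h.1.r 1 (by decide), hE.r1]
  · rintro k A' ⟨hA', hk⟩ - h11 hkn
    let w : Fin n := ⟨k, hkn⟩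
    have h11' : A'.r 11 = (w : ℕ) := h11
    have hE' := hE.of_same hA' (by decide) (by decide)
    have hS' := hS.of_same hA' (by decide) (by decide)
    have h9' : A'.r 9 = σ := by rw [hA'.r 9 (by decide), hσ]
    have hT' := hT.of_same hA' (by decide)
    have hsucc : (∀ x : Fin n, (x : ℕ) < k + 1 → x ∈ S → Good G σ (S \ attr G.toArena σ S {x})) ↔
        (∀ x : Fin n, (x : ℕ) < k → x ∈ S → Good G σ (S \ attr G.toArena σ S {x})) ∧
          (w ∈ S → Good G σ (S \ attr G.toArena σ S {w})) := by
      constructor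
      · exact fun h => ⟨fun x hx => h x (by omega), h w (Nat.lt_succ_self k)⟩
      · rintro ⟨h, hw⟩ x hx
        by_cases hxw : x = w
        · rwa [hxw]
        · exact h x (by have : (x : ℕ) ≠ k := fun h => hxw (Fin.ext h)
                        omega)
    refine Runs.block_cons (T₁ := 14 * n + 16 * m + 18) (T₂ := 1) ?_
      fun A'' h => Runs.block_nil h
    refine Runs.cond (T := 14 * n + 16 * m + 17) (if w ∈ S then 1 else 0) (by decide)
      (by simp [h11', hS'.mem]) ?_ ?_
    · intro h0
      have hw : w ∈ S := by simpa using h0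
      refine (Runs.block_cons (T₂ := 7) (attractor_runs hP hG hE' hS' hsub h9' h11' hw)
        ?_).mono_time (by omega)
      rintro A₁ ⟨hA₁, h12⟩
      have h9₁ : A₁.r 9 = σ := by rw [hA₁.r 9 (by decide), h9']
      have h11₁ : A₁.r 11 = k := by rw [hA₁.r 11 (by decide), h11]
      have hT₁ := hT'.of_same hA₁ (by decide)
      -- The complement misses `w`, so its number is smaller and its table entry is already correct.
      have hlt : mask (S \ attr G.toArena σ S {w}) < mask S :=
        mask_lt_of_ssubset (Finset.sdiff_ssubset attr_subset
          ⟨w, subset_attr (Finset.singleton_subset_iff.2 hw) (Finset.mem_singleton_self w)⟩)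
      have htab := hT₁.eq_zero_iff (σ := σ) hlt
      refine Runs.block_cons (T₁ := 3) (T₂ := 4) (Q₁ := fun A'' =>
        A'' = A₁.set 19 (A₁.a (14 + σ) (mask (S \ attr G.toArena σ S {w})))) ?_ ?_
      · have hle : A₁.a (14 + σ) (mask (S \ attr G.toArena σ S {w})) ≤ P.W := by
          rw [hT₁ σ]
          split_ifs <;> omega
        refine Runs.cond (T := 2) (σ : ℕ) (by decide) (by simp [h9₁]) ?_ ?_
        · intro h1
          have hσ1 : σ = 1 := by omega
          subst hσ1
          exact Runs.block_set _ (by decide) (by decide) (by simp [h12]) hle (Runs.block_nil rfl)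
        · intro h1
          have hσ1 : σ = 0 := by omega
          subst hσ1
          exact Runs.block_set _ (by decide) (by decide) (by simp [h12]) hle (Runs.block_nil rfl)
      · rintro A₂ rfl
        have hA₂ : Abs.Same [10, 11, 12, 13, 14, 15, 16, 17, 18, 19] [7, 9] A
            (A₁.set 19 (A₁.a (14 + σ) (mask (S \ attr G.toArena σ S {w})))) :=
          (hA'.trans hA₁ (by simp) (by simp)).set (by decide)
        have h10 : A₁.r 10 = A'.r 10 := hA₁.r 10 (by decide)
        refine Runs.block_cons (T₁ := 3) (T₂ := 1) ?_ fun A'' h => Runs.block_nil h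
        refine Runs.cond (T := 2) _ (by decide) rfl ?_ ?_
        · intro h1
          refine (Runs.skip ⟨⟨hA₂, ?_⟩, by simp [h11₁]⟩).mono_time (by omega)
          have hgood : Good G σ (S \ attr G.toArena σ S {w}) := by
            simpa [htab] using h1
          rw [hsucc, ← hk]
          simp [h10, hgood]
        · intro h1
          have hgood : ¬ Good G σ (S \ attr G.toArena σ S {w}) := by
            simpa [htab] using h1
          refine Runs.block_set 0 (by decide) (by decide) (by simp) (by omega)
            (Runs.block_nil ⟨⟨hA₂.set (by decide), ?_⟩, by simp [h11₁]⟩)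
          rw [hsucc]
          simp [hgood, hw]
    · intro h0
      have hw : w ∉ S := by simpa using h0
      refine (Runs.skip ⟨⟨hA', ?_⟩, h11⟩).mono_time (by omega)
      rw [hk, hsucc]
      simp [hw]
  · exact ⟨(Abs.Same.refl _ _ _).set (by decide), by simp⟩
  · rintro A' ⟨hA', h10⟩
    exact Runs.block_nil ⟨hA', h10.trans ⟨fun h w => h w w.2, fun h w _ => h w⟩⟩

end MullerGame

/-! ### The dynamic program over all sets -/

namespace MullerGame

open RAM RAM.AExpr

variable {n : ℕ} [Nonempty (Fin n)] {G : MullerGame (Fin n)} {m : ℕ} {src dst : ℕ → Fin n}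
  {st : ℕ → ℕ} {A A' : Abs} {P : Sizes} {σ τ : Fin 2} {S : Finset (Fin n)}

omit [Nonempty (Fin n)] in
/-- The next table, when no player wins on `S`. -/
lemma TableInv.succ_of_not (h : TableInv G (mask S) A) (hn : ∀ σ, ¬ Good G σ S) :
    TableInv G (mask S + 1) A := by
  classical
  intro σ T
  rw [h σ T]
  refine if_congr ⟨fun h => ⟨by omega, h.2⟩, fun ⟨h₁, h₂⟩ => ⟨?_, h₂⟩⟩ rfl rfl
  refine lt_of_le_of_ne (by omega) fun h' => hn σ ?_
  rwa [← mask_injective h']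

omit [Nonempty (Fin n)] in
/-- The next table, when Player `σ` wins on `S`. -/
lemma TableInv.succ_of_good (h : TableInv G (mask S) A) (hστ : σ ≠ τ) (hσ : Good G σ S)
    (hτ : ¬ Good G τ S) : TableInv G (mask S + 1) (A.put (14 + σ) (mask S) 1) := by
  classical
  intro ρ T
  rw [Abs.put_a]
  by_cases hT : T = S
  · subst hT
    by_cases hρ : ρ = σ
    · subst hρ
      simp [hσ]
    · have : ρ = τ := by omega
      subst this
      rw [if_neg (by omega), h ρ T, if_neg (by omega), if_neg fun h => hτ h.2]
  · have hm : mask T ≠ mask S := fun h' => hT (mask_injective h')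
    rw [if_neg fun h => hm h.2, h ρ T]
    exact if_congr (and_congr_left fun _ => by omega) rfl rfl

/-- Record that the player in `r9` wins on the set with the number in `r5`. -/
def record : Program :=
  cond (reg 9) (block [put 15 (reg 5) (lit 1)]) (block [put 14 (reg 5) (lit 1)])

omit [Nonempty (Fin n)] in
lemma record_runs (hP : Fits P n m) (h5 : A.r 5 = mask S) (hσ : A.r 9 = σ) :
    Runs P record A 3 fun A' => A' = A.put (14 + σ) (mask S) 1 := by
  have hlt : mask S < 2 ^ P.n := by
    rw [hP.n_eq]
    exact mask_lt S
  refine Runs.cond (T := 2) (σ : ℕ) (by decide) (by simp [hσ]) ?_ ?_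
  · intro h1
    have hσ1 : σ = 1 := by omega
    subst hσ1
    exact Runs.block_putBit _ 1 (by decide) (by decide) (by simp [h5]) (by simp) hlt le_rfl
      (Runs.block_nil rfl)
  · intro h1
    have hσ1 : σ = 0 := by omega
    subst hσ1
    exact Runs.block_putBit _ 1 (by decide) (by decide) (by simp [h5]) (by simp) hlt le_rfl
      (Runs.block_nil rfl)

/-- Enter the set with the number in `r5` into the tables. -/
def enterSet : Program := block [
  loadSet,
  cond (reg 8)
    (block [
      set 9 (sub (lit 1) (get 13 (reg 5))),
      testAll,
      cond (reg 10)
        record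
        (block [
          set 9 (sub (lit 1) (reg 9)),
          testAll,
          cond (reg 10) record .skip])])
    .skip]

omit [Nonempty (Fin n)] in
-- The subtraction from one in the program turns the bit for $\mathcal{F}_0$ into the player whose
-- winning condition contains $S$, and then a player into the opponent.
lemma exists_player (G : MullerGame (Fin n)) (S : Finset (Fin n)) :
    ∃ σ τ : Fin 2, σ ≠ τ ∧ S ∈ G.F σ ∧ S ∉ G.F τ ∧
      (1 - if S ∈ G.F 0 then 1 else 0) = (σ : ℕ) ∧ 1 - (σ : ℕ) = τ := by
  have h := G.cover S
  have h' := G.disjoint S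
  by_cases h0 : S ∈ G.F 0
  · exact ⟨0, 1, by decide, h0, fun h1 => h' ⟨h0, h1⟩, by simp [h0], by simp⟩
  · exact ⟨1, 0, by decide, h.resolve_left h0, h0, by simp [h0], by simp⟩

/-- The player σ with $S \in \mathcal{F}_\sigma$ is tested first. If she fails, the side condition
of `good_iff` for the other player holds automatically, so the same test decides for both. -/
lemma enterSet_runs (hP : Fits P n m) (hG : IsAdjacency G.toArena m src dst st)
    (hE : Env G m src dst st A) (h5 : A.r 5 = mask S) (hS : S.Nonempty)
    (hT : TableInv G (mask S) A) :
    Runs P enterSet A (2 * ((14 * n + 16 * m + 21) * n) + 18 * n + 4 * m + 40) fun A' =>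
      Abs.Same [6, 7, 8, 9, 10, 11, 12, 13, 14, 15, 16, 17, 18, 19] [5, 6, 7, 9, 14, 15] A A' ∧
      TableInv G (mask S + 1) A' := by
  have hW := hP.W_le
  refine (Runs.block_cons (T₂ := 2 * ((14 * n + 16 * m + 21) * n) + 24)
    (loadSet_runs hP hG hE h5) ?_).mono_time (by omega)
  rintro A₁ ⟨hA₁, hS₁, h8₁⟩
  have hE₁ := hE.of_same hA₁ (by decide) (by decide)
  have hT₁ := hT.of_same hA₁ (by decide)
  have hA₁' : Abs.Same [6, 7, 8, 9, 10, 11, 12, 13, 14, 15, 16, 17, 18, 19] [5, 6, 7, 9, 14, 15]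
    A A₁ := (Abs.Same.refl _ _ A).trans hA₁ (by simp) (by simp)
  refine (Runs.block_cons (T₁ := 2 * ((14 * n + 16 * m + 21) * n) + 23) (T₂ := 1) ?_
    fun A'' h => Runs.block_nil h)
  refine Runs.cond (T := 2 * ((14 * n + 16 * m + 21) * n) + 22) _ (by decide) rfl ?_ ?_
  · intro h0
    have hsub := h8₁.1 h0
    obtain ⟨σ, τ, hστ, hF, hF', hσ, hτ⟩ := exists_player G S
    have hσlt : (σ : ℕ) < 2 := σ.2
    refine Runs.block_set (T := 2 * ((14 * n + 16 * m + 21) * n) + 21) σ (by decide) (by decide)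
      ?_ (by omega) ?_
    · simp [← hσ, hS₁.r5, hE₁.win]
    have hA₂ : Abs.Same [9] [] A₁ (A₁.set 9 σ) := (Abs.Same.refl _ _ _).set (by decide)
    refine (Runs.block_cons (T₂ := (14 * n + 16 * m + 21) * n + 17)
      (testAll_runs (σ := σ) hP hG (hE₁.of_same hA₂ (by decide) (by decide))
        (hS₁.of_same hA₂ (by decide) (by decide)) hsub (by simp)
        (hT₁.of_same hA₂ (by decide))) ?_).mono_time (by omega)
    rintro A₃ ⟨hA₃, h10₃⟩
    have hA₃' : Abs.Same [9, 10, 11, 12, 13, 14, 15, 16, 17, 18, 19] [7, 9] A₁ A₃ :=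
      ((Abs.Same.refl _ _ A₁).trans hA₂ (by simp) (by simp)).trans hA₃ (by simp) (by simp)
    have hA₃'' := hA₁'.trans hA₃' (by simp) (by simp)
    have hE₃ := hE₁.of_same hA₃' (by decide) (by decide)
    have hS₃ := hS₁.of_same hA₃' (by decide) (by decide)
    have hT₃ := hT₁.of_same hA₃' (by decide)
    have h9₃ : A₃.r 9 = σ := by rw [hA₃.r 9 (by decide)]; simp
    have hgσ : A₃.r 10 ≠ 0 ↔ Good G σ S := by
      rw [h10₃, good_iff hστ hsub hS]
      simp [hF]
    refine (Runs.block_cons (T₁ := (14 * n + 16 * m + 21) * n + 16) (T₂ := 1) ?_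
      fun A'' h => Runs.block_nil h)
    refine Runs.cond (T := (14 * n + 16 * m + 21) * n + 15) _ (by decide) rfl ?_ ?_
    · intro h1
      refine (record_runs hP hS₃.r5 h9₃).mono (by omega) ?_
      rintro _ - rfl
      have hg := hgσ.1 h1
      refine ⟨hA₃''.put ?_, hT₃.succ_of_good hστ hg fun hg' => ?_⟩
      · fin_cases σ <;> simp
      -- A nonempty set is not good for both players, so the opponent's entry correctly remains
      -- zero.
      · exact hS.ne_empty (hg.eq_empty_of_isTrap hστ
          ⟨subset_rfl, fun _ _ _ w hw _ => hw⟩ hg')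
    · intro h1
      have hng : ¬ Good G σ S := fun h => hgσ.2 h h1
      refine Runs.block_set (T := (14 * n + 16 * m + 21) * n + 14) τ (by decide) (by decide)
        (by simp [h9₃, hτ]) (by omega) ?_
      have hA₄ : Abs.Same [9] [] A₃ (A₃.set 9 τ) := (Abs.Same.refl _ _ _).set (by decide)
      refine (Runs.block_cons (T₂ := 8)
        (testAll_runs (σ := τ) hP hG (hE₃.of_same hA₄ (by decide) (by decide))
          (hS₃.of_same hA₄ (by decide) (by decide)) hsub (by simp)
          (hT₃.of_same hA₄ (by decide))) ?_).mono_time (by omega)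
      rintro A₅ ⟨hA₅, h10₅⟩
      have hA₅' : Abs.Same [9, 10, 11, 12, 13, 14, 15, 16, 17, 18, 19] [7, 9] A₃ A₅ :=
        ((Abs.Same.refl _ _ A₃).trans hA₄ (by simp) (by simp)).trans hA₅ (by simp) (by simp)
      have hA₅'' := hA₃''.trans hA₅' (by simp) (by simp)
      have hT₅ := hT₃.of_same hA₅' (by decide)
      have h9₅ : A₅.r 9 = τ := by rw [hA₅.r 9 (by decide)]; simp
      have h5₅ : A₅.r 5 = mask S := by rw [hA₅'.r 5 (by decide), hS₃.r5]
      have hgτ : A₅.r 10 ≠ 0 ↔ Good G τ S := by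
        rw [h10₅, good_iff hστ.symm hsub hS]
        simp [hng]
      refine (Runs.block_cons (T₁ := 7) (T₂ := 1) ?_ fun A'' h => Runs.block_nil h)
      refine Runs.cond (T := 6) _ (by decide) rfl ?_ ?_
      · intro h2
        refine (record_runs hP h5₅ h9₅).mono (by omega) ?_
        rintro _ - rfl
        refine ⟨hA₅''.put ?_, hT₅.succ_of_good hστ.symm (hgτ.1 h2) hng⟩
        fin_cases τ <;> simp
      · intro h2
        refine (Runs.skip ⟨hA₅'', hT₅.succ_of_not fun ρ => ?_⟩).mono_time (by omega)
        by_cases hρ : ρ = σ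
        · rwa [hρ]
        · rw [show ρ = τ by omega]
          exact fun h => hgτ.2 h h2
  · intro h0
    refine (Runs.skip ⟨hA₁', hT₁.succ_of_not fun ρ hg => ?_⟩).mono_time (by omega)
    -- Sets that are not subarenas are good for nobody, so their entries stay zero.
    exact h8₁.2 hg.isSubarena h0

/-- Fill the tables. -/
def fillTables : Program := forLoop 5 (reg 4) (block [
  cond (reg 5) enterSet (block [put 14 (lit 0) (lit 1), put 15 (lit 0) (lit 1)])])

lemma fillTables_runs (hP : Fits P n m) (hG : IsAdjacency G.toArena m src dst st)
    (hE : Env G m src dst st A) (hT : TableInv G 0 A) :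
    Runs P fillTables A
      ((2 * ((14 * n + 16 * m + 21) * n) + 18 * n + 4 * m + 44) * 2 ^ n + 2) fun A' =>
      Abs.Same [5, 6, 7, 8, 9, 10, 11, 12, 13, 14, 15, 16, 17, 18, 19] [5, 6, 7, 9, 14, 15] A A' ∧
      TableInv G (2 ^ n) A' := by
  refine Runs.forLoop (fun k A' => Abs.Same [5, 6, 7, 8, 9, 10, 11, 12, 13, 14, 15, 16, 17, 18, 19]
      [5, 6, 7, 9, 14, 15] A A' ∧ TableInv G k A') (2 ^ n)
    (2 * ((14 * n + 16 * m + 21) * n) + 18 * n + 4 * m + 42) (by decide) (by decide)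
    hP.pow_le ?_ ?_ ?_ ⟨Abs.Same.refl _ _ _, hT⟩
  · exact fun k A' v h => ⟨h.1.set (by decide), h.2⟩
  · exact fun k A' h => by simp [h.1.r 4 (by decide), hE.r4]
  · rintro k A' ⟨hA', hT'⟩ - h5 hk
    have hE' := hE.of_same hA' (by decide) (by decide)
    obtain ⟨S, rfl⟩ := exists_mask_eq hk
    refine Runs.block_cons (T₁ := 2 * ((14 * n + 16 * m + 21) * n) + 18 * n + 4 * m + 41)
      (T₂ := 1) ?_ fun A'' h => Runs.block_nil h
    refine Runs.cond (T := 2 * ((14 * n + 16 * m + 21) * n) + 18 * n + 4 * m + 40) _ (by decide)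
      h5 ?_ ?_
    · intro h0
      refine (enterSet_runs hP hG hE' h5 ?_ hT').mono le_rfl ?_
      · rw [Finset.nonempty_iff_ne_empty]
        rintro rfl
        exact h0 rfl
      · rintro A'' - ⟨hA'', hT''⟩
        exact ⟨⟨hA'.trans hA'' (by simp) (by simp), hT''⟩, by rw [hA''.r 5 (by decide), h5]⟩
    · intro h0
      -- The empty set is good for both players; it is the base of the recursion and is excluded
      -- from `good_iff`.
      have hS : S = ∅ := mask_injective (by rw [h0, mask_empty])
      subst hS
      have hpos : 0 < 2 ^ P.n := Nat.two_pow_pos _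
      refine (Runs.block_putBit (T := 2) 0 1 (by decide) (by decide) (by simp) (by simp) hpos le_rfl
        (Runs.block_putBit 0 1 (by decide) (by decide) (by simp) (by simp) hpos le_rfl
        (Runs.block_nil ⟨⟨(hA'.put (by decide)).put (by decide), ?_⟩, by simp [h5]⟩))).mono_time
        (by omega)
      intro σ T
      have h₁ := hT' σ T
      rw [mask_empty] at h₁ ⊢
      by_cases hT : T = ∅
      · subst hT
        rw [mask_empty, if_pos ⟨by omega, .empty⟩]
        fin_cases σ <;> simp
      · have hm : mask T ≠ 0 := fun h => hT (mask_injective (h.trans mask_empty.symm))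
        rw [if_neg (by omega)] at h₁ ⊢
        rw [Abs.put_a, if_neg fun h => hm h.2, Abs.put_a, if_neg fun h => hm h.2, h₁]

open Classical in
/-- The positions in the array `10` are those that are known to be won by Player 0, after the sets
with numbers less than `k` have been taken into account. -/
def WinInv (G : MullerGame (Fin n)) (k : ℕ) (A : Abs) : Prop :=
  ∀ w : Fin n, A.a 10 w = if ∃ T, mask T < k ∧ w ∈ T ∧ Good G 0 T ∧
    IsTrap G.toArena 0 T Finset.univ then 1 else 0

/-- Test whether the opponent of Player 0 cannot leave the set in the array `5`. -/
def testTrap : Program := block [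
  set 8 (lit 1),
  forLoop 16 (reg 2) (block [
    cond (get 5 (get 3 (reg 16)))
      (cond (get 1 (get 3 (reg 16)))
        (cond (get 5 (get 4 (reg 16))) .skip (block [set 8 (lit 0)])) .skip) .skip])]

omit [Nonempty (Fin n)] in
lemma testTrap_runs (hP : Fits P n m) (hG : IsAdjacency G.toArena m src dst st)
    (hE : Env G m src dst st A) (h5 : ∀ w : Fin n, A.a 5 w = if w ∈ S then 1 else 0) :
    Runs P testTrap A (8 * m + 4) fun A' => Abs.Same [8, 16] [] A A' ∧
      (A'.r 8 ≠ 0 ↔ IsTrap G.toArena 0 S Finset.univ) := by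
  have hW := hP.W_le
  refine Runs.block_set 1 (by decide) (by decide) (by simp) (by omega) ?_
  refine Runs.block_cons (T₁ := (6 + 2) * m + 2) (T₂ := 1) (Runs.forLoop
    (fun k A' => Abs.Same [8, 16] [] A A' ∧ (A'.r 8 ≠ 0 ↔ ∀ e, e < k → src e ∈ S →
      G.owner (src e) ≠ 0 → dst e ∈ S)) m 6 (by decide) (by decide) (by omega) ?_ ?_ ?_ ?_) ?_
  · exact fun k A' v h => ⟨h.1.set (by decide), by simpa using h.2⟩
  · exact fun k A' h => by simp [h.1.r 2 (by decide), hE.r2]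
  · rintro k A' ⟨hA', hk⟩ - h16 hkm
    have hE' := hE.of_same hA' (by decide) (by decide)
    have h5' : A'.a 5 = A.a 5 := hA'.a 5 (by decide)
    have hsucc : (∀ e, e < k + 1 → src e ∈ S → G.owner (src e) ≠ 0 → dst e ∈ S) ↔
        (∀ e, e < k → src e ∈ S → G.owner (src e) ≠ 0 → dst e ∈ S) ∧
          (src k ∈ S → G.owner (src k) ≠ 0 → dst k ∈ S) := by
      constructor
      · exact fun h => ⟨fun e he => h e (by omega), h k (Nat.lt_succ_self k)⟩
      · rintro ⟨h, hk⟩ e he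
        rcases (Nat.lt_succ_iff.1 he).eq_or_lt with rfl | he
        · exact hk
        · exact h e he
    have hskip : (src k ∈ S → G.owner (src k) ≠ 0 → dst k ∈ S) →
        Runs P .skip A' 1 fun A'' => (Abs.Same [8, 16] [] A A'' ∧ (A''.r 8 ≠ 0 ↔
          ∀ e, e < k + 1 → src e ∈ S → G.owner (src e) ≠ 0 → dst e ∈ S)) ∧ A''.r 16 = k := by
      intro h
      refine Runs.skip ⟨⟨hA', ?_⟩, h16⟩
      rw [hk, hsucc]
      exact ⟨fun h' => ⟨h', h⟩, And.left⟩
    refine Runs.block_cons (T₁ := 5) (T₂ := 1) ?_ fun A'' h => Runs.block_nil h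
    refine Runs.cond (T := 4) (if src k ∈ S then 1 else 0) (by decide)
      (by simp [h16, hE'.src k hkm, h5', h5]) ?_ ?_
    · intro h0
      have hw : src k ∈ S := by simpa using h0
      refine Runs.cond (T := 3) (G.owner (src k) : ℕ) (by decide)
        (by simp [h16, hE'.src k hkm, hE'.own]) ?_ ?_
      · intro h1
        refine Runs.cond (T := 2) (if dst k ∈ S then 1 else 0) (by decide)
          (by simp [h16, hE'.dst k hkm, h5', h5]) ?_ ?_
        · intro h2
          exact (hskip fun _ _ => by simpa using h2).mono_time (by omega)
        · intro h2
          have hd : dst k ∉ S := by simpa using h2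
          refine Runs.block_set 0 (by decide) (by decide) (by simp) (by omega)
            (Runs.block_nil ⟨⟨hA'.set (by decide), ?_⟩, by simp [h16]⟩)
          rw [hsucc]
          have : G.owner (src k) ≠ 0 := by omega
          simp [hd, hw, this]
      · intro h1
        exact (hskip fun _ h => absurd (by omega) h).mono_time (by omega)
    · intro h0
      have hw : src k ∉ S := by simpa using h0
      exact (hskip fun h => absurd h hw).mono_time (by omega)
  · exact ⟨(Abs.Same.refl _ _ _).set (by decide), by simp⟩
  · rintro A' ⟨hA', h8⟩
    refine Runs.block_nil ⟨hA', h8.trans ⟨fun h => ⟨Finset.subset_univ _, fun u hu ho w _ he => ?_⟩,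
      fun h e he hu ho => h.2 _ hu ho _ (Finset.mem_univ _) ((hG.mem_iff _ _).2 ⟨e, he, rfl, rfl⟩)⟩⟩
    obtain ⟨e, hem, rfl, rfl⟩ := (hG.mem_iff _ _).1 he
    exact h e hem hu ho

/-- Mark the positions that Player 0 wins. -/
def markWinning : Program := forLoop 5 (reg 4) (block [
  cond (get 14 (reg 5))
    (block [
      decode,
      testTrap,
      cond (reg 8)
        (forLoop 7 (reg 1) (block [
          cond (get 5 (reg 7)) (block [put 10 (reg 7) (lit 1)]) .skip]))
        .skip])
    .skip])

omit [Nonempty (Fin n)] in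
lemma WinInv.succ_of_not (h : WinInv G (mask S) A)
    (hn : ¬ (Good G 0 S ∧ IsTrap G.toArena 0 S Finset.univ)) : WinInv G (mask S + 1) A := by
  classical
  intro w
  rw [h w]
  refine if_congr (exists_congr fun T => ?_) rfl rfl
  constructor
  · exact fun h => ⟨by omega, h.2⟩
  · rintro ⟨h₁, h₂, h₃⟩
    refine ⟨lt_of_le_of_ne (by omega) fun h' => hn ?_, h₂, h₃⟩
    rwa [← mask_injective h']

lemma markWinning_runs (hP : Fits P n m) (hG : IsAdjacency G.toArena m src dst st)
    (hE : Env G m src dst st A) (hT : TableInv G (2 ^ n) A) (h10 : ∀ j, A.a 10 j = 0) :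
    Runs P markWinning A ((13 * n + 8 * m + 18) * 2 ^ n + 2) fun A' =>
      Abs.Same [5, 6, 7, 8, 16] [5, 10] A A' ∧ WinInv G (2 ^ n) A' := by
  classical
  have hW := hP.W_le
  have hm := hP.m_le
  refine Runs.forLoop (fun k A' => Abs.Same [5, 6, 7, 8, 16] [5, 10] A A' ∧ WinInv G k A') (2 ^ n)
    (13 * n + 8 * m + 16) (by decide) (by decide) hP.pow_le ?_ ?_ ?_
    ⟨Abs.Same.refl _ _ _, fun w => by simp [h10]⟩
  · exact fun k A' v h => ⟨h.1.set (by decide), h.2⟩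
  · exact fun k A' h => by simp [h.1.r 4 (by decide), hE.r4]
  · rintro k A' ⟨hA', hw'⟩ - h5 hk
    have hE' := hE.of_same hA' (by decide) (by decide)
    have hT' := hT.of_same hA' (by decide)
    obtain ⟨S, rfl⟩ := exists_mask_eq hk
    -- The tables are complete by now; only Player 0's table is needed, since positions not won by
    -- Player 0 are won by Player 1.
    have hgood := hT'.eq_zero_iff (σ := 0) hk
    refine Runs.block_cons (T₁ := 13 * n + 8 * m + 15)
      (T₂ := 1) ?_ fun A'' h => Runs.block_nil h
    refine Runs.cond (T := 13 * n + 8 * m + 14) (A'.a 14 (mask S)) (by decide)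
      (by simp [h5]) ?_ ?_
    · intro h0
      have hg : Good G 0 S := by
        by_contra hg
        exact h0 (hgood.2 hg)
      refine (Runs.block_cons (T₂ := 6 * n + 8 * m + 9) (decode_runs hP hE' h5) ?_).mono_time
        (by omega)
      rintro A₁ ⟨hA₁, hS₁⟩
      have hE₁ := hE'.of_same hA₁ (by decide) (by decide)
      refine (Runs.block_cons (T₂ := 6 * n + 5) (testTrap_runs hP hG hE₁ hS₁) ?_).mono_time
        (by omega)
      rintro A₂ ⟨hA₂, h8⟩
      have hE₂ := hE₁.of_same hA₂ (by decide) (by decide)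
      have hA₂' : Abs.Same [6, 7, 8, 16] [5] A' A₂ :=
        ((Abs.Same.refl _ _ A').trans hA₁ (by simp) (by simp)).trans hA₂ (by simp) (by simp)
      have hA₂'' := hA'.trans hA₂' (by simp) (by simp)
      have hw₂ : ∀ w : Fin n, A₂.a 10 w = A'.a 10 w := fun w => by rw [hA₂'.a 10 (by decide)]
      have h5₂ : A₂.r 5 = mask S := by rw [hA₂'.r 5 (by decide), h5]
      refine Runs.block_cons (T₁ := 6 * n + 4) (T₂ := 1) ?_ fun A'' h => Runs.block_nil h
      refine Runs.cond (T := 6 * n + 3) _ (by decide) rfl ?_ ?_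
      · intro h1
        have htrap := h8.1 h1
        refine (Runs.forLoop (fun k A' => Abs.Same [7] [10] A₂ A' ∧ ∀ w : Fin n,
          A'.a 10 w = if (w : ℕ) < k ∧ w ∈ S then 1 else A₂.a 10 w) n 4 (by decide) (by decide)
          (by omega) ?_ ?_ ?_ ⟨Abs.Same.refl _ _ _, by simp⟩).mono (by omega) ?_
        · exact fun k A' v h => ⟨h.1.set (by decide), h.2⟩
        · exact fun k A' h => by simp [h.1.r 1 (by decide), hE₂.r1]
        · rintro k A₃ ⟨hA₃, hw₃⟩ - h7 hkn
          let w : Fin n := ⟨k, hkn⟩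
          have h7' : A₃.r 7 = (w : ℕ) := h7
          refine Runs.block_cons (T₁ := 3) (T₂ := 1) ?_ fun A'' h => Runs.block_nil h
          refine Runs.cond (T := 2) (if w ∈ S then 1 else 0) (by decide) ?_ ?_ ?_
          · simp [h7', hA₃.a 5 (by decide), hA₂.a 5 (by decide), hS₁]
          · intro h2
            have hwS : w ∈ S := by simpa using h2
            refine Runs.block_put w 1 (by decide) (by decide) (by simp [h7']) (by simp)
              (by simp only [w]; omega) (by omega)
              (Runs.block_nil ⟨⟨hA₃.put (by decide), fun x => ?_⟩, by simp [h7]⟩)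
            by_cases hx : x = w
            · simp [hx, hwS, w]
            · have hxk : (x : ℕ) ≠ k := fun h => hx (Fin.ext h)
              rw [Abs.put_a, if_neg (by simpa [Fin.val_inj] using hx), hw₃]
              exact if_congr (and_congr_left fun _ => by omega) rfl rfl
          · intro h2
            have hwS : w ∉ S := by simpa using h2
            refine (Runs.skip ⟨⟨hA₃, fun x => ?_⟩, h7⟩).mono_time (by omega)
            rw [hw₃]
            by_cases hx : x = w
            · simp [hx, hwS]
            · have hxk : (x : ℕ) ≠ k := fun h => hx (Fin.ext h)
              exact if_congr (and_congr_left fun _ => by omega) rfl rfl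
        · rintro A₃ - ⟨hA₃, hw₃⟩
          refine ⟨⟨hA₂''.trans hA₃ (by simp) (by simp), fun w => ?_⟩,
            by rw [hA₃.r 5 (by decide), h5₂]⟩
          rw [hw₃, hw₂, hw' w]
          by_cases hwS : w ∈ S
          · rw [if_pos ⟨w.2, hwS⟩, if_pos ⟨S, by omega, hwS, hg, htrap⟩]
          · rw [if_neg fun h => hwS h.2]
            refine if_congr (exists_congr fun T => ?_) rfl rfl
            constructor
            · exact fun h => ⟨by omega, h.2⟩
            · rintro ⟨h₁, h₂, h₃⟩
              refine ⟨lt_of_le_of_ne (by omega) fun h' => hwS ?_, h₂, h₃⟩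
              rwa [← mask_injective h']
      · intro h1
        refine (Runs.skip ⟨⟨hA₂'', ?_⟩, h5₂⟩).mono_time (by omega)
        exact fun w => (hw₂ w).trans (hw'.succ_of_not (fun h => h8.2 h.2 h1) w)
    · intro h0
      refine (Runs.skip ⟨⟨hA', ?_⟩, h5⟩).mono_time (by omega)
      exact hw'.succ_of_not fun h => hgood.1 h0 h.1

/-- Write the output. -/
def writeOutput : Program := forLoop 7 (reg 1) (block [
  wr (reg 7) (sub (lit 1) (get 10 (reg 7)))])

/-- Overwriting the first input cells is harmless, since everything is read from the arrays. One bit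
suffices because each position is won by exactly one player. -/
lemma writeOutput_runs (hP : Fits P n m) (hL : n ≤ P.L) (h1 : A.r 1 = n)
    (hw : WinInv G (2 ^ n) A) :
    Runs P writeOutput A (4 * n + 2) fun A' => ∀ w : Fin n,
      (A'.inp w = 0 ∨ A'.inp w = 1) ∧ ∀ σ : Fin 2, A'.inp w = σ ↔ G.WinsFrom σ w := by
  classical
  have hW := hP.W_le
  refine (Runs.forLoop (fun k A' => A'.r 1 = n ∧ A'.a = A.a ∧ ∀ w : Fin n, (w : ℕ) < k →
    A'.inp w = 1 - A.a 10 w) n 2 (by decide) (by decide) (by omega) ?_ ?_ ?_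
    ⟨h1, rfl, fun w hw => absurd hw (Nat.not_lt_zero _)⟩).mono (by omega) ?_
  · exact fun k A' v h => ⟨by simpa using h.1, h.2⟩
  · exact fun k A' h => by simp [h.1]
  · rintro k A' ⟨h1', ha, hk⟩ - h7 hkn
    refine Runs.block_wr k (1 - A.a 10 k) (by decide) (by simp [h7]) (by simp [h7, ha])
      (by omega) (by omega) (Runs.block_nil ⟨⟨h1', ha, fun w hw => ?_⟩, h7⟩)
    by_cases hwk : (w : ℕ) = k
    · simp [hwk]
    · simpa [hwk] using hk w (by omega)
  · rintro A' - ⟨-, -, hA'⟩ w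
    have h0 : G.WinsFrom 0 w ↔ ∃ T, mask T < 2 ^ n ∧ w ∈ T ∧ Good G 0 T ∧
        IsTrap G.toArena 0 T Finset.univ := by
      rw [winsFrom_iff (σ := 0) (τ := 1) (by decide)]
      exact exists_congr fun T => ⟨fun h => ⟨mask_lt T, h⟩, And.right⟩
    have hval : A'.inp w = if G.WinsFrom 0 w then 0 else 1 := by
      rw [hA' w w.2, hw w]
      by_cases h : G.WinsFrom 0 w
      · rw [if_pos (h0.1 h), if_pos h]
      · rw [if_neg fun h' => h (h0.2 h'), if_neg h]
    have hor := winsFrom_or (G := G) (σ := 0) (τ := 1) (by decide) w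
    have hnb := not_winsFrom_both (G := G) (σ := 0) (τ := 1) (v := w) (by decide)
    rw [hval]
    by_cases h : G.WinsFrom 0 w
    · have h1 : ¬ G.WinsFrom 1 w := hnb h
      refine ⟨by simp [h], fun σ => ?_⟩
      fin_cases σ <;> simp [h, h1]
    · have h1 : G.WinsFrom 1 w := hor.resolve_left h
      refine ⟨by simp [h], fun σ => ?_⟩
      fin_cases σ <;> simp [h, h1]

end MullerGame

/-! ### The input cells and the sorting of the edges -/

namespace MullerGame

open RAM RAM.AExpr

/-- Blocks of constant length `k` make entry `j` of block `i` sit at position `k * i + j`. -/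
lemma getD_flatMap {α : Type*} {k : ℕ} {g : α → List ℕ} (hg : ∀ x, (g x).length = k)
    (L : List α) {i j : ℕ} (hi : i < L.length) (hj : j < k) :
    (L.flatMap g).getD (k * i + j) 0 = (g L[i]).getD j 0 := by
  induction L generalizing i with
  | nil => exact absurd hi (Nat.not_lt_zero _)
  | cons x L ih =>
    rw [List.flatMap_cons]
    cases i with
    | zero =>
      rw [List.getD_append _ _ _ _ (by rw [hg]; omega)]
      simp
    | succ i =>
      rw [List.getD_append_right _ _ _ _ (by rw [hg, Nat.mul_succ]; omega), hg,
        show k * (i + 1) + j - k = k * i + j by rw [Nat.mul_succ]; omega,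
        ih (by simpa using hi)]
      rfl

lemma length_flatMap_of_const {α : Type*} {k : ℕ} {g : α → List ℕ} (hg : ∀ x, (g x).length = k)
    (L : List α) : (L.flatMap g).length = k * L.length := by
  induction L with
  | nil => rfl
  | cons x L ih =>
    rw [List.flatMap_cons, List.length_append, hg, ih, List.length_cons, Nat.mul_succ,
      Nat.add_comm]

variable {n : ℕ} {G : MullerGame (Fin n)} (p : G.Presentation)

namespace Presentation

lemma length_edgeList : p.edgeList.length = G.edges.card := by
  rw [← List.toFinset_card_of_nodup p.edgeList_nodup]
  congr 1
  ext e
  rw [List.mem_toFinset, p.mem_edgeList]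

lemma length_winList : p.winList.length = (G.F 0).card := by
  rw [← List.toFinset_card_of_nodup p.winList_nodup]
  congr 1
  ext e
  rw [List.mem_toFinset, p.mem_winList]

/-- The content of the input cells. -/
def cell (a : ℕ) : ℕ := p.encode.getD a 0

lemma length_encode : p.encode.length =
    3 + n + 2 * p.edgeList.length + n * p.winList.length := by
  rw [encode, List.length_append, List.length_append, List.length_append,
    length_flatMap_of_const (k := 2) (fun _ => rfl),
    length_flatMap_of_const (k := n) (fun _ => List.length_ofFn), List.length_ofFn]
  simp only [List.length_cons, List.length_nil]

lemma cell_zero : p.cell 0 = n := by simp [cell, encode]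

lemma cell_one : p.cell 1 = p.edgeList.length := by simp [cell, encode]

lemma cell_two : p.cell 2 = p.winList.length := by simp [cell, encode]

lemma cell_owner (v : Fin n) : p.cell (3 + v) = G.owner v := by
  have hv := v.2
  rw [cell, encode, List.append_assoc, List.append_assoc,
    List.getD_append_right _ _ _ _ (by simp), List.getD_append _ _ _ _ (by simp)]
  simp

lemma cell_edge {e j : ℕ} (he : e < p.edgeList.length) (hj : j < 2) :
    p.cell (3 + n + 2 * e + j) = [(p.edgeList[e].1 : ℕ), (p.edgeList[e].2 : ℕ)].getD j 0 := by
  have hlen : ([n, p.edgeList.length, p.winList.length] ++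
    List.ofFn (fun v : Fin n => (G.owner v : ℕ))).length = 3 + n := by simp; omega
  rw [cell, encode, List.append_assoc, List.getD_append_right _ _ _ _ (by rw [hlen]; omega),
    hlen, List.getD_append _ _ _ _ (by
      rw [length_flatMap_of_const (k := 2) (fun _ => rfl)]; omega),
    show 3 + n + 2 * e + j - (3 + n) = 2 * e + j by omega]
  exact getD_flatMap (k := 2) (fun _ => rfl) _ he hj

lemma cell_src {e : ℕ} (he : e < p.edgeList.length) :
    p.cell (3 + n + 2 * e) = p.edgeList[e].1 := p.cell_edge he (j := 0) (by decide)

lemma cell_dst {e : ℕ} (he : e < p.edgeList.length) :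
    p.cell (3 + n + 2 * e + 1) = p.edgeList[e].2 := p.cell_edge he (j := 1) (by decide)

lemma cell_win {i : ℕ} (hi : i < p.winList.length) (v : Fin n) :
    p.cell (3 + n + 2 * p.edgeList.length + (n * i + v)) = if v ∈ p.winList[i] then 1 else 0 := by
  have hlen : ([n, p.edgeList.length, p.winList.length] ++
    List.ofFn (fun v : Fin n => (G.owner v : ℕ)) ++
    p.edgeList.flatMap (fun e => [(e.1 : ℕ), (e.2 : ℕ)])).length =
      3 + n + 2 * p.edgeList.length := by
    rw [List.length_append, length_flatMap_of_const (k := 2) (fun _ => rfl)]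
    simp
    omega
  rw [cell, encode, List.getD_append_right _ _ _ _ (by rw [hlen]; omega), hlen,
    Nat.add_sub_cancel_left, getD_flatMap (fun _ => List.length_ofFn) _ hi v.2]
  simp

lemma cell_eq_zero {a : ℕ} (ha : 3 + n + 2 * p.edgeList.length + n * p.winList.length ≤ a) :
    p.cell a = 0 := by
  rw [cell, List.getD_eq_default _ _ (by rw [length_encode]; exact ha)]

/-- Beyond the edges the input consists of bits; this keeps the explicitly listed sets within one
bit-sized cell per entry in the space bound. -/
lemma cell_le_one {a : ℕ} (ha : 3 + n + 2 * p.edgeList.length ≤ a) : p.cell a ≤ 1 := by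
  by_cases h : a < 3 + n + 2 * p.edgeList.length + n * p.winList.length
  · obtain ⟨b, rfl⟩ := Nat.exists_eq_add_of_le ha
    have hb : b < n * p.winList.length := by omega
    have hn : 0 < n := Nat.pos_of_ne_zero (by rintro rfl; simp at hb)
    have hi : b / n < p.winList.length := Nat.div_lt_of_lt_mul hb
    have := p.cell_win hi ⟨b % n, Nat.mod_lt _ hn⟩
    simp only [Nat.div_add_mod] at this
    rw [this]
    split_ifs <;> omega
  · rw [p.cell_eq_zero (by omega)]
    omega

/-- The first edges of the list of all edges sorted by their ends: those with an end less
than `u`. -/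
def sortedEdges (u : ℕ) : List (Fin n × Fin n) :=
  (List.range u).flatMap fun i => p.edgeList.filter fun e => (e.2 : ℕ) = i

lemma sortedEdges_succ (u : ℕ) : p.sortedEdges (u + 1) =
    p.sortedEdges u ++ p.edgeList.filter fun e => (e.2 : ℕ) = u := by
  simp [sortedEdges, List.range_succ]

lemma sortedEdges_prefix {u u' : ℕ} (h : u ≤ u') : p.sortedEdges u <+: p.sortedEdges u' := by
  induction h with
  | refl => exact List.prefix_rfl
  | step _ ih =>
    rw [sortedEdges_succ]
    exact ih.trans (List.prefix_append _ _)

lemma length_sortedEdges : (p.sortedEdges n).length = p.edgeList.length := by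
  -- Each edge passes the filter for exactly one end, so the filtered lists have the right total
  -- length.
  have key : ∀ L : List (Fin n × Fin n),
      ∑ i ∈ Finset.range n, (L.filter fun e => (e.2 : ℕ) = i).length = L.length := by
    intro L
    induction L with
    | nil => simp
    | cons x L ih =>
      have : ∀ i : ℕ, ((x :: L).filter fun e => (e.2 : ℕ) = i).length =
          (L.filter fun e => (e.2 : ℕ) = i).length + if (x.2 : ℕ) = i then 1 else 0 := by
        intro i
        rw [List.filter_cons]
        split_ifs <;> simp_all
      simp only [this, Finset.sum_add_distrib, ih, Finset.sum_ite_eq, Finset.mem_range, x.2.2,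
        if_true, List.length_cons]
  have h2 : ∀ u, (p.sortedEdges u).length =
      ∑ i ∈ Finset.range u, (p.edgeList.filter fun e => (e.2 : ℕ) = i).length := by
    intro u
    induction u with
    | zero => rfl
    | succ u ih => rw [sortedEdges_succ, List.length_append, ih, Finset.sum_range_succ]
  rw [h2, key]

lemma mem_sortedEdges (e : Fin n × Fin n) : e ∈ p.sortedEdges n ↔ e ∈ G.edges := by
  rw [← p.mem_edgeList, sortedEdges, List.mem_flatMap]
  constructor
  · rintro ⟨i, -, hi⟩
    exact (List.mem_filter.1 hi).1
  · exact fun h => ⟨e.2, by simp, List.mem_filter.2 ⟨h, by simp⟩⟩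

variable [NeZero n]

/-- The edge with index `e` in the sorted list. -/
def edge (e : ℕ) : Fin n × Fin n := (p.sortedEdges n).getD e (0, 0)

lemma edge_eq {u e : ℕ} (hu : u ≤ n) (he : e < (p.sortedEdges u).length) :
    p.edge e = (p.sortedEdges u)[e] := by
  obtain ⟨t, ht⟩ := p.sortedEdges_prefix hu
  rw [edge, ← ht, List.getD_append _ _ _ _ he, List.getD_eq_getElem _ _ he]

lemma isAdjacency : IsAdjacency G.toArena p.edgeList.length (fun e => (p.edge e).1)
    (fun e => (p.edge e).2) (fun u => (p.sortedEdges u).length) := by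
  have hmono : ∀ {u u'}, u ≤ u' → (p.sortedEdges u).length ≤ (p.sortedEdges u').length :=
    fun h => (p.sortedEdges_prefix h).length_le
  have hseg : ∀ u < n, ∀ e, (p.sortedEdges u).length ≤ e → e < (p.sortedEdges (u + 1)).length →
      ((p.edge e).2 : ℕ) = u := by
    intro u hu e h₁ h₂
    rw [p.edge_eq hu h₂]
    simp only [p.sortedEdges_succ u]
    rw [List.getElem_append_right h₁]
    have := List.getElem_mem (l := p.edgeList.filter fun e => (e.2 : ℕ) = u)
      (n := e - (p.sortedEdges u).length) (by
        rw [p.sortedEdges_succ, List.length_append] at h₂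
        omega)
    simpa using (List.mem_filter.1 this).2
  refine ⟨fun u w => ?_, fun u e => ?_, fun u => hmono (Nat.le_succ _),
    p.length_sortedEdges.le⟩
  · rw [← p.mem_sortedEdges, List.mem_iff_getElem, ← p.length_sortedEdges]
    constructor
    · rintro ⟨e, he, h⟩
      refine ⟨e, he, ?_⟩
      rw [p.edge_eq le_rfl he, h]
      exact ⟨rfl, rfl⟩
    · rintro ⟨e, he, h₁, h₂⟩
      refine ⟨e, he, ?_⟩
      rw [← p.edge_eq le_rfl he, ← h₁, ← h₂]
  · constructor
    · rintro ⟨h₁, h₂⟩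
      refine ⟨?_, Fin.ext (hseg u u.2 e h₁ h₂)⟩
      rw [← p.length_sortedEdges]
      exact h₂.trans_le (hmono u.2)
    · rintro ⟨he, hu⟩
      rw [← p.length_sortedEdges] at he
      -- The segment that contains index `e` is found as the first prefix longer than `e`; the
      -- common end of its edges identifies it as the segment of `u`.
      have hex : ∃ k, e < (p.sortedEdges k).length := ⟨n, he⟩
      have hk := Nat.find_spec hex
      have hkn : Nat.find hex ≤ n := Nat.find_min' hex he
      have hk0 : Nat.find hex ≠ 0 := by
        intro h
        rw [h] at hk
        exact absurd hk (Nat.not_lt_zero _)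
      obtain ⟨k, hk'⟩ := Nat.exists_eq_succ_of_ne_zero hk0
      have hmin := Nat.find_min hex (m := k) (by omega)
      rw [hk'] at hk hkn
      have := hseg k hkn e (not_lt.1 hmin) hk
      rw [hu] at this
      rw [this]
      exact ⟨not_lt.1 hmin, hk⟩

end Presentation

end MullerGame

/-! ### Programs that store the input in the arrays -/

namespace MullerGame

open RAM RAM.AExpr

namespace Presentation

variable {n : ℕ} {G : MullerGame (Fin n)} (p : G.Presentation) {A A' : Abs}

/-- The sizes that occur in the computation on the input that `p` describes. -/
def sizes : Sizes where
  L := 3 + n + 2 * p.edgeList.length + n * p.winList.length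
  n := n
  m := n + p.edgeList.length
  W := 3 + n + 2 * p.edgeList.length + n * p.winList.length + 2 ^ n + n + p.edgeList.length + 10
  inp := p.cell

lemma fits : Fits p.sizes n p.edgeList.length where
  n_eq := rfl
  m_le := le_rfl
  W_le := by
    have := Nat.two_pow_pos n
    simp only [sizes]
    omega
  pow_le := by
    have := Nat.two_pow_pos n
    simp only [sizes]
    omega

lemma length_winList_le : p.winList.length ≤ 2 ^ n := by
  rw [length_winList]
  exact (Finset.card_le_univ _).trans (by simp)

lemma le_W : 3 + n + 2 * p.edgeList.length + n * p.winList.length + 2 ^ n ≤ p.sizes.W ∧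
    p.winList.length ≤ p.sizes.W ∧ p.sizes.W = 3 + n + 2 * p.edgeList.length +
      n * p.winList.length + 2 ^ n + n + p.edgeList.length + 10 := by
  have := p.length_winList_le
  have := Nat.two_pow_pos n
  exact ⟨by simp only [sizes]; omega, by simp only [sizes]; omega, rfl⟩

/-- The state in which the numbers of positions, edges and sets are in the registers `1`, `2`
and `3`. -/
structure Start (A : Abs) : Prop where
  r1 : A.r 1 = n
  r2 : A.r 2 = p.edgeList.length
  r3 : A.r 3 = p.winList.length
  inp : A.inp = p.cell

variable {p}

lemma Start.of_same {R I : List ℕ} (h : p.Start A) (hS : Abs.Same R I A A')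
    (hR : ∀ x ∈ [1, 2, 3], x ∉ R) : p.Start A' where
  r1 := by rw [hS.r 1 (hR 1 (by decide)), h.r1]
  r2 := by rw [hS.r 2 (hR 2 (by decide)), h.r2]
  r3 := by rw [hS.r 3 (hR 3 (by decide)), h.r3]
  inp := by rw [hS.inp, h.inp]

/-- Compute the powers of two. -/
def powers : Program := block [
  set 4 (lit 1),
  forLoop 5 (reg 1) (block [put 0 (reg 5) (reg 4), set 4 (add (reg 4) (reg 4))])]

lemma powers_runs (h : p.Start A) : Runs p.sizes powers A (5 * n + 4) fun A' =>
    Abs.Same [4, 5] [0] A A' ∧ A'.r 4 = 2 ^ n ∧ ∀ v : Fin n, A'.a 0 v = 2 ^ (v : ℕ) := by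
  have hW := p.fits.W_le
  have hm := p.fits.m_le
  have hN := p.fits.pow_le
  refine Runs.block_set 1 (by decide) (by decide) (by simp) (by omega) ?_
  refine Runs.block_cons (T₁ := (3 + 2) * n + 2) (T₂ := 1) (Runs.forLoop (fun k A' =>
    Abs.Same [4, 5] [0] A A' ∧ A'.r 4 = 2 ^ k ∧ ∀ v : Fin n, (v : ℕ) < k → A'.a 0 v = 2 ^ (v : ℕ))
    n 3 (by decide) (by decide) (by omega) ?_ ?_ ?_ ⟨(Abs.Same.refl _ _ _).set (by decide), by simp,
      fun w hw => absurd hw (Nat.not_lt_zero _)⟩) ?_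
  · exact fun k A' v h => ⟨h.1.set (by decide), by simpa using h.2.1, h.2.2⟩
  · exact fun k A' hA => by simp [hA.1.r 1 (by decide), h.r1]
  · rintro k A' ⟨hA', h4, hk⟩ - h5 hkn
    have hpow : 2 ^ (k + 1) ≤ 2 ^ n := Nat.pow_le_pow_right (by decide) hkn
    rw [Nat.pow_succ] at hpow
    refine Runs.block_put k (2 ^ k) (by decide) (by decide) (by simp [h5]) (by simp [h4])
      (by omega) (by omega) ?_
    refine Runs.block_set (2 ^ k * 2) (by decide) (by decide) (by simp [h4]; omega) (by omega)
      (Runs.block_nil ⟨⟨(hA'.put (by decide)).set (by decide), by simp [Nat.pow_succ],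
        fun v hv => ?_⟩, by simp [h5]⟩)
    by_cases hvk : (v : ℕ) = k
    · simp [hvk]
    · simpa [hvk] using hk v (by omega)
  · rintro A' ⟨hA', h4, hv⟩
    exact Runs.block_nil ⟨hA', h4, fun v => hv v v.2⟩

/-- Read the owners of the positions. -/
def readOwners : Program := forLoop 5 (reg 1) (block [
  rd 6 (add (lit 3) (reg 5)),
  put 1 (reg 5) (reg 6)])

lemma readOwners_runs (h : p.Start A) : Runs p.sizes readOwners A (5 * n + 2) fun A' =>
    Abs.Same [5, 6] [1] A A' ∧ ∀ v : Fin n, A'.a 1 v = G.owner v := by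
  have hW := p.fits.W_le
  have hm := p.fits.m_le
  refine (Runs.forLoop (fun k A' => Abs.Same [5, 6] [1] A A' ∧ ∀ v : Fin n, (v : ℕ) < k →
    A'.a 1 v = G.owner v) n 3 (by decide) (by decide) (by omega) ?_ ?_ ?_
    ⟨Abs.Same.refl _ _ _, fun w hw => absurd hw (Nat.not_lt_zero _)⟩).mono (by omega)
    fun A' _ h => ⟨h.1, fun v => h.2 v v.2⟩
  · exact fun k A' v h => ⟨h.1.set (by decide), h.2⟩
  · exact fun k A' hA => by simp [hA.1.r 1 (by decide), h.r1]
  · rintro k A' ⟨hA', hk⟩ - h5 hkn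
    let w : Fin n := ⟨k, hkn⟩
    have ho := (G.owner w).2
    refine Runs.block_rd (3 + k) (G.owner w) (by decide) (by decide) (by simp [h5]) ?_ ?_
      (by omega) ?_
    · simp only [sizes]
      omega
    · rw [hA'.inp, h.inp]
      exact p.cell_owner w
    refine Runs.block_put k (G.owner w) (by decide) (by decide) (by simp [h5]) (by simp) (by omega)
      (by omega) (Runs.block_nil ⟨⟨(hA'.set (by decide)).put (by decide), fun v hv => ?_⟩,
        by simp [h5]⟩)
    by_cases hvk : (v : ℕ) = k
    · have : v = w := Fin.ext hvk
      simp [this, w]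
    · simpa [hvk] using hk v (by omega)

/-- Sort the edges by their ends. -/
def sortEdges : Program := block [
  set 6 (lit 0),
  forLoop 5 (reg 1) (block [
    put 2 (reg 5) (reg 6),
    set 8 (add (lit 3) (reg 1)),
    forLoop 7 (reg 2) (block [
      rd 9 (add (reg 8) (lit 1)),
      cond (eq (reg 9) (reg 5))
        (block [
          rd 9 (reg 8),
          put 3 (reg 6) (reg 9),
          put 4 (reg 6) (reg 5),
          set 6 (add (reg 6) (lit 1))])
        .skip,
      set 8 (add (reg 8) (lit 2))])]),
  put 2 (reg 1) (reg 6)]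

/-- The edges in `L` are stored at the beginning of the edge arrays. -/
def Stored (L : List (Fin n × Fin n)) (A : Abs) : Prop :=
  A.r 6 = L.length ∧
    ∀ (e : ℕ) (he : e < L.length), A.a 3 e = (L[e].1 : Fin n) ∧ A.a 4 e = (L[e].2 : Fin n)

/-- One pass over all edges for each end is enough: $n$ passes of length $m$ are far below the bound
to be proved. The number of edges stored before pass `k` is the start of segment `k`. -/
lemma sortEdges_runs (h : p.Start A) :
    Runs p.sizes sortEdges A ((11 * p.edgeList.length + 7) * n + 5) fun A' =>
      Abs.Same [5, 6, 7, 8, 9] [2, 3, 4] A A' ∧ Stored (p.sortedEdges n) A' ∧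
      ∀ u ≤ n, A'.a 2 u = (p.sortedEdges u).length := by
  have hW := p.fits.W_le
  have hm := p.fits.m_le
  have hpos := Nat.two_pow_pos n
  have hlen : ∀ u ≤ n, (p.sortedEdges u).length ≤ p.edgeList.length := fun u hu => by
    rw [← p.length_sortedEdges]
    exact (p.sortedEdges_prefix hu).length_le
  refine Runs.block_set (T := (11 * p.edgeList.length + 7) * n + 4) 0 (by decide) (by decide)
    (by simp) (by omega) ?_
  refine Runs.block_cons (T₁ := ((11 * p.edgeList.length + 5) + 2) * n + 2) (T₂ := 2)
    (Runs.forLoop (fun k A' => Abs.Same [5, 6, 7, 8, 9] [2, 3, 4] A A' ∧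
      Stored (p.sortedEdges k) A' ∧ ∀ u < k, A'.a 2 u = (p.sortedEdges u).length) n
      (11 * p.edgeList.length + 5) (by decide) (by decide) (by omega) ?_ ?_ ?_ ?_) ?_
  · exact fun k A' v h => ⟨h.1.set (by decide), by simpa [Stored] using h.2.1, h.2.2⟩
  · exact fun k A' hA => by simp [hA.1.r 1 (by decide), h.r1]
  · rintro k A' ⟨hA', hst, hk⟩ - h5 hkn
    have h' := h.of_same hA' (by decide)
    have hlk := hlen k hkn.le
    refine (Runs.block_put (T := 11 * p.edgeList.length + 4) k (p.sortedEdges k).length (by decide)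
      (by decide) (by simp [h5]) (by simp [hst.1]) (by omega) (by omega) ?_)
    refine Runs.block_set (3 + n) (by decide) (by decide) (by simp [h'.r1])
      (by have := p.le_W; omega) ?_
    have hA₁ : Abs.Same [8] [2] A' ((A'.put 2 k (p.sortedEdges k).length).set 8 (3 + n)) :=
      ((Abs.Same.refl _ _ _).put (by decide)).set (by decide)
    have hk₁ : ∀ u < k + 1, ((A'.put 2 k (p.sortedEdges k).length).set 8 (3 + n)).a 2 u =
        (p.sortedEdges u).length := by
      intro u hu
      by_cases huk : u = k
      · simp [huk]
      · simpa [huk] using hk u (by omega)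
    refine Runs.block_cons (T₁ := (9 + 2) * p.edgeList.length + 2) (T₂ := 1)
      (Runs.forLoop (fun i A'' => Abs.Same [6, 7, 8, 9] [3, 4]
        ((A'.put 2 k (p.sortedEdges k).length).set 8 (3 + n)) A'' ∧ A''.r 8 = 3 + n + 2 * i ∧
        Stored (p.sortedEdges k ++ (p.edgeList.take i).filter fun e => (e.2 : ℕ) = k) A'')
        p.edgeList.length 9 (by decide) (by decide) (by omega) ?_ ?_ ?_ ?_) ?_
    · exact fun k A' v h => ⟨h.1.set (by decide), by simpa using h.2.1,
        by simpa [Stored] using h.2.2⟩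
    · exact fun k A' hA => by
        simp [hA.1.r 2 (by decide), h'.r2]
    · rintro i A'' ⟨hA'', h8, hst'⟩ - h7 hi
      have hin : A''.inp = p.cell := by rw [hA''.inp, hA₁.inp, h'.inp]
      have h5' : A''.r 5 = k := by rw [hA''.r 5 (by decide), hA₁.r 5 (by decide), h5]
      have hLW := p.le_W
      have hL : 3 + n + 2 * i + 1 < p.sizes.L := by
        simp only [sizes]
        omega
      have hs := p.edgeList[i].1.2
      have hd := p.edgeList[i].2.2
      have htake : p.edgeList.take (i + 1) = p.edgeList.take i ++ [p.edgeList[i]] := by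
        rw [List.take_append_getElem]
      -- An unfinished pass has stored at most as many edges as a finished one, so the edge arrays
      -- do not overflow.
      have hlen' : ∀ i, (p.sortedEdges k ++
          (p.edgeList.take i).filter fun e => (e.2 : ℕ) = k).length ≤ p.edgeList.length := by
        intro i
        refine le_trans ?_ (hlen (k + 1) hkn)
        rw [p.sortedEdges_succ, List.length_append, List.length_append]
        exact Nat.add_le_add_left (((List.take_sublist _ _).filter _).length_le) _
      refine Runs.block_rd (T := 8) (3 + n + 2 * i + 1) p.edgeList[i].2 (by decide) (by decide)
        (by simp [h8]) hL (by rw [hin, p.cell_dst hi]) (by omega) ?_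
      refine Runs.block_cons (T₁ := 6) (T₂ := 2) (Q₁ := fun B => Abs.Same [6, 7, 8, 9] [3, 4]
        ((A'.put 2 k (p.sortedEdges k).length).set 8 (3 + n)) B ∧ B.r 8 = 3 + n + 2 * i ∧
        B.r 7 = i ∧
        Stored (p.sortedEdges k ++ (p.edgeList.take (i + 1)).filter fun e => (e.2 : ℕ) = k) B)
        ?_ ?_
      · refine Runs.cond (T := 5) (if (p.edgeList[i].2 : ℕ) = k then 1 else 0) (by decide)
          (by simp [h5']) ?_ ?_
        · intro h0
          have hk' : (p.edgeList[i].2 : ℕ) = k := by simpa using h0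
          have happ : p.sortedEdges k ++ (p.edgeList.take (i + 1)).filter
              (fun e => (e.2 : ℕ) = k) = (p.sortedEdges k ++
              (p.edgeList.take i).filter fun e => (e.2 : ℕ) = k) ++ [p.edgeList[i]] := by
            rw [htake, List.filter_append, List.append_assoc]
            congr 2
            simp [hk']
          have hlt := hlen' (i + 1)
          rw [happ] at hlt ⊢
          generalize p.sortedEdges k ++ (p.edgeList.take i).filter
            (fun e => (e.2 : ℕ) = k) = L at hst' hlt ⊢
          rw [List.length_append, List.length_singleton] at hlt
          refine Runs.block_rd (3 + n + 2 * i) p.edgeList[i].1 (by decide) (by decide)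
            (by simp [h8]) (by omega) (by rw [Abs.set_inp, hin, p.cell_src hi]) (by omega) ?_
          refine Runs.block_put L.length p.edgeList[i].1 (by decide) (by decide)
            (by simp [hst'.1]) (by simp) (by omega) (by omega) ?_
          refine Runs.block_put L.length k (by decide) (by decide)
            (by simp [hst'.1]) (by simp [h5']) (by omega) (by omega) ?_
          refine Runs.block_set (L.length + 1) (by decide) (by decide) (by simp [hst'.1])
            (by omega) (Runs.block_nil ⟨?_, by simp [h8], by simp [h7], by simp, ?_⟩)
          · exact ((((hA''.set (by decide)).set (by decide)).put (by decide)).put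
              (by decide)).set (by decide)
          · intro e he
            rw [List.length_append, List.length_singleton] at he
            rcases (Nat.lt_succ_iff.1 he).eq_or_lt with rfl | he'
            · simp [hk']
            · have := hst'.2 e he'
              simp [he'.ne, this, List.getElem_append_left he']
        · intro h0
          have hk' : (p.edgeList[i].2 : ℕ) ≠ k := by simpa using h0
          refine (Runs.skip ⟨hA''.set (by decide), by simp [h8], by simp [h7], ?_⟩).mono_time
            (by omega)
          rw [htake, List.filter_append]
          simpa [Stored, hk'] using hst'
      · rintro B ⟨hB, h8', h7', hst''⟩
        refine Runs.block_set (3 + n + 2 * (i + 1)) (by decide) (by decide) ?_ (by omega)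
          (Runs.block_nil ⟨⟨hB.set (by decide), by simp, ?_⟩, by simp [h7']⟩)
        · simp [h8']
          omega
        · simpa [Stored] using hst''
    · refine ⟨Abs.Same.refl _ _ _, by simp, ?_⟩
      simpa [Stored] using hst
    · rintro A'' ⟨hA'', -, hst'⟩
      rw [List.take_length, ← p.sortedEdges_succ] at hst'
      refine Runs.block_nil ⟨⟨(hA'.trans hA₁ (by simp) (by simp)).trans hA'' (by simp) (by simp),
        hst', fun u hu => ?_⟩, ?_⟩
      · rw [hA''.a 2 (by decide), hk₁ u hu]
      · rw [hA''.r 5 (by decide), hA₁.r 5 (by decide), h5]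
  · refine ⟨(Abs.Same.refl _ _ _).set (by decide), ⟨by simp [sortedEdges], ?_⟩, ?_⟩
    · intro e he
      exact absurd he (Nat.not_lt_zero _)
    · intro u hu
      exact absurd hu (Nat.not_lt_zero _)
  · rintro A' ⟨hA', hst, hk⟩
    have hln := hlen n le_rfl
    refine Runs.block_put n (p.sortedEdges n).length (by decide) (by decide)
      (by simp [hA'.r 1 (by decide), h.r1]) (by simp [hst.1]) (by omega) (by omega)
      (Runs.block_nil ⟨hA'.put (by decide), by simpa [Stored] using hst, fun u hu => ?_⟩)
    by_cases hun : u = n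
    · simp [hun]
    · simpa [hun] using hk u (by omega)

/-- Mark the sets that are winning for Player 0. -/
def markSets : Program := block [
  set 6 (add (add (lit 3) (reg 1)) (add (reg 2) (reg 2))),
  forLoop 5 (reg 3) (block [
    set 7 (lit 0),
    forLoop 8 (reg 1) (block [
      rd 9 (reg 6),
      cond (reg 9) (block [set 7 (add (reg 7) (get 0 (reg 8)))]) .skip,
      set 6 (add (reg 6) (lit 1))]),
    put 13 (reg 7) (lit 1)])]

/-- The register `6` runs once through the strings without being reset, and each string is summed up
to the number of its set. -/
lemma markSets_runs (h : p.Start A) (hpow : ∀ v : Fin n, A.a 0 v = 2 ^ (v : ℕ))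
    (h13 : ∀ j, A.a 13 j = 0) :
    Runs p.sizes markSets A ((8 * n + 7) * p.winList.length + 4) fun A' =>
      Abs.Same [5, 6, 7, 8, 9] [13] A A' ∧
      ∀ S : Finset (Fin n), A'.a 13 (mask S) = if S ∈ G.F 0 then 1 else 0 := by
  classical
  have hW := p.fits.W_le
  have hLW := p.le_W
  have hpos := Nat.two_pow_pos n
  refine Runs.block_set (T := (8 * n + 7) * p.winList.length + 3)
    (3 + n + 2 * p.edgeList.length) (by decide) (by decide) (by simp [h.r1, h.r2]; omega)
    (by omega) ?_
  refine Runs.block_cons (T₁ := ((8 * n + 5) + 2) * p.winList.length + 2) (T₂ := 1)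
    (Runs.forLoop (fun i A' => Abs.Same [5, 6, 7, 8, 9] [13] A A' ∧
      A'.r 6 = 3 + n + 2 * p.edgeList.length + n * i ∧
      ∀ S : Finset (Fin n), A'.a 13 (mask S) = if S ∈ p.winList.take i then 1 else 0)
      p.winList.length (8 * n + 5) (by decide) (by decide) (by omega) ?_ ?_ ?_ ?_) ?_
  · exact fun k A' v h => ⟨h.1.set (by decide), by simpa using h.2.1, h.2.2⟩
  · exact fun k A' hA => by simp [hA.1.r 3 (by decide), h.r3]
  · rintro i A' ⟨hA', h6, hi⟩ - h5 hiw
    have h' := h.of_same hA' (by decide)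
    have hni : n * (i + 1) ≤ n * p.winList.length := Nat.mul_le_mul_left _ hiw
    rw [Nat.mul_succ] at hni
    obtain ⟨X, hX⟩ : ∃ X, X = p.winList[i] := ⟨_, rfl⟩
    refine Runs.block_set (T := 8 * n + 4) 0 (by decide) (by decide) (by simp) (by omega) ?_
    refine Runs.block_cons (T₁ := (6 + 2) * n + 2) (T₂ := 2)
      (Runs.forLoop (fun k A'' => Abs.Same [6, 7, 8, 9] [] A' A'' ∧
        A''.r 6 = 3 + n + 2 * p.edgeList.length + (n * i + k) ∧
        A''.r 7 = mask (X.filter fun w : Fin n => (w : ℕ) < k))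
        n 6 (by decide) (by decide) (by omega) ?_ ?_ ?_ ?_) ?_
    · exact fun k A' v h => ⟨h.1.set (by decide), by simpa using h.2.1, by simpa using h.2.2⟩
    · exact fun k A' hA => by simp [hA.1.r 1 (by decide), h'.r1]
    · rintro k A'' ⟨hA'', h6', h7⟩ - h8 hkn
      let w : Fin n := ⟨k, hkn⟩
      have hin : A''.inp = p.cell := by rw [hA''.inp, h'.inp]
      have hp0 : A''.a 0 k = 2 ^ k := by
        rw [hA''.a 0 (by decide), hA'.a 0 (by decide)]
        exact hpow w
      have hcell := p.cell_win hiw w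
      rw [← hX] at hcell
      have hsucc := mask_filter_succ X w
      have hlt : mask (X.filter fun v : Fin n => (v : ℕ) < w + 1) < 2 ^ n := mask_lt _
      refine Runs.block_rd (T := 5) (3 + n + 2 * p.edgeList.length + (n * i + k))
        (if w ∈ X then 1 else 0) (by decide) (by decide) (by simp [h6']) ?_
        (by rw [hin]; exact hcell) (by split_ifs <;> omega) ?_
      · simp only [sizes]
        omega
      refine Runs.block_cons (T₁ := 3) (T₂ := 2) (Q₁ := fun B => Abs.Same [6, 7, 8, 9] [] A' B ∧
        B.r 6 = 3 + n + 2 * p.edgeList.length + (n * i + k) ∧ B.r 8 = k ∧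
        B.r 7 = mask (X.filter fun v : Fin n => (v : ℕ) < w + 1)) ?_ ?_
      · refine Runs.cond (T := 2) (if w ∈ X then 1 else 0) (by decide) (by simp) ?_ ?_
        · intro h0
          have hw : w ∈ X := by simpa using h0
          refine Runs.block_set _ (by decide) (by decide) ?_ (hlt.le.trans (by omega))
            (Runs.block_nil ⟨(hA''.set (by decide)).set (by decide), by simp [h6'],
              by simp [h8], by simp⟩)
          rw [if_pos hw] at hsucc
          rw [hsucc]
          simp only [AExpr.eval, Abs.set_r, Abs.set_a, if_neg (show (7 : ℕ) ≠ 9 by decide),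
            if_neg (show (8 : ℕ) ≠ 9 by decide), h8]
          exact congrArg₂ (· + ·) h7 hp0
        · intro h0
          have hw : w ∉ X := by simpa using h0
          refine (Runs.skip ⟨hA''.set (by decide), by simp [h6'], by simp [h8], ?_⟩).mono_time
            (by omega)
          rw [if_neg hw] at hsucc
          rw [hsucc]
          rw [Abs.set_r, if_neg (by decide)]
          exact h7
      · rintro B ⟨hB, h6B, h8B, h7B⟩
        exact Runs.block_set (3 + n + 2 * p.edgeList.length + (n * i + (k + 1))) (by decide)
          (by decide) (by simp [h6B]; omega) (by omega) (Runs.block_nil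
            ⟨⟨hB.set (by decide), by simp, by rw [Abs.set_r, if_neg (by decide)]; exact h7B⟩,
              by simp [h8B]⟩)
    · exact ⟨(Abs.Same.refl _ _ _).set (by decide), by simp [h6], by simp [mask]⟩
    · rintro A'' ⟨hA'', h6', h7⟩
      have hXf : X.filter (fun w : Fin n => (w : ℕ) < n) = X :=
        Finset.filter_true_of_mem fun w _ => w.2
      rw [hXf] at h7
      refine Runs.block_putBit (mask X) 1 (by decide) (by decide) (by simp [h7]) (by simp)
        (mask_lt X) le_rfl (Runs.block_nil ⟨⟨(hA'.trans hA'' (by simp) (by simp)).put (by decide),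
          ?_, fun S => ?_⟩, ?_⟩)
      · rw [Abs.put_r, h6', Nat.mul_succ]
      · rw [Abs.put_a, hA''.a 13 (by decide), hi, ← List.take_append_getElem hiw, ← hX]
        by_cases hSX : S = X
        · simp [hSX]
        · have : mask S ≠ mask X := fun h => hSX (mask_injective h)
          simp [hSX, this]
      · rw [Abs.put_r, hA''.r 5 (by decide), h5]
  · exact ⟨(Abs.Same.refl _ _ _).set (by decide), by simp, fun S => by simp [h13]⟩
  · rintro A' ⟨hA', -, hS⟩
    refine Runs.block_nil ⟨hA', fun S => ?_⟩
    rw [hS S, List.take_length]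
    exact if_congr (p.mem_winList S) rfl rfl

end Presentation

end MullerGame

/-! ### Locating the arrays, and the whole program -/

namespace MullerGame

open RAM

namespace Presentation

variable {n : ℕ} {G : MullerGame (Fin n)} (p : G.Presentation) {A A' : Abs} {r : ℕ → ℕ}

/-- The states that occur in the computation on the input that `p` describes. -/
def Ok (s : State) : Prop := ∃ A, Layout p.sizes s A ∧ Safe p.sizes A

/-- The state of the abstract machine with the registers `r` and with empty arrays. -/
def abs (r : ℕ → ℕ) : Abs := ⟨r, fun _ _ => 0, p.cell⟩

lemma layout_abs (r : ℕ → ℕ) : Layout p.sizes ⟨r, p.cell⟩ (p.abs r) where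
  reg := rfl
  inp _ _ := rfl
  arr i j _ := p.cell_eq_zero (by simp only [sizes]; omega)

/-- The registers `r` satisfy the bounds. -/
def RegsFit (r : ℕ → ℕ) : Prop := (∀ x, r x ≤ p.sizes.W) ∧ ∀ x, 40 ≤ x → r x = 0

variable {p}

lemma RegsFit.safe (h : p.RegsFit r) : Safe p.sizes (p.abs r) where
  r_le := h.1
  r_zero := h.2
  inp_le _ _ := le_max_left _ _
  word_le _ _ _ := Nat.zero_le _
  word_zero _ _ _ _ := rfl
  bit_le _ _ _ := Nat.zero_le _
  bit_zero _ _ _ _ := rfl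

lemma RegsFit.ok (h : p.RegsFit r) : p.Ok ⟨r, p.cell⟩ := ⟨_, p.layout_abs r, h.safe⟩

lemma RegsFit.update (h : p.RegsFit r) {x v : ℕ} (hx : x < 40) (hv : v ≤ p.sizes.W) :
    p.RegsFit (Function.update r x v) := by
  refine ⟨fun y => ?_, fun y hy => ?_⟩
  · rw [Function.update_apply]
    split_ifs
    exacts [hv, h.1 y]
  · rw [Function.update_of_ne (by omega), h.2 y hy]

lemma RegsFit.assign (h : p.RegsFit r) {x : ℕ} {e : Expr} (v : ℕ) (hx : x < 40)
    (he : e.eval ⟨r, p.cell⟩ = v) (hv : v ≤ p.sizes.W) :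
    Run p.Ok (.assign x e) ⟨r, p.cell⟩ (e.cost + 1) ⟨Function.update r x v, p.cell⟩ := by
  subst he
  exact .assign x e ⟨r, p.cell⟩ (h.update hx hv).ok

/-- Add to the register `0` the product of the registers `1` and `5`. -/
def addProduct : Program := .while (.reg 5)
  (.seq (.assign 0 (.add (.reg 0) (.reg 1))) (.assign 5 (.sub (.reg 5) (.lit 1))))

/-- Multiplication by repeated addition: there are at most $2^n$ listed sets, so the time is
affordable. The argument works on the bare machine, because array access presupposes the address
that is being computed. -/
lemma addProduct_run (k : ℕ) (h : p.RegsFit r) (h5 : r 5 = k) (h1 : r 1 = n)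
    (h0 : r 0 + n * k = p.sizes.L) :
    ∃ t r', t ≤ 20 * (k + 1) ∧ Run p.Ok addProduct ⟨r, p.cell⟩ t ⟨r', p.cell⟩ ∧
      p.RegsFit r' ∧ r' 0 = p.sizes.L ∧ ∀ x, x ≠ 0 → x ≠ 5 → r' x = r x := by
  induction k generalizing r with
  | zero => exact ⟨_, r, by simp [Expr.cost], .whileFalse h5, h, h0, fun _ _ _ => rfl⟩
  | succ k ih =>
    rw [Nat.mul_succ] at h0
    have hpos := Nat.two_pow_pos n
    have hLW : p.sizes.L ≤ p.sizes.W := by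
      simp only [sizes]
      omega
    have hk : k + 1 ≤ p.sizes.W := h5 ▸ h.1 5
    have ha := h.assign (x := 0) (e := .add (.reg 0) (.reg 1)) (r 0 + n) (by decide)
      (by simp [Expr.eval, h1]) (by omega)
    have hf := h.update (x := 0) (v := r 0 + n) (by decide) (by omega)
    have hb := hf.assign (x := 5) (e := .sub (.reg 5) (.lit 1)) k (by decide)
      (by simp [Expr.eval, h5]) (by omega)
    obtain ⟨t, r', ht, hr, hf', h0', hs⟩ := ih (hf.update (x := 5) (v := k) (by decide) (by omega))
      (by simp) (by simp [h1]) (by simp; omega)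
    refine ⟨_, r', ?_, .whileTrue ?_ (ha.seq hb) hr, hf', h0', fun x hx hx' => ?_⟩
    · simp only [Expr.cost]
      omega
    · simp [Expr.eval, h5]
    · simp [hs x hx hx', hx, hx']

/-- Read the sizes and compute the address of the arrays. -/
def prelude : Program :=
  .seq (.assign 1 (.load (.lit 0))) <| .seq (.assign 2 (.load (.lit 1))) <|
  .seq (.assign 3 (.load (.lit 2))) <| .seq (.assign 5 (.reg 3)) <|
  .seq (.assign 0 (.add (.lit 3) (.add (.reg 1) (.add (.reg 2) (.reg 2))))) addProduct

variable (p)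

lemma regsFit_zero : p.RegsFit fun _ => 0 := ⟨fun _ => Nat.zero_le _, fun _ _ => rfl⟩

lemma prelude_run : ∃ t r, t ≤ 20 * (p.winList.length + 1) + 50 ∧
    Run p.Ok prelude (initialState p.encode) t ⟨r, p.cell⟩ ∧ p.RegsFit r ∧ r 0 = p.sizes.L ∧
      p.Start (p.abs r) := by
  have hW := p.le_W
  have hpos := Nat.two_pow_pos n
  have h := p.regsFit_zero
  have h₁ := h.assign (x := 1) (e := .load (.lit 0)) n (by decide) p.cell_zero (by omega)
  replace h := h.update (x := 1) (v := n) (by decide) (by omega)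
  have h₂ := h.assign (x := 2) (e := .load (.lit 1)) p.edgeList.length (by decide) p.cell_one
    (by omega)
  replace h := h.update (x := 2) (v := p.edgeList.length) (by decide) (by omega)
  have h₃ := h.assign (x := 3) (e := .load (.lit 2)) p.winList.length (by decide) p.cell_two
    (by omega)
  replace h := h.update (x := 3) (v := p.winList.length) (by decide) (by omega)
  have h₄ := h.assign (x := 5) (e := .reg 3) p.winList.length (by decide) (by simp [Expr.eval])
    (by omega)
  replace h := h.update (x := 5) (v := p.winList.length) (by decide) (by omega)
  have h₅ := h.assign (x := 0) (e := .add (.lit 3) (.add (.reg 1) (.add (.reg 2) (.reg 2))))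
    (3 + n + 2 * p.edgeList.length) (by decide) (by simp [Expr.eval]; omega) (by omega)
  replace h := h.update (x := 0) (v := 3 + n + 2 * p.edgeList.length) (by decide) (by omega)
  obtain ⟨t, r, ht, hr, hf, h0, hs⟩ := addProduct_run p.winList.length h (by simp) (by simp)
    (by simp [sizes])
  refine ⟨_, r, ?_, h₁.seq (h₂.seq (h₃.seq (h₄.seq (h₅.seq hr)))), hf, h0, ?_, ?_, ?_, rfl⟩
  · simp only [Expr.cost]
    omega
  · exact (hs 1 (by decide) (by decide)).trans (by simp)
  · exact (hs 2 (by decide) (by decide)).trans (by simp)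
  · exact (hs 3 (by decide) (by decide)).trans (by simp)

/-- Solve the game once the address of the arrays is known. -/
def compute : Program := block [powers, readOwners, sortEdges, markSets, fillTables, markWinning,
  writeOutput]

variable [NeZero n]

/-- The time is left as the nested sum that the sequence of programs produces; it is estimated in
`time_le`. -/
lemma compute_runs (h : p.Start (p.abs r)) : Runs p.sizes compute (p.abs r)
    ((5 * n + 4) + ((5 * n + 2) + (((11 * p.edgeList.length + 7) * n + 5) +
      (((8 * n + 7) * p.winList.length + 4) + (((2 * ((14 * n + 16 * p.edgeList.length + 21) * n) +
        18 * n + 4 * p.edgeList.length + 44) * 2 ^ n + 2) + (((13 * n + 8 * p.edgeList.length + 18)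
          * 2 ^ n + 2) + ((4 * n + 2) + 1))))))) fun A' => ∀ w : Fin n,
      (A'.inp w = 0 ∨ A'.inp w = 1) ∧ ∀ σ : Fin 2, A'.inp w = σ ↔ G.WinsFrom σ w := by
  refine Runs.block_cons (powers_runs h) ?_
  rintro A₁ ⟨hA₁, h4, hpow⟩
  have h₁ := h.of_same hA₁ (by decide)
  refine Runs.block_cons (readOwners_runs h₁) ?_
  rintro A₂ ⟨hA₂, hown⟩
  have h₂ := h₁.of_same hA₂ (by decide)
  refine Runs.block_cons (sortEdges_runs h₂) ?_
  rintro A₃ ⟨hA₃, hst, hstart⟩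
  have h₃ := h₂.of_same hA₃ (by decide)
  refine Runs.block_cons (markSets_runs h₃ (fun v => ?_) fun j => ?_) ?_
  · rw [hA₃.a 0 (by decide), hA₂.a 0 (by decide), hpow]
  · rw [hA₃.a 13 (by decide), hA₂.a 13 (by decide), hA₁.a 13 (by decide)]
    rfl
  rintro A₄ ⟨hA₄, hwin⟩
  have h₄ := h₃.of_same hA₄ (by decide)
  -- The tables and marks need zero initialization; these arrays have not been touched so far, and
  -- memory behind the input is initially zero.
  have hzero : ∀ i, 4 < i → i ≠ 13 → ∀ j, A₄.a i j = 0 := by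
    intro i hi hi' j
    rw [hA₄.a i (by simp [hi']), hA₃.a i (by simp; omega), hA₂.a i (by simp; omega),
      hA₁.a i (by simp; omega)]
    rfl
  have hstore : ∀ e < p.edgeList.length, A₄.a 3 e = (p.edge e).1 ∧ A₄.a 4 e = (p.edge e).2 := by
    intro e he
    rw [← p.length_sortedEdges] at he
    rw [p.edge_eq le_rfl he, hA₄.a 3 (by decide), hA₄.a 4 (by decide)]
    exact hst.2 e he
  have hE : Env G p.edgeList.length (fun e => (p.edge e).1) (fun e => (p.edge e).2)
      (fun u => (p.sortedEdges u).length) A₄ :=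
    { r1 := h₄.r1
      r2 := h₄.r2
      r4 := by
        rw [hA₄.r 4 (by decide), hA₃.r 4 (by decide), hA₂.r 4 (by decide), h4]
      pow := fun v => by
        rw [hA₄.a 0 (by decide), hA₃.a 0 (by decide), hA₂.a 0 (by decide), hpow]
      own := fun v => by rw [hA₄.a 1 (by decide), hA₃.a 1 (by decide), hown]
      start := fun u hu => by rw [hA₄.a 2 (by decide), hstart u hu]
      src := fun e he => (hstore e he).1
      dst := fun e he => (hstore e he).2
      win := hwin }
  have hT : TableInv G 0 A₄ := fun σ S => by
    rw [hzero _ (by omega) (by omega), if_neg (by simp)]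
  refine Runs.block_cons (fillTables_runs p.fits p.isAdjacency hE hT) ?_
  rintro A₅ ⟨hA₅, hT₅⟩
  have hE₅ := hE.of_same hA₅ (by decide) (by decide)
  refine Runs.block_cons (markWinning_runs p.fits p.isAdjacency hE₅ hT₅ fun j => ?_) ?_
  · rw [hA₅.a 10 (by decide), hzero 10 (by decide) (by decide)]
  rintro A₆ ⟨hA₆, hw⟩
  refine Runs.block_cons (writeOutput_runs p.fits ?_ ?_ hw) fun A' hA' => Runs.block_nil hA'
  · simp only [sizes]
    omega
  · rw [hA₆.r 1 (by decide), hE₅.r1]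

end Presentation

end MullerGame

/-! ### Bounds on time and space -/

lemma Nat.pow_three_le_four_mul_two_pow (n : ℕ) : n ^ 3 ≤ 4 * 2 ^ n := by
  rcases lt_or_ge n 4 with hn | hn
  -- From $n = 4$ on, where equality holds, doubling outpaces the growth of the cube; smaller cases
  -- are checked directly.
  · interval_cases n <;> decide
  · induction n, hn using Nat.le_induction with
    | base => decide
    | succ n hn ih =>
      rw [Nat.pow_succ 2]
      nlinarith [Nat.mul_le_mul_right n hn, Nat.mul_le_mul_right (n * n) hn]

/-- Only the first `B` cells may hold words of `w` bits; all others are charged a constant. -/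
lemma Finset.sum_range_le_of_le_ite {g : ℕ → ℕ} {N B w c : ℕ}
    (h : ∀ x < N, g x ≤ c + if x < B then w else 0) : ∑ x ∈ range N, g x ≤ c * N + B * w := by
  refine (sum_le_sum fun x hx => h x (mem_range.1 hx)).trans ?_
  rw [sum_add_distrib, sum_const, card_range, smul_eq_mul, Nat.mul_comm]
  refine Nat.add_le_add_left ?_ _
  rw [← sum_filter, sum_const, smul_eq_mul]
  refine Nat.mul_le_mul_right _ ((card_le_card fun x hx => ?_).trans (card_range B).le)
  exact mem_range.2 (mem_filter.1 hx).2

lemma RAM.Run.mono {Ok Ok' : State → Prop} (h : ∀ s, Ok s → Ok' s) {p : Program} {s s' : State}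
    {t : ℕ} (hr : Run Ok p s t s') : Run Ok' p s t s' := by
  induction hr with
  | skip s => exact .skip s
  | assign x e s ok => exact .assign x e s (h _ ok)
  | store a e s ok => exact .store a e s (h _ ok)
  | seq _ _ ihp ihq => exact .seq ihp ihq
  | iteTrue he _ ih => exact .iteTrue he ih
  | iteFalse he _ ih => exact .iteFalse he ih
  | whileFalse he => exact .whileFalse he
  | whileTrue he _ _ ihp ihw => exact .whileTrue he ihp ihw

lemma Arena.le_card_edges {n : ℕ} (A : Arena (Fin n)) : n ≤ A.edges.card := by
  choose f hf using A.total
  calc n = (Finset.univ.image fun u => (u, f u)).card := by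
        rw [Finset.card_image_of_injective _ fun u v h => congrArg Prod.fst h, Finset.card_univ,
          Fintype.card_fin]
    _ ≤ A.edges.card := Finset.card_le_card fun e he => by
        obtain ⟨u, -, rfl⟩ := Finset.mem_image.1 he
        exact hf u

lemma Arena.card_edges_le {n : ℕ} (A : Arena (Fin n)) : A.edges.card ≤ n * n :=
  (Finset.card_le_univ _).trans (by simp)

namespace MullerGame

open RAM

/-- With $n \le m$ and at most $2^n$ listed sets, every monomial is at most $2^n n m$; the constant
is generous. -/
lemma time_le {n m f t : ℕ} (hn : 0 < n) (hnm : n ≤ m) (hf : f ≤ t) (ht : 0 < t) :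
    20 * (f + 1) + 50 + unit *
    ((5 * n + 4) + ((5 * n + 2) + (((11 * m + 7) * n + 5) + (((8 * n + 7) * f + 4) +
      (((2 * ((14 * n + 16 * m + 21) * n) + 18 * n + 4 * m + 44) * t + 2) +
        (((13 * n + 8 * m + 18) * t + 2) + ((4 * n + 2) + 1))))))) ≤ 10000000 * (t * n * m) := by
  have hm : 0 < m := hn.trans_le hnm
  have e₁ : 1 ≤ t * n * m := Nat.mul_pos (Nat.mul_pos ht hn) hm
  have e₂ : n * t ≤ t * n * m := by nlinarith [Nat.mul_pos ht hn]
  have e₃ : m * t ≤ t * n * m := by nlinarith [Nat.mul_pos ht hm]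
  have e₄ : n * n * t ≤ t * n * m := by nlinarith [Nat.mul_pos ht hn]
  have e₅ : m * n ≤ t * n * m := by nlinarith [Nat.mul_pos hn hm]
  have e₆ : n * f ≤ n * t := Nat.mul_le_mul_left _ hf
  have e₇ : n ≤ n * t := Nat.le_mul_of_pos_right _ ht
  have e₈ : t ≤ n * t := Nat.le_mul_of_pos_left _ hn
  rw [unit]
  linarith

namespace Presentation

variable {n : ℕ} {G : MullerGame (Fin n)} (p : G.Presentation)

lemma cell_le (a : ℕ) : p.cell a ≤ p.sizes.W := by
  have hW := p.le_W
  have hpos := Nat.two_pow_pos n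
  have hle : ∀ x ∈ p.encode, x ≤ p.sizes.W := by
    intro x hx
    simp only [encode, List.mem_append, List.mem_cons, List.not_mem_nil, or_false, List.mem_ofFn,
      List.mem_flatMap] at hx
    rcases hx with (((rfl | rfl | rfl) | ⟨v, rfl⟩) | ⟨e, -, rfl | rfl⟩) | ⟨X, -, v, rfl⟩
    · omega
    · omega
    · omega
    · have := (G.owner v).2
      omega
    · have := e.1.2
      omega
    · have := e.2.2
      omega
    · split_ifs <;> omega
  rw [cell, List.getD_eq_getElem?_getD]
  by_cases ha : a < p.encode.length
  · rw [List.getElem?_eq_getElem ha]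
    exact hle _ (List.getElem_mem ha)
  · rw [List.getElem?_eq_none (not_lt.1 ha)]
    exact Nat.zero_le _

lemma le_length_edgeList : n ≤ p.edgeList.length := by
  rw [length_edgeList]
  exact G.le_card_edges

lemma length_edgeList_le : p.edgeList.length ≤ n * n := by
  rw [length_edgeList]
  exact G.card_edges_le

/-- With $t = 2^n$, all sizes are at most $t^2$ up to constants, and $16 t^2 \le t^6$; hence six
times $n$ bits. -/
lemma size_W_le (hn : 0 < n) : p.sizes.W.size ≤ 6 * n := by
  rw [Nat.size_le]
  have hlt : n < 2 ^ n := Nat.lt_two_pow_self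
  have hf := p.length_winList_le
  have hm := p.length_edgeList_le
  have ht : 2 ≤ 2 ^ n := by simpa using Nat.pow_le_pow_right (show 0 < 2 by decide) hn
  rw [Nat.mul_comm, Nat.pow_mul]
  simp only [sizes]
  generalize 2 ^ n = t at *
  have h₁ : n * n ≤ t * t := Nat.mul_le_mul hlt.le hlt.le
  have h₂ : n * p.winList.length ≤ t * t := Nat.mul_le_mul hlt.le hf
  have h₃ : 2 * t ≤ t * t := Nat.mul_le_mul_right _ ht
  have h₄ : 16 ≤ t ^ 4 := by simpa using Nat.pow_le_pow_left ht 4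
  have h₅ : 16 * (t * t) ≤ t ^ 6 := (Nat.mul_le_mul_right _ h₄).trans (by ring_nf; rfl)
  omega

variable {p} {s : State} {A : Abs}

lemma size_le (hn : 0 < n) {v : ℕ} (hv : v ≤ p.sizes.W) : v.size ≤ 6 * n :=
  (Nat.size_le_size hv).trans (p.size_W_le hn)

lemma size_le_one {v : ℕ} (hv : v ≤ 1) : v.size ≤ 1 := by
  interval_cases v <;> simp

variable (p) in
lemma one_le_W : 1 ≤ p.sizes.W := by
  have hpos := Nat.two_pow_pos n
  simp only [sizes]
  omega

lemma exists_addr {L a : ℕ} (h : L ≤ a) : ∃ i j, i < 16 ∧ a = L + 16 * j + i :=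
  ⟨(a - L) % 16, (a - L) / 16, Nat.mod_lt _ (by decide), by omega⟩

lemma wordsFit (hn : 0 < n) (hs : Layout p.sizes s A) (hA : Safe p.sizes A) :
    s.WordsFit (6 * n) := by
  have h1 := p.one_le_W
  refine ⟨fun x => size_le hn (by rw [hs.reg]; exact hA.r_le x), fun a => size_le (p := p) hn ?_⟩
  rcases lt_or_ge a p.sizes.L with ha | ha
  · rw [hs.inp a ha]
    exact (hA.inp_le a ha).trans (max_le (p.cell_le a) h1)
  · obtain ⟨i, j, hi, rfl⟩ := exists_addr ha
    rw [hs.arr i j hi]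
    rcases lt_or_ge i 13 with h | h
    · exact hA.word_le i j h
    · exact (hA.bit_le i j h).trans h1

/-- Interleaved arrays share one address range: rows up to $n + m$ may hold words, later rows only
bits. -/
lemma spaceFits (hn : 0 < n) (hs : Layout p.sizes s A) (hA : Safe p.sizes A) :
    s.SpaceFits (10000000 * (G.size + 2 ^ n)) := by
  have hfit := wordsFit hn hs hA
  have hpos := Nat.two_pow_pos n
  refine ⟨40, p.sizes.L + 16 * (2 ^ n + n + p.edgeList.length + 1), fun x hx => ?_, fun a ha => ?_,
    ?_⟩
  · rw [hs.reg, hA.r_zero x hx]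
  · obtain ⟨i, j, hi, rfl⟩ := exists_addr ((Nat.le_add_right _ _).trans ha)
    rw [hs.arr i j hi]
    rcases lt_or_ge i 13 with h | h
    · exact hA.word_zero i j h (by simp only [sizes]; omega)
    · exact hA.bit_zero i j h (by simp only [sizes]; omega)
  rw [Finset.sum_range_add]
  have h₁ := Finset.sum_range_le_of_le_ite (g := fun x => (s.reg x).size + 1) (N := 40) (B := 40)
    (w := 6 * n) (c := 1) fun x hx => by
      have := hfit.1 x
      simp only [if_pos hx]
      omega
  have h₂ := Finset.sum_range_le_of_le_ite (g := fun a => (s.mem a).size + 1) (N := p.sizes.L)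
    (B := 3 + n + 2 * p.edgeList.length) (w := 6 * n) (c := 2) fun a ha => by
      have := hfit.2 a
      split_ifs with h
      · omega
      · have hle := hA.inp_le a ha
        rw [← hs.inp a ha] at hle
        have := size_le_one (hle.trans (max_le (p.cell_le_one (not_lt.1 h)) le_rfl))
        omega
  have h₃ := Finset.sum_range_le_of_le_ite (g := fun a => (s.mem (p.sizes.L + a)).size + 1)
    (N := 16 * (2 ^ n + n + p.edgeList.length + 1)) (B := 16 * (n + p.edgeList.length + 1))
    (w := 6 * n) (c := 2) fun a ha => by
      have := hfit.2 (p.sizes.L + a)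
      split_ifs with h
      · omega
      · obtain ⟨i, j, hi, hj⟩ := exists_addr (Nat.le_add_right p.sizes.L a)
        have hle : s.mem (p.sizes.L + a) ≤ 1 := by
          rw [hj, hs.arr i j hi]
          rcases lt_or_ge i 13 with h' | h'
          · rw [hA.word_zero i j h' (by simp only [sizes]; omega)]
            exact Nat.zero_le _
          · exact hA.bit_le i j h'
        have := size_le_one hle
        omega
  refine (Nat.add_le_add h₁ (Nat.add_le_add h₂ h₃)).trans ?_
  -- The word-sized cells contribute about $n \cdot m \le n^3$ bits, which the term $2^n$ absorbs.
  have hcube := Nat.pow_three_le_four_mul_two_pow n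
  have hm := p.length_edgeList_le
  have hnm := p.le_length_edgeList
  rw [MullerGame.size, ← p.length_edgeList, ← p.length_winList]
  simp only [sizes]
  have e₁ : n * p.edgeList.length ≤ n ^ 3 :=
    (Nat.mul_le_mul_left _ hm).trans (by ring_nf; rfl)
  have e₂ : n * n ≤ n * p.edgeList.length := Nat.mul_le_mul_left _ hnm
  nlinarith

end Presentation

end MullerGame

theorem mainTheorem6 :
    ∃ (p : RAM.Program) (C : ℕ),
      ∀ (n : ℕ), 0 < n → ∀ (G : MullerGame (Fin n)) (P : G.Presentation),
        ∃ s : RAM.State,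
          RAM.HaltsWithin p P.encode
            (C * (2 ^ n * n * G.edges.card)) (C * n) (C * (G.size + 2 ^ n)) s ∧
          ∀ v : Fin n,
            (s.mem v = 0 ∨ s.mem v = 1) ∧
            ∀ σ : Fin 2, s.mem v = (σ : ℕ) ↔ G.WinsFrom σ v := by
  refine ⟨.seq MullerGame.Presentation.prelude MullerGame.Presentation.compute, 10000000,
    fun n hn G P => ?_⟩
  have : NeZero n := ⟨hn.ne'⟩
  obtain ⟨t, r, ht, hr, hf, h0, hst⟩ := P.prelude_run
  obtain ⟨t', s, A, hr', ht', hs, hA, hout⟩ :=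
    P.compute_runs hst hf.safe ⟨r, P.cell⟩ ⟨P.layout_abs r, h0⟩
  -- One invariant covers both phases: it does not require that register `0` already holds the
  -- address of the arrays.
  have hOk : ∀ s, P.Ok s → s.WordsFit (10000000 * n) ∧
      s.SpaceFits (10000000 * (G.size + 2 ^ n)) := by
    rintro s ⟨A, hs, hA⟩
    have h := MullerGame.Presentation.wordsFit hn hs hA
    exact ⟨⟨fun x => (h.1 x).trans (by omega), fun a => (h.2 a).trans (by omega)⟩,
      MullerGame.Presentation.spaceFits hn hs hA⟩
  refine ⟨s, ⟨hOk _ P.regsFit_zero.ok, t + t', ?_, (hr.seq hr').mono hOk⟩, fun v => ?_⟩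
  · rw [← P.length_edgeList]
    exact (Nat.add_le_add ht ht').trans (MullerGame.time_le hn P.le_length_edgeList
      P.length_winList_le (Nat.two_pow_pos n))
  · rw [hs.inp v (by have := v.2; simp only [MullerGame.Presentation.sizes]; omega)]
    exact hout v
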